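/- **Definitions.** For real matrices $S_1\in\mathbb R^{m_1\times n_1}$, $S_2\in\mathbb R^{m_2\times n_2}$, the *1-product* $S_1\otimes S_2\in\mathbb R^{(m_1+m_2)\times n_1n_2}$ is the matrix whose columns are the concatenations of each column of $S_1$ with each column of $S_2$. Let $x_1$ be a row of $S_1$ with entries in $\{0,1\}$. For $a\in\{0,1\}$ let $S_1^a$ be obtained from $S_1$ by deleting the row $x_1$ and all columns whose $x_1$-entry is not $a$. Call $x_1$ a *special row* if neither $S_1^0$ nor $S_1^1$ is empty, that is, $x_1$ contains both a $0$ and a $1$, and $S_1$ has a row other than $x_1$. Define likewise $S_2^a$ for a special row $y_1$ of $S_2$. The *2-product* is $$(S_1,x_1)\otimes_2(S_2,y_1):=\left(\begin{array}{c|c} S_1^0\otimes S_2^0 & S_1^1\otimes S_2^1\\ 0\cdots 0 & 1\cdots 1\end{array}\right).$$ Two matrices are *isomorphic* if one is obtained from the other by permuting rows and columns. A matrix $S$ *is a 2-product* if it is isomorphic to $(S_1,x_1)\otimes_2(S_2,y_1)$ for some real matrices $S_1,S_2$ with special rows $x_1,y_1$. Algorithms are (constant-free) programs for a real random access machine: addition,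 subtraction, multiplication and comparison ($=,<$) of real numbers, addition, truncated subtraction and comparison of natural numbers (used as counters and indices), accesses to array entries, assignments and tests each take one step. **Theorem.** There is an algorithm that, given $m$, $n$ and any matrix $S\in\mathbb R^{m\times n}$, halts after a number of steps bounded by a polynomial in $m$ and $n$, correctly determines whether $S$ is a 2-product and, in case it is, outputs two matrices $S_1,S_2$ together with a special row $x_1$ of $S_1$ and a special row $y_1$ of $S_2$ such that $S$ is isomorphic to $(S_1,x_1)\otimes_2(S_2,y_1)$. -/

import Mathlib

/-! ### Products of matrices -/

/-- The 1-product: the columns are the concatenations of a column of `S₁` with a column of `S₂`,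
one for each pair of column indices. -/
def oneProduct {ι₁ κ₁ ι₂ κ₂ : Type*} (S₁ : Matrix ι₁ κ₁ ℝ) (S₂ : Matrix ι₂ κ₂ ℝ) :
    Matrix (ι₁ ⊕ ι₂) (κ₁ × κ₂) ℝ :=
  Matrix.of fun i j => Sum.elim (fun i₁ => S₁ i₁ j.1) (fun i₂ => S₂ i₂ j.2) i

/-- Two matrices are isomorphic if one is obtained from the other by permuting (renaming) rows
and columns. -/
def MatrixIso {ι κ ι' κ' : Type*} (S : Matrix ι κ ℝ) (T : Matrix ι' κ' ℝ) : Prop :=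
  ∃ (e : ι ≃ ι') (f : κ ≃ κ'), ∀ i j, S i j = T (e i) (f j)

/-- The part `S^a` of `S` determined by its row `x`: remove the row `x` and keep only the columns
whose entry in row `x` is `a`. -/
def rowPart {ι κ : Type*} (S : Matrix ι κ ℝ) (x : ι) (a : ℝ) :
    Matrix {i : ι // i ≠ x} {j : κ // S x j = a} ℝ :=
  S.submatrix Subtype.val Subtype.val

/-- The row `x` of `S` may serve as a special row: it is a 0/1 row, and neither of the two parts
`S^0`, `S^1` is empty, i.e. `x` has both a zero and a one, and `S` has a row other than `x`. -/
structure IsSpecialRow {ι κ : Type*} (S : Matrix ι κ ℝ) (x : ι) : Prop where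
  zero_or_one : ∀ j, S x j = 0 ∨ S x j = 1
  exists_zero : ∃ j, S x j = 0
  exists_one : ∃ j, S x j = 1
  exists_other_row : ∃ i, i ≠ x

/-- The 2-product `(S₁, x₁) ⊗₂ (S₂, y₁)`: the block matrix with blocks `S₁^0 ⊗ S₂^0` and
`S₁^1 ⊗ S₂^1` on top of one last row `0 ⋯ 0 1 ⋯ 1`. -/
def twoProduct {ι₁ κ₁ ι₂ κ₂ : Type*} (S₁ : Matrix ι₁ κ₁ ℝ) (x₁ : ι₁) (S₂ : Matrix ι₂ κ₂ ℝ)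
    (y₁ : ι₂) :
    Matrix (({i : ι₁ // i ≠ x₁} ⊕ {i : ι₂ // i ≠ y₁}) ⊕ Unit)
      (({j : κ₁ // S₁ x₁ j = 0} × {j : κ₂ // S₂ y₁ j = 0}) ⊕
        ({j : κ₁ // S₁ x₁ j = 1} × {j : κ₂ // S₂ y₁ j = 1})) ℝ :=
  Matrix.fromBlocks
    (oneProduct (rowPart S₁ x₁ 0) (rowPart S₂ y₁ 0))
    (oneProduct (rowPart S₁ x₁ 1) (rowPart S₂ y₁ 1))
    (Matrix.of fun _ _ => 0)
    (Matrix.of fun _ _ => 1)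

/-- `S₁`, `S₂` with their rows `x₁`, `y₁` exhibit `S` as a 2-product: both rows are special, and
`S` is isomorphic to `(S₁, x₁) ⊗₂ (S₂, y₁)`. -/
def IsTwoProductOf {m n m₁ n₁ m₂ n₂ : ℕ} (S : Matrix (Fin m) (Fin n) ℝ)
    (S₁ : Matrix (Fin m₁) (Fin n₁) ℝ) (x₁ : Fin m₁)
    (S₂ : Matrix (Fin m₂) (Fin n₂) ℝ) (y₁ : Fin m₂) : Prop :=
  IsSpecialRow S₁ x₁ ∧ IsSpecialRow S₂ y₁ ∧ MatrixIso S (twoProduct S₁ x₁ S₂ y₁)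

/-- `S` is a 2-product. -/
def IsTwoProduct {m n : ℕ} (S : Matrix (Fin m) (Fin n) ℝ) : Prop :=
  ∃ (m₁ n₁ m₂ n₂ : ℕ) (S₁ : Matrix (Fin m₁) (Fin n₁) ℝ) (x₁ : Fin m₁)
    (S₂ : Matrix (Fin m₂) (Fin n₂) ℝ) (y₁ : Fin m₂), IsTwoProductOf S S₁ x₁ S₂ y₁

/-! ### Algorithms on real matrices: a real random access machine with a step count

Programs are finite, constant-free objects, and one and the same program runs on the inputs of all
sizes. The memory consists of two-dimensional arrays of natural numbers (for counting and
indexing) and two-dimensional arrays of real numbers. Natural numbers can be added, subtracted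
(with truncation) and compared, reals can be added, subtracted, multiplied and compared, at unit
cost per operation and per memory access. The only way from reals to natural numbers is
branching on a comparison, and neither rounding nor multiplication of natural numbers is
available as a unit-cost operation. -/

namespace RealRAM

/-- A memory state. The cell `(a, i, j)` is the entry `(i, j)` of the array named `a`. -/
structure State where
  nat : ℕ × ℕ × ℕ → ℕ
  real : ℕ × ℕ × ℕ → ℝ

/-- Expressions for natural numbers; `get a i j` is the entry `(i, j)` of array `a`. -/
inductive NatExpr : Type
  | lit (k : ℕ)
  | get (a : ℕ) (i j : NatExpr)
  | add (e₁ e₂ : NatExpr)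
  | sub (e₁ e₂ : NatExpr)

/-- The value of an expression. -/
def NatExpr.eval (s : State) : NatExpr → ℕ
  | lit k => k
  | get a i j => s.nat (a, i.eval s, j.eval s)
  | add e₁ e₂ => e₁.eval s + e₂.eval s
  | sub e₁ e₂ => e₁.eval s - e₂.eval s

/-- The number of steps for evaluating an expression: one for each node. -/
def NatExpr.cost : NatExpr → ℕ
  | lit _ => 1
  | get _ i j => i.cost + j.cost + 1
  | add e₁ e₂ => e₁.cost + e₂.cost + 1
  | sub e₁ e₂ => e₁.cost + e₂.cost + 1

/-- Expressions for real numbers. The only constants are `0` and `1`. -/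
inductive RealExpr : Type
  | zero
  | one
  | get (a : ℕ) (i j : NatExpr)
  | add (e₁ e₂ : RealExpr)
  | sub (e₁ e₂ : RealExpr)
  | mul (e₁ e₂ : RealExpr)

/-- The value of an expression. -/
noncomputable def RealExpr.eval (s : State) : RealExpr → ℝ
  | zero => 0
  | one => 1
  | get a i j => s.real (a, i.eval s, j.eval s)
  | add e₁ e₂ => e₁.eval s + e₂.eval s
  | sub e₁ e₂ => e₁.eval s - e₂.eval s
  | mul e₁ e₂ => e₁.eval s * e₂.eval s

/-- The number of steps for evaluating an expression: one for each node. -/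
def RealExpr.cost : RealExpr → ℕ
  | zero => 1
  | one => 1
  | get _ i j => i.cost + j.cost + 1
  | add e₁ e₂ => e₁.cost + e₂.cost + 1
  | sub e₁ e₂ => e₁.cost + e₂.cost + 1
  | mul e₁ e₂ => e₁.cost + e₂.cost + 1

/-- Tests. -/
inductive Test : Type
  | natEq (e₁ e₂ : NatExpr)
  | natLt (e₁ e₂ : NatExpr)
  | realEq (e₁ e₂ : RealExpr)
  | realLt (e₁ e₂ : RealExpr)
  | not (b : Test)
  | and (b₁ b₂ : Test)

/-- The truth value of a test. -/
def Test.Holds (s : State) : Test → Prop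
  | natEq e₁ e₂ => e₁.eval s = e₂.eval s
  | natLt e₁ e₂ => e₁.eval s < e₂.eval s
  | realEq e₁ e₂ => e₁.eval s = e₂.eval s
  | realLt e₁ e₂ => e₁.eval s < e₂.eval s
  | not b => ¬ b.Holds s
  | and b₁ b₂ => b₁.Holds s ∧ b₂.Holds s

/-- The number of steps for evaluating a test. -/
def Test.cost : Test → ℕ
  | natEq e₁ e₂ => e₁.cost + e₂.cost + 1
  | natLt e₁ e₂ => e₁.cost + e₂.cost + 1
  | realEq e₁ e₂ => e₁.cost + e₂.cost + 1
  | realLt e₁ e₂ => e₁.cost + e₂.cost + 1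
  | not b => b.cost + 1
  | and b₁ b₂ => b₁.cost + b₂.cost + 1

/-- Programs: doing nothing, assignments to an array entry, sequential composition, branching, and
unbounded while loops. -/
inductive Program : Type
  | skip
  | setNat (a : ℕ) (i j : NatExpr) (e : NatExpr)
  | setReal (a : ℕ) (i j : NatExpr) (e : RealExpr)
  | seq (P Q : Program)
  | cond (b : Test) (P Q : Program)
  | loop (b : Test) (P : Program)

/-- `Exec P s s' t`: started in the state `s`, the program `P` halts in the state `s'` after exactly
`t` steps. -/
inductive Exec : Program → State → State → ℕ → Prop
  | skip (s : State) : Exec .skip s s 1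
  | setNat (a : ℕ) (i j e : NatExpr) (s : State) :
      Exec (.setNat a i j e) s
        { s with nat := Function.update s.nat (a, i.eval s, j.eval s) (e.eval s) }
        (i.cost + j.cost + e.cost + 1)
  | setReal (a : ℕ) (i j : NatExpr) (e : RealExpr) (s : State) :
      Exec (.setReal a i j e) s
        { s with real := Function.update s.real (a, i.eval s, j.eval s) (e.eval s) }
        (i.cost + j.cost + e.cost + 1)
  | seq {P Q : Program} {s s' s'' : State} {t t' : ℕ} :
      Exec P s s' t → Exec Q s' s'' t' → Exec (.seq P Q) s s'' (t + t')
  | cond_true {b : Test} {P Q : Program} {s s' : State} {t : ℕ} :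
      b.Holds s → Exec P s s' t → Exec (.cond b P Q) s s' (b.cost + t)
  | cond_false {b : Test} {P Q : Program} {s s' : State} {t : ℕ} :
      ¬ b.Holds s → Exec Q s s' t → Exec (.cond b P Q) s s' (b.cost + t)
  | loop_done {b : Test} {P : Program} {s : State} :
      ¬ b.Holds s → Exec (.loop b P) s s b.cost
  | loop_step {b : Test} {P : Program} {s s' s'' : State} {t t' : ℕ} :
      b.Holds s → Exec P s s' t → Exec (.loop b P) s' s'' t' →
        Exec (.loop b P) s s'' (b.cost + t + t')

/-- The initial state on the input `S`: the cells `(0, 0, 0)` and `(1, 0, 0)` of the natural memory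
hold the numbers `m` of rows and `n` of columns, the real array `0` holds the entries of `S`, and
all the other cells hold zero. -/
noncomputable def input {m n : ℕ} (S : Matrix (Fin m) (Fin n) ℝ) : State where
  nat c := if c = (0, 0, 0) then m else if c = (1, 0, 0) then n else 0
  real c := if h : c.1 = 0 ∧ c.2.1 < m ∧ c.2.2 < n then S ⟨c.2.1, h.2.1⟩ ⟨c.2.2, h.2.2⟩ else 0

/-- The answer (`1` for yes, `0` for no) given by a final state. -/
def State.answer (s : State) : ℕ := s.nat (0, 0, 0)

/-- The upper left `m × n` corner of the real array `a`, as a matrix. -/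
def State.matrix (s : State) (a m n : ℕ) : Matrix (Fin m) (Fin n) ℝ :=
  Matrix.of fun i j => s.real (a, i, j)

/-- A final state outputs the matrices `S₁`, `S₂` and their rows `x₁`, `y₁`: the cells `(k, 0, 0)`,
`k = 1, …, 6`, of the natural memory hold the numbers `m₁, n₁` of rows and columns of `S₁`, the
numbers `m₂, n₂` of rows and columns of `S₂`, and the (zero-based) indices of `x₁` and `y₁`; the real
arrays `1` and `2` hold the entries of `S₁` and `S₂`. -/
def State.Outputs (s : State) {m₁ n₁ m₂ n₂ : ℕ} (S₁ : Matrix (Fin m₁) (Fin n₁) ℝ) (x₁ : Fin m₁)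
    (S₂ : Matrix (Fin m₂) (Fin n₂) ℝ) (y₁ : Fin m₂) : Prop :=
  s.nat (1, 0, 0) = m₁ ∧ s.nat (2, 0, 0) = n₁ ∧ s.nat (3, 0, 0) = m₂ ∧ s.nat (4, 0, 0) = n₂ ∧
  s.nat (5, 0, 0) = x₁ ∧ s.nat (6, 0, 0) = y₁ ∧
  s.matrix 1 m₁ n₁ = S₁ ∧ s.matrix 2 m₂ n₂ = S₂

end RealRAM

/-! ### Running programs within a time bound -/

/-! Fix a candidate `r` for the special row and consider a uniformly random column among those with
a given entry in row `r`. The matrix is a 2-product with special row `r` exactly if `r` is a 0/1 row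
containing both values and the remaining rows divide into two nonempty sets `P`, `Q` on which the
random column has independent parts, for each value in row `r`. In counts: if a pattern on `P`
occurs `p` times, a pattern on `Q` occurs `q` times, both together occur `j` times, and `N` columns
have the given entry, then `p * q = j * N` (`IndRows`, `CondInd`). Necessity is
`IsTwoProduct.exists_condInd`.

There are exponentially many pairs `P`, `Q`, but the sets of rows independent of their complement
are closed under complement and union, so they are the unions of the classes of one finest partition
(`condInd_iff_closed`). The partition is built by adding the rows one at a time: the old classes
that the new row `v` ties to other rows are merged with `v`, and the others survive. The row `r` is
constant under the conditioning and forms a class of its own, so if any division exists, then a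
single class can be split off (`exists_class_condInd`).

For sufficiency the multiplicities have to be distributed to two integral factors. With `g` the gcd
of the multiplicities `p` and `N = g * s`, the number `s` divides every `q`, because `N` divides
every product `p * q` (`IndRows.exists_factor`). Keeping `p / g` copies on the left and `q / s`
copies on the right gives products `p * q / N = j`. As `g, s ≤ n`, no gcd is computed: the four
divisors, two for each value in row `r`, are found by trial.

The machine thus tries all `r`, all representatives `w` of a class and all four divisors, at most `m
^ 2 * n ^ 4` candidates, and checks `Splits` for each. A candidate that passes yields factors
(`Splits.isTwoProductOf`), and a 2-product has one that passes (`exists_splits`). All conditions are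
formulas comparing products of two counts over bounded ranges; a fixed formula is evaluated in
polynomial time (`Fm.runs_compile`). -/

/-- The number of all `k < n` with `p k`. -/
noncomputable def cnt (n : ℕ) (p : ℕ → Prop) : ℕ := {k | k < n ∧ p k}.ncard

theorem cnt_eq_card (n : ℕ) (p : ℕ → Prop) [DecidablePred p] :
    cnt n p = ((Finset.range n).filter p).card := by
  rw [cnt, ← Set.ncard_coe_finset]
  congr 1
  ext k
  simp

@[simp] theorem cnt_zero (p : ℕ → Prop) : cnt 0 p = 0 := by simp [cnt]

open Classical in
theorem cnt_succ (n : ℕ) (p : ℕ → Prop) : cnt (n + 1) p = cnt n p + if p n then 1 else 0 := by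
  rw [cnt_eq_card, cnt_eq_card, Finset.range_add_one, Finset.filter_insert]
  split_ifs
  · rw [Finset.card_insert_of_notMem (by simp)]
  · rfl

namespace RealRAM

/-! ### A time-bounded Hoare calculus -/

/-- Started in `s`, the program `P` halts within `T` steps in a state that satisfies `Q`. -/
def Runs (P : Program) (s : State) (Q : State → Prop) (T : ℕ) : Prop :=
  ∃ s' t, Exec P s s' t ∧ t ≤ T ∧ Q s'

/-- Store the natural number `x` in the cell `(a, i, j)`. -/
def State.setN (s : State) (a i j x : ℕ) : State :=
  { s with nat := Function.update s.nat (a, i, j) x }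

/-- Store the real number `x` in the cell `(a, i, j)`. -/
noncomputable def State.setR (s : State) (a i j : ℕ) (x : ℝ) : State :=
  { s with real := Function.update s.real (a, i, j) x }

@[simp] theorem State.setN_nat (s : State) (a i j x : ℕ) (c : ℕ × ℕ × ℕ) :
    (s.setN a i j x).nat c = if c = (a, i, j) then x else s.nat c := by
  simp [State.setN, Function.update_apply]

@[simp] theorem State.setN_real (s : State) (a i j x : ℕ) (c : ℕ × ℕ × ℕ) :
    (s.setN a i j x).real c = s.real c := rfl

@[simp] theorem State.setR_real (s : State) (a i j : ℕ) (x : ℝ) (c : ℕ × ℕ × ℕ) :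
    (s.setR a i j x).real c = if c = (a, i, j) then x else s.real c := by
  simp [State.setR, Function.update_apply]

@[simp] theorem State.setR_nat (s : State) (a i j : ℕ) (x : ℝ) (c : ℕ × ℕ × ℕ) :
    (s.setR a i j x).nat c = s.nat c := rfl

theorem Runs.mono {P : Program} {s : State} {Q Q' : State → Prop} {T T' : ℕ}
    (h : Runs P s Q T) (hQ : ∀ s', Q s' → Q' s') (hT : T ≤ T') : Runs P s Q' T' := by
  obtain ⟨s', t, h1, h2, h3⟩ := h
  exact ⟨s', t, h1, h2.trans hT, hQ _ h3⟩

theorem Runs.skip {s : State} {Q : State → Prop} (h : Q s) : Runs .skip s Q 1 :=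
  ⟨s, 1, .skip s, le_rfl, h⟩

theorem Runs.setNat {a : ℕ} {i j e : NatExpr} {s : State} {Q : State → Prop}
    (h : Q (s.setN a (i.eval s) (j.eval s) (e.eval s))) :
    Runs (.setNat a i j e) s Q (i.cost + j.cost + e.cost + 1) :=
  ⟨_, _, .setNat a i j e s, le_rfl, h⟩

theorem Runs.setReal {a : ℕ} {i j : NatExpr} {e : RealExpr} {s : State} {Q : State → Prop}
    (h : Q (s.setR a (i.eval s) (j.eval s) (e.eval s))) :
    Runs (.setReal a i j e) s Q (i.cost + j.cost + e.cost + 1) :=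
  ⟨_, _, .setReal a i j e s, le_rfl, h⟩

theorem Runs.seq {P P' : Program} {s : State} {Q R : State → Prop} {T T' : ℕ}
    (h : Runs P s Q T) (h' : ∀ s', Q s' → Runs P' s' R T') :
    Runs (.seq P P') s R (T + T') := by
  obtain ⟨s', t, h1, h2, h3⟩ := h
  obtain ⟨s'', t', h4, h5, h6⟩ := h' s' h3
  exact ⟨s'', t + t', .seq h1 h4, by omega, h6⟩

theorem Runs.cond {b : Test} {P P' : Program} {s : State} {Q : State → Prop} {T T' : ℕ}
    (h : b.Holds s → Runs P s Q T) (h' : ¬ b.Holds s → Runs P' s Q T') :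
    Runs (.cond b P P') s Q (b.cost + T + T') := by
  by_cases hb : b.Holds s
  · obtain ⟨s', t, h1, h2, h3⟩ := h hb
    exact ⟨s', _, .cond_true hb h1, by omega, h3⟩
  · obtain ⟨s', t, h1, h2, h3⟩ := h' hb
    exact ⟨s', _, .cond_false hb h1, by omega, h3⟩

/-- The content of the register `a`, that is, of the cell `(a, 0, 0)`. -/
abbrev reg (a : ℕ) : NatExpr := .get a (.lit 0) (.lit 0)

/-- Assign to the register `a`. -/
abbrev setReg (a : ℕ) (e : NatExpr) : Program := .setNat a (.lit 0) (.lit 0) e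

/-- Run `P` for the register `a` running from `0` up to the content of the register `b`. -/
def forProg (a b : ℕ) (P : Program) : Program :=
  .seq (setReg a (.lit 0))
    (.loop (.natLt (reg a) (reg b)) (.seq P (setReg a (.add (reg a) (.lit 1)))))

/-- The invariant `I k` describes the state once the counter holds `k`. The overhead per round
consists of the test (7 steps) and the increment (8 steps); the remaining 11 steps are the
initialisation and the last, failing test. -/
theorem Runs.for {a b N T : ℕ} {P : Program} {s : State} (hab : b ≠ a)
    (hN : s.nat (b, 0, 0) = N) (I : ℕ → State → Prop) (h0 : I 0 (s.setN a 0 0 0))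
    (hstep : ∀ k < N, ∀ s', I k s' → s'.nat (a, 0, 0) = k → s'.nat (b, 0, 0) = N →
      Runs P s' (fun s'' => s''.nat (a, 0, 0) = k ∧ s''.nat (b, 0, 0) = N ∧
        I (k + 1) (s''.setN a 0 0 (k + 1))) T) :
    Runs (forProg a b P) s (I N) (N * (T + 15) + 11) := by
  have main : ∀ d k, d + k = N → ∀ s', I k s' → s'.nat (a, 0, 0) = k → s'.nat (b, 0, 0) = N →
      Runs (.loop (.natLt (reg a) (reg b)) (.seq P (setReg a (.add (reg a) (.lit 1))))) s'
        (I N) (d * (T + 15) + 7) := by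
    intro d
    induction d with
    | zero =>
      intro k hk s' hI ha hb
      refine ⟨s', _, .loop_done ?_, ?_, ?_⟩
      · simp only [Test.Holds, NatExpr.eval, ha, hb]; omega
      · simp [Test.cost, NatExpr.cost]
      · rwa [← hk, Nat.zero_add]
    | succ d ih =>
      intro k hk s' hI ha hb
      obtain ⟨s₁, t₁, h1, h2, h3, h4, h5⟩ := hstep k (by omega) s' hI ha hb
      obtain ⟨s₂, t₂, g1, g2, g3⟩ := ih (k + 1) (by omega) _ h5 (by simp) (by simp [hab, h4])
      refine ⟨s₂, _, .loop_step (t' := t₂) ?_ (.seq h1 (.setNat _ _ _ _ _)) ?_, ?_, g3⟩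
      · simp only [Test.Holds, NatExpr.eval, ha, hb]; omega
      · simpa [State.setN, NatExpr.eval, h3] using g1
      · simp only [Test.cost, NatExpr.cost]
        rw [Nat.succ_mul]; omega
  have := main N 0 rfl _ h0 (by simp) (by simp [hab, hN])
  refine (Runs.seq (T' := N * (T + 15) + 7)
    (Runs.setNat (Q := fun s' => s' = s.setN a 0 0 0) rfl) ?_).mono (fun _ h => h) ?_
  · rintro s' rfl; exact this
  · simp only [NatExpr.cost]; omega

/-! ### Polynomial bounds -/

/-- Functions bounded by a polynomial. -/
def PolyBdd (f : ℕ → ℕ) : Prop := ∃ C k : ℕ, ∀ B, f B ≤ C * (B + 1) ^ k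

theorem PolyBdd.const (c : ℕ) : PolyBdd fun _ => c := ⟨c, 0, by simp⟩

theorem PolyBdd.id : PolyBdd fun B => B := ⟨1, 1, by simp⟩

theorem PolyBdd.mul {f g : ℕ → ℕ} (hf : PolyBdd f) (hg : PolyBdd g) :
    PolyBdd fun B => f B * g B := by
  obtain ⟨C, k, h⟩ := hf
  obtain ⟨D, l, h'⟩ := hg
  refine ⟨C * D, k + l, fun B => (Nat.mul_le_mul (h B) (h' B)).trans (le_of_eq ?_)⟩
  ring

theorem PolyBdd.add {f g : ℕ → ℕ} (hf : PolyBdd f) (hg : PolyBdd g) :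
    PolyBdd fun B => f B + g B := by
  obtain ⟨C, k, h⟩ := hf
  obtain ⟨D, l, h'⟩ := hg
  refine ⟨C + D, k + l, fun B => (Nat.add_le_add (h B) (h' B)).trans ?_⟩
  rw [Nat.add_mul]
  exact Nat.add_le_add
    (Nat.mul_le_mul_left _ (Nat.pow_le_pow_right (by omega) (by omega)))
    (Nat.mul_le_mul_left _ (Nat.pow_le_pow_right (by omega) (by omega)))

/-! ### Formulas with bounded counting and their evaluation -/

/-- Formulas: tests, their Boolean combinations, and comparisons of products of two counts. -/
inductive Fm : Type
  | test (b : Test)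
  | not (φ : Fm)
  | and (φ ψ : Fm)
  | cntLt (b : ℕ) (φ₁ φ₂ φ₃ φ₄ : Fm)

/-- The truth value at level `d`. A count at level `d` binds the register `d`, which runs up to the
content of the register `b`. -/
def Fm.Holds : Fm → ℕ → State → Prop
  | .test b, _, s => b.Holds s
  | .not φ, d, s => ¬ φ.Holds d s
  | .and φ ψ, d, s => φ.Holds d s ∧ ψ.Holds d s
  | .cntLt b φ₁ φ₂ φ₃ φ₄, d, s =>
    cnt (s.nat (b, 0, 0)) (fun k => φ₁.Holds (d + 1) (s.setN d 0 0 k)) *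
      cnt (s.nat (b, 0, 0)) (fun k => φ₂.Holds (d + 1) (s.setN d 0 0 k)) <
    cnt (s.nat (b, 0, 0)) (fun k => φ₃.Holds (d + 1) (s.setN d 0 0 k)) *
      cnt (s.nat (b, 0, 0)) (fun k => φ₄.Holds (d + 1) (s.setN d 0 0 k))

/-- All natural arrays read have names below `d`. -/
def NatExpr.WF (d : ℕ) : NatExpr → Prop
  | lit _ => True
  | get a i j => a < d ∧ i.WF d ∧ j.WF d
  | add e₁ e₂ => e₁.WF d ∧ e₂.WF d
  | sub e₁ e₂ => e₁.WF d ∧ e₂.WF d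

/-- All natural arrays read have names below `d`, all real arrays read have names below `20`. -/
def RealExpr.WF (d : ℕ) : RealExpr → Prop
  | zero => True
  | one => True
  | get a i j => a < 20 ∧ i.WF d ∧ j.WF d
  | add e₁ e₂ => e₁.WF d ∧ e₂.WF d
  | sub e₁ e₂ => e₁.WF d ∧ e₂.WF d
  | mul e₁ e₂ => e₁.WF d ∧ e₂.WF d

/-- All natural arrays read have names below `d`, all real arrays read have names below `20`. -/
def Test.WF (d : ℕ) : Test → Prop
  | natEq e₁ e₂ => e₁.WF d ∧ e₂.WF d
  | natLt e₁ e₂ => e₁.WF d ∧ e₂.WF d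
  | realEq e₁ e₂ => e₁.WF d ∧ e₂.WF d
  | realLt e₁ e₂ => e₁.WF d ∧ e₂.WF d
  | not b => b.WF d
  | and b₁ b₂ => b₁.WF d ∧ b₂.WF d

/-- Well-formed formulas at level `d`. -/
def Fm.WF : Fm → ℕ → Prop
  | .test b, d => b.WF d
  | .not φ, d => φ.WF d
  | .and φ ψ, d => φ.WF d ∧ ψ.WF d
  | .cntLt b φ₁ φ₂ φ₃ φ₄, d => (b = 10 ∨ b = 11) ∧
      φ₁.WF (d + 1) ∧ φ₂.WF (d + 1) ∧ φ₃.WF (d + 1) ∧ φ₄.WF (d + 1)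

/-! ### Frame conditions for the evaluation of formulas -/

/-- The two states agree except for the registers from `d` on and the real arrays from `e` on. -/
def Agree (d e : ℕ) (s s' : State) : Prop :=
  (∀ c : ℕ × ℕ × ℕ, c.1 < d ∨ c.2 ≠ (0, 0) → s'.nat c = s.nat c) ∧
    ∀ c : ℕ × ℕ × ℕ, c.1 < e → s'.real c = s.real c

theorem Agree.refl (d e : ℕ) (s : State) : Agree d e s s := ⟨fun _ _ => rfl, fun _ _ => rfl⟩

theorem Agree.trans {d e : ℕ} {s s' s'' : State} (h : Agree d e s s') (h' : Agree d e s' s'') :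
    Agree d e s s'' :=
  ⟨fun c hc => (h'.1 c hc).trans (h.1 c hc), fun c hc => (h'.2 c hc).trans (h.2 c hc)⟩

theorem Agree.mono {d e d' e' : ℕ} {s s' : State} (h : Agree d e s s') (hd : d' ≤ d)
    (he : e' ≤ e) : Agree d' e' s s' :=
  ⟨fun c hc => h.1 c (hc.imp (fun h => by omega) id), fun c hc => h.2 c (by omega)⟩

theorem Agree.nat_reg {d e : ℕ} {s s' : State} (h : Agree d e s s') {a : ℕ} (ha : a < d)
    (i j : ℕ) : s'.nat (a, i, j) = s.nat (a, i, j) := h.1 _ (Or.inl ha)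

theorem Agree.real_cell {d e : ℕ} {s s' : State} (h : Agree d e s s') {a : ℕ} (ha : a < e)
    (i j : ℕ) : s'.real (a, i, j) = s.real (a, i, j) := h.2 _ ha

theorem agree_setN {d e a x : ℕ} (ha : d ≤ a) (s : State) : Agree d e s (s.setN a 0 0 x) := by
  refine ⟨fun c hc => ?_, fun c _ => rfl⟩
  obtain ⟨c1, c2, c3⟩ := c
  rw [State.setN_nat, if_neg]
  rintro ⟨⟩
  rcases hc with h | h
  · simp only at h; omega
  · exact h rfl

theorem agree_setR {d e a i j : ℕ} {x : ℝ} (ha : e ≤ a) (s : State) :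
    Agree d e s (s.setR a i j x) := by
  refine ⟨fun c _ => rfl, fun c hc => ?_⟩
  obtain ⟨c1, c2, c3⟩ := c
  rw [State.setR_real, if_neg]
  rintro ⟨⟩
  simp only at hc; omega

theorem NatExpr.eval_congr {d e : ℕ} {s s' : State} (h : Agree d e s s') (x : NatExpr)
    (hx : x.WF d) : x.eval s' = x.eval s := by
  induction x with
  | lit k => rfl
  | get a i j hi hj =>
    obtain ⟨h1, h2, h3⟩ := hx
    simp only [NatExpr.eval, hi h2, hj h3]
    exact h.1 _ (Or.inl h1)
  | add x y hx' hy => simp only [NatExpr.eval, hx' hx.1, hy hx.2]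
  | sub x y hx' hy => simp only [NatExpr.eval, hx' hx.1, hy hx.2]

theorem RealExpr.eval_congr {d : ℕ} {s s' : State} (h : Agree d 20 s s') (x : RealExpr)
    (hx : x.WF d) : x.eval s' = x.eval s := by
  induction x with
  | zero => rfl
  | one => rfl
  | get a i j =>
    obtain ⟨h1, h2, h3⟩ := hx
    simp only [RealExpr.eval, NatExpr.eval_congr h _ h2, NatExpr.eval_congr h _ h3]
    exact h.2 _ h1
  | add x y hx' hy => simp only [RealExpr.eval, hx' hx.1, hy hx.2]
  | sub x y hx' hy => simp only [RealExpr.eval, hx' hx.1, hy hx.2]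
  | mul x y hx' hy => simp only [RealExpr.eval, hx' hx.1, hy hx.2]

theorem Test.holds_congr {d : ℕ} {s s' : State} (h : Agree d 20 s s') (b : Test)
    (hb : b.WF d) : b.Holds s' ↔ b.Holds s := by
  induction b with
  | natEq x y => simp only [Test.Holds, NatExpr.eval_congr h _ hb.1, NatExpr.eval_congr h _ hb.2]
  | natLt x y => simp only [Test.Holds, NatExpr.eval_congr h _ hb.1, NatExpr.eval_congr h _ hb.2]
  | realEq x y =>
    simp only [Test.Holds, RealExpr.eval_congr h _ hb.1, RealExpr.eval_congr h _ hb.2]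
  | realLt x y =>
    simp only [Test.Holds, RealExpr.eval_congr h _ hb.1, RealExpr.eval_congr h _ hb.2]
  | not b ih => simp only [Test.Holds, ih hb]
  | and b c ihb ihc => simp only [Test.Holds, ihb hb.1, ihc hb.2]

theorem Agree.setN {d e : ℕ} {s s' : State} (h : Agree d e s s') (k : ℕ) :
    Agree (d + 1) e (s.setN d 0 0 k) (s'.setN d 0 0 k) := by
  refine ⟨fun c hc => ?_, fun c hc => h.2 c hc⟩
  obtain ⟨c1, c2, c3⟩ := c
  simp only [State.setN_nat]
  split_ifs with h1
  · rfl
  · refine h.1 _ ?_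
    rcases hc with hc | hc
    · rcases Nat.lt_succ_iff_lt_or_eq.1 hc with hc | hc
      · exact Or.inl hc
      · right
        rintro h2
        simp_all
    · exact Or.inr hc

/-- Evaluation writes only to registers and real arrays that a well-formed formula at level `d` does
not read as free input, so that subformulas evaluated one after the other do not disturb each other.
-/
theorem Fm.holds_congr (φ : Fm) : ∀ {d : ℕ} {s s' : State}, 20 ≤ d → Agree d 20 s s' → φ.WF d →
    (φ.Holds d s' ↔ φ.Holds d s) := by
  induction φ with
  | test b => exact fun _ h hw => Test.holds_congr h b hw
  | not φ ih => exact fun hd h hw => not_congr (ih hd h hw)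
  | and φ ψ ih1 ih2 => exact fun hd h hw => and_congr (ih1 hd h hw.1) (ih2 hd h hw.2)
  | cntLt b φ₁ φ₂ φ₃ φ₄ h1 h2 h3 h4 =>
    intro d s s' hd h hw
    obtain ⟨hb, w1, w2, w3, w4⟩ := hw
    have hb' : s'.nat (b, 0, 0) = s.nat (b, 0, 0) := h.nat_reg (by omega) _ _
    have hd' : 20 ≤ d + 1 := by omega
    simp only [Fm.Holds, hb', fun k => h1 hd' (h.setN k) w1, fun k => h2 hd' (h.setN k) w2,
      fun k => h3 hd' (h.setN k) w3, fun k => h4 hd' (h.setN k) w4]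

/-! ### Compilation of formulas -/

/-- The cell `(a, i, 0)` of the real memory. -/
abbrev rcell (a i : ℕ) : RealExpr := .get a (.lit i) (.lit 0)

/-- Count in the cell `(d, q, 0)` of the real memory, for how many `k` below the content of the
register `b` the program `P` puts `1` and not `0` into the cell `(d + 1, 0, 0)`. -/
def countProg (d b q : ℕ) (P : Program) : Program :=
  .seq (.setReal d (.lit q) (.lit 0) .zero)
    (forProg d b (.seq P (.setReal d (.lit q) (.lit 0) (.add (rcell d q) (rcell (d + 1) 0)))))

/-- A program evaluating a formula at level `d`: it puts `1` or `0` into the cell `(d, 0, 0)` of the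
real memory. -/
def Fm.compile : Fm → ℕ → Program
  | .test b, d => .cond b (.setReal d (.lit 0) (.lit 0) .one) (.setReal d (.lit 0) (.lit 0) .zero)
  | .not φ, d => .seq (φ.compile d) (.setReal d (.lit 0) (.lit 0) (.sub .one (rcell d 0)))
  | .and φ ψ, d =>
    .seq (φ.compile d) (.cond (.realEq (rcell d 0) .one) (ψ.compile d) .skip)
  | .cntLt b φ₁ φ₂ φ₃ φ₄, d =>
    .seq (countProg d b 1 (φ₁.compile (d + 1))) <|
    .seq (countProg d b 2 (φ₂.compile (d + 1))) <|
    .seq (countProg d b 3 (φ₃.compile (d + 1))) <|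
    .seq (countProg d b 4 (φ₄.compile (d + 1))) <|
    .cond (.realLt (.mul (rcell d 1) (rcell d 2)) (.mul (rcell d 3) (rcell d 4)))
      (.setReal d (.lit 0) (.lit 0) .one) (.setReal d (.lit 0) (.lit 0) .zero)

/-- A bound for the time needed to evaluate a formula, if all counts run up to `B` at most. -/
def Fm.time : Fm → ℕ → ℕ
  | .test b, _ => b.cost + 20
  | .not φ, B => φ.time B + 20
  | .and φ ψ, B => φ.time B + ψ.time B + 20
  | .cntLt _ φ₁ φ₂ φ₃ φ₄, B =>
    B * (φ₁.time B + 30) + B * (φ₂.time B + 30) + B * (φ₃.time B + 30) + B * (φ₄.time B + 30) + 200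

/-- Each count contributes one factor `B`, so the degree is bounded by the nesting depth of counts,
which is fixed with the formula. -/
theorem Fm.polyBdd_time (φ : Fm) : PolyBdd φ.time := by
  induction φ with
  | test b => exact .const _
  | not φ h => exact h.add (.const _)
  | and φ ψ h h' => exact (h.add h').add (.const _)
  | cntLt b φ₁ φ₂ φ₃ φ₄ h1 h2 h3 h4 =>
    exact (((((PolyBdd.id.mul (h1.add (.const 30)))).add (PolyBdd.id.mul (h2.add (.const 30)))).add
      (PolyBdd.id.mul (h3.add (.const 30)))).add (PolyBdd.id.mul (h4.add (.const 30)))).add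
      (.const 200)

open Classical in
-- The running total is kept in the cell `(d, q, 0)`. Other cells of array `d` are preserved, which
-- lets four counts of the same level be stored side by side.
theorem runs_countProg {d b q N B T : ℕ} {P : Program} {s : State} {p : ℕ → Prop}
    (hb : b < d) (hN : s.nat (b, 0, 0) = N) (hB : N ≤ B)
    (hP : ∀ k < N, ∀ s', Agree d d s s' → s'.nat (d, 0, 0) = k →
      Runs P s' (fun s'' => Agree (d + 1) (d + 1) s' s'' ∧
        s''.real (d + 1, 0, 0) = if p k then 1 else 0) T) :
    Runs (countProg d b q P) s (fun s' => Agree d d s s' ∧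
      (∀ q' ≠ q, s'.real (d, q', 0) = s.real (d, q', 0)) ∧
      s'.real (d, q, 0) = cnt N p) (B * (T + 30) + 15) := by
  refine (Runs.seq (T' := N * (T + 10 + 15) + 11)
    (Runs.setReal (Q := fun s' => s' = s.setR d q 0 0) rfl) ?_).mono (fun _ h => h) ?_
  · rintro s₁ rfl
    refine (Runs.for (by omega) (by simpa using hN) (fun k s' => Agree d d s s' ∧
      (∀ q' ≠ q, s'.real (d, q', 0) = s.real (d, q', 0)) ∧
      s'.real (d, q, 0) = cnt k p) ?_ ?_)
    · refine ⟨(agree_setR le_rfl s).trans (agree_setN le_rfl _), fun q' hq => ?_, ?_⟩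
      · simp [hq]
      · simp
    · rintro k hk s' ⟨h1, h2, h3⟩ h4 h5
      refine (Runs.seq (hP k hk s' h1 h4) (fun s'' h => Runs.setReal ?_)).mono (fun _ h => h) ?_
      · obtain ⟨g1, g2⟩ := h
        simp only [NatExpr.eval, RealExpr.eval, State.setR_nat]
        refine ⟨(g1.nat_reg (by omega) _ _).trans h4, (g1.nat_reg (by omega) _ _).trans h5,
          ?_, fun q' hq => ?_, ?_⟩
        · exact ((h1.trans (g1.mono (by omega) (by omega))).trans (agree_setR le_rfl _)).trans
            (agree_setN le_rfl _)
        · simp only [State.setN_real, State.setR_real, Prod.mk.injEq, hq, true_and, and_true,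
            if_false]
          rw [g1.real_cell (by omega), h2 q' hq]
        · simp only [State.setN_real, State.setR_real, if_true]
          rw [g1.real_cell (by omega), h3, g2, cnt_succ]
          split_ifs <;> simp
      · simp [NatExpr.cost, RealExpr.cost]
  · simp only [NatExpr.cost, RealExpr.cost]
    nlinarith [Nat.mul_le_mul_right (T + 25) hB]

open Classical in
-- Counts are held in real memory: multiplication is a unit-cost operation for reals but not for
-- naturals, and products of casts are compared exactly.
theorem Fm.runs_compile (φ : Fm) {B : ℕ} : ∀ {d : ℕ} {s : State}, 20 ≤ d → φ.WF d →
    s.nat (10, 0, 0) ≤ B → s.nat (11, 0, 0) ≤ B →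
    Runs (φ.compile d) s (fun s' => Agree d d s s' ∧
      s'.real (d, 0, 0) = if φ.Holds d s then 1 else 0) (φ.time B) := by
  induction φ with
  | test b =>
    intro d s hd hw hm hn
    refine (Runs.cond (fun h => Runs.setReal ?_) (fun h => Runs.setReal ?_)).mono
      (fun _ h => h) ?_
    · exact ⟨agree_setR le_rfl _, by simp [Fm.Holds, h, NatExpr.eval, RealExpr.eval]⟩
    · exact ⟨agree_setR le_rfl _, by simp [Fm.Holds, h, NatExpr.eval, RealExpr.eval]⟩
    · simp [Fm.time, NatExpr.cost, RealExpr.cost, add_assoc]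
  | not φ ih =>
    intro d s hd hw hm hn
    refine (Runs.seq (ih hd hw hm hn) (fun s' h => Runs.setReal ?_)).mono (fun _ h => h) ?_
    · refine ⟨h.1.trans (agree_setR le_rfl _), ?_⟩
      simp only [NatExpr.eval, RealExpr.eval, State.setR_real, if_true, h.2, Fm.Holds]
      by_cases hφ : φ.Holds d s <;> simp [hφ]
    · simp [Fm.time, NatExpr.cost, RealExpr.cost]
  | and φ ψ ih1 ih2 =>
    intro d s hd hw hm hn
    refine (Runs.seq (T' := ψ.time B + 20) (ih1 hd hw.1 hm hn) (fun s' h => ?_)).mono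
      (fun _ h => h) ?_
    · refine (Runs.cond (T := ψ.time B) (T' := 1) (fun hb => ?_) (fun hb => Runs.skip ?_)).mono
        (fun _ h => h) ?_
      · have hφ : φ.Holds d s := by
          by_contra hφ
          simp [Test.Holds, RealExpr.eval, NatExpr.eval, h.2, hφ] at hb
        refine (ih2 (s := s') hd hw.2 (by rwa [h.1.nat_reg (by omega)])
          (by rwa [h.1.nat_reg (by omega)])).mono (fun s'' h'' => ?_) le_rfl
        refine ⟨h.1.trans h''.1, ?_⟩
        rw [h''.2]
        simp only [Fm.Holds, hφ, true_and, Fm.holds_congr ψ hd (h.1.mono le_rfl hd) hw.2]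
      · have hφ : ¬ φ.Holds d s := by
          intro hφ
          simp [Test.Holds, RealExpr.eval, NatExpr.eval, h.2, hφ] at hb
        exact ⟨h.1, by simp [h.2, hφ, Fm.Holds]⟩
      · simp [Test.cost, RealExpr.cost, NatExpr.cost]; omega
    · simp only [Fm.time]; omega
  | cntLt b φ₁ φ₂ φ₃ φ₄ ih1 ih2 ih3 ih4 =>
    intro d s hd hw hm hn
    obtain ⟨hb, w1, w2, w3, w4⟩ := hw
    have hbB : s.nat (b, 0, 0) ≤ B := by rcases hb with rfl | rfl <;> assumption
    -- Each of the four loops starts in a state whose scratch cells have been altered by the earlier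
    -- loops, but counts truth values with respect to the original state `s`.
    have key : ∀ (φ : Fm) (q : ℕ) (s₁ : State), φ.WF (d + 1) →
        (∀ {d : ℕ} {s : State}, 20 ≤ d → φ.WF d →
          s.nat (10, 0, 0) ≤ B → s.nat (11, 0, 0) ≤ B →
          Runs (φ.compile d) s (fun s' => Agree d d s s' ∧
            s'.real (d, 0, 0) = if φ.Holds d s then 1 else 0) (φ.time B)) → Agree d d s s₁ →
        Runs (countProg d b q (φ.compile (d + 1))) s₁ (fun s' => Agree d d s s' ∧
          (∀ q' ≠ q, s'.real (d, q', 0) = s₁.real (d, q', 0)) ∧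
          s'.real (d, q, 0) = cnt (s.nat (b, 0, 0)) fun k =>
            φ.Holds (d + 1) (s.setN d 0 0 k)) (B * (φ.time B + 30) + 15) := by
      intro φ q s₁ hφ ih hs₁
      refine (runs_countProg (B := B) (N := s.nat (b, 0, 0)) (T := φ.time B)
        (p := fun k => φ.Holds (d + 1) (s.setN d 0 0 k)) (by omega)
        (hs₁.nat_reg (by omega) _ _) hbB ?_).mono
        (fun s' h => ⟨hs₁.trans h.1, h.2⟩) le_rfl
      intro k hk s' h hk'
      -- The loop counter is itself the bound variable: register `d` holds `k`.
      have hag : Agree (d + 1) d (s.setN d 0 0 k) s' := by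
        have := (hs₁.trans h).setN k
        have h2 : s'.setN d 0 0 k = s' := by
          rw [← hk']
          simp [State.setN]
        rwa [h2] at this
      refine (ih (s := s') (by omega) hφ ?_ ?_).mono (fun s'' h'' => ⟨h''.1, ?_⟩) le_rfl
      · rwa [h.nat_reg (by omega), hs₁.nat_reg (by omega)]
      · rwa [h.nat_reg (by omega), hs₁.nat_reg (by omega)]
      · rw [h''.2]
        simp only [Fm.holds_congr φ (by omega) (hag.mono le_rfl hd) hφ]
    refine (Runs.seq (key φ₁ 1 s w1 ih1 (Agree.refl _ _ _)) (fun s₁ h1 => Runs.seq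
      (key φ₂ 2 s₁ w2 ih2 h1.1) (fun s₂ h2 => Runs.seq
      (key φ₃ 3 s₂ w3 ih3 h2.1) (fun s₃ h3 => Runs.seq
      (key φ₄ 4 s₃ w4 ih4 h3.1) (fun s₄ h4 =>
      Runs.cond (fun hc => Runs.setReal ?_) (fun hc => Runs.setReal ?_)))))).mono (fun _ h => h) ?_
    · refine ⟨h4.1.trans (agree_setR le_rfl _), ?_⟩
      simp only [Test.Holds, RealExpr.eval, NatExpr.eval] at hc
      rw [h4.2.1 1 (by omega), h3.2.1 1 (by omega), h2.2.1 1 (by omega), h1.2.2,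
        h4.2.1 2 (by omega), h3.2.1 2 (by omega), h2.2.2, h4.2.1 3 (by omega), h3.2.2,
        h4.2.2] at hc
      rw [if_pos]
      · simp [NatExpr.eval, RealExpr.eval]
      · rw [Fm.Holds]; exact_mod_cast hc
    · refine ⟨h4.1.trans (agree_setR le_rfl _), ?_⟩
      simp only [Test.Holds, RealExpr.eval, NatExpr.eval] at hc
      rw [h4.2.1 1 (by omega), h3.2.1 1 (by omega), h2.2.1 1 (by omega), h1.2.2,
        h4.2.1 2 (by omega), h3.2.1 2 (by omega), h2.2.2, h4.2.1 3 (by omega), h3.2.2,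
        h4.2.2] at hc
      rw [if_neg]
      · simp [NatExpr.eval, RealExpr.eval]
      · rw [Fm.Holds]; exact_mod_cast hc
    · simp only [Fm.time, Test.cost, RealExpr.cost, NatExpr.cost]; omega

end RealRAM

/-! ### Independence of sets of rows -/

theorem cnt_mono {n : ℕ} {p q : ℕ → Prop} (h : ∀ k < n, p k → q k) : cnt n p ≤ cnt n q :=
  Set.ncard_le_ncard (fun k hk => ⟨hk.1, h k hk.1 hk.2⟩) ((Set.finite_lt_nat n).subset fun _ h => h.1)

theorem cnt_congr {n : ℕ} {p q : ℕ → Prop} (h : ∀ k < n, (p k ↔ q k)) : cnt n p = cnt n q :=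
  le_antisymm (cnt_mono fun k hk => (h k hk).1) (cnt_mono fun k hk => (h k hk).2)

theorem cnt_pos {n : ℕ} {p : ℕ → Prop} : 0 < cnt n p ↔ ∃ k < n, p k := by
  rw [cnt, Set.ncard_pos ((Set.finite_lt_nat n).subset fun _ h => h.1)]
  rfl

theorem cnt_eq_zero {n : ℕ} {p : ℕ → Prop} (h : ∀ k < n, ¬ p k) : cnt n p = 0 := by
  by_contra h0
  obtain ⟨k, hk, hp⟩ := cnt_pos.1 (Nat.pos_of_ne_zero h0)
  exact h k hk hp

/-- The number of the columns `k < n` with `q k` whose entries in the rows of `P` are given by `c`. -/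
noncomputable def colNum (A : ℕ → ℕ → ℝ) (n : ℕ) (q : ℕ → Prop) (P : Set ℕ) (c : ℕ → ℝ) : ℕ :=
  cnt n fun k => q k ∧ ∀ x ∈ P, A x k = c x

/-- The parts of a random column (among those with `q`) in the rows of `P` and of `Q` are
independent; meaningful for disjoint `P`, `Q`. -/
def IndRows (A : ℕ → ℕ → ℝ) (n : ℕ) (q : ℕ → Prop) (P Q : Set ℕ) : Prop :=
  ∀ c, colNum A n q P c * colNum A n q Q c = colNum A n q (P ∪ Q) c * cnt n q

section
variable {A : ℕ → ℕ → ℝ} {n : ℕ} {q : ℕ → Prop} {P Q K L R : Set ℕ}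

theorem colNum_congr {c c' : ℕ → ℝ} (h : ∀ x ∈ P, c x = c' x) :
    colNum A n q P c = colNum A n q P c' :=
  cnt_congr fun k _ => and_congr_right fun _ =>
    forall₂_congr fun x hx => by rw [h x hx]

theorem colNum_le (c : ℕ → ℝ) : colNum A n q P c ≤ cnt n q := cnt_mono fun _ _ h => h.1

theorem IndRows.symm (h : IndRows A n q P Q) : IndRows A n q Q P := fun c => by
  rw [mul_comm, h c, Set.union_comm]

theorem indRows_empty_left : IndRows A n q ∅ Q := fun c => by
  rw [Set.empty_union, mul_comm]
  congr 1
  exact cnt_congr fun k _ => by simp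

open Classical in
-- Marginalisation: the columns matching `c` on `Q'` are sorted by their whole pattern on `Q`. The
-- list `T` of these patterns does not depend on `P`, so one list serves for a marginal and for a
-- joint count.
theorem exists_colNum_eq_sum {Q' : Set ℕ} (hQ : Q' ⊆ Q) (c : ℕ → ℝ) :
    ∃ T : Finset (ℕ → ℝ), (∀ b ∈ T, ∀ x ∉ Q, b x = c x) ∧ ∀ P : Set ℕ, Disjoint P Q →
      colNum A n q (P ∪ Q') c = ∑ b ∈ T, colNum A n q (P ∪ Q) b := by
  set g : ℕ → ℕ → ℝ := fun k x => if x ∈ Q then A x k else c x with hg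
  set D := (Finset.range n).filter fun k => q k ∧ ∀ x ∈ Q', A x k = c x with hD
  refine ⟨D.image g, ?_, fun P hP => ?_⟩
  · intro b hb x hx
    obtain ⟨l, -, rfl⟩ := Finset.mem_image.1 hb
    simp [hg, hx]
  · rw [colNum, cnt_eq_card, Finset.card_eq_sum_card_fiberwise (f := g) (t := D.image g)]
    · refine Finset.sum_congr rfl fun b hb => ?_
      obtain ⟨l, hl, rfl⟩ := Finset.mem_image.1 hb
      rw [colNum, cnt_eq_card]
      congr 1
      ext k
      rw [Finset.mem_filter, Finset.mem_filter, Finset.mem_filter, and_assoc]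
      refine and_congr_right fun hk => ?_
      rw [hD, Finset.mem_filter] at hl
      have hgk : g k = g l ↔ ∀ x ∈ Q, A x k = A x l := by
        constructor
        · intro h x hx
          have := congrFun h x
          simpa [hg, hx] using this
        · intro h
          funext x
          by_cases hx : x ∈ Q <;> simp [hg, hx]
          exact h x hx
      rw [hgk]
      constructor
      · rintro ⟨⟨h1, h2⟩, h3⟩
        refine ⟨h1, fun x hx => ?_⟩
        by_cases hxQ : x ∈ Q
        · simpa [hg, hxQ] using h3 x hxQ
        · simp only [hg, hxQ, if_false]
          exact h2 x (Or.inl (hx.resolve_right hxQ))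
      · rintro ⟨h1, h2⟩
        have h3 : ∀ x ∈ Q, A x k = A x l := fun x hx => by
          simpa [hg, hx] using h2 x (Or.inr hx)
        refine ⟨⟨h1, fun x hx => ?_⟩, h3⟩
        rcases hx with hx | hx
        · have : x ∉ Q := fun h => Set.disjoint_left.1 hP hx h
          simpa [hg, this] using h2 x (Or.inl hx)
        · rw [h3 x (hQ hx), hl.2.2 x hx]
    · intro k hk
      replace hk := Finset.mem_filter.1 (Finset.mem_coe.1 hk)
      exact Finset.mem_coe.2 (Finset.mem_image_of_mem _
        (Finset.mem_filter.2 ⟨hk.1, hk.2.1, fun x hx => hk.2.2 x (Or.inr hx)⟩))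

/-- Sum the product rule over the patterns on `Q` that extend the given one on `Q'`; disjointness
keeps the pattern on `P` fixed. -/
theorem IndRows.mono_right {Q' : Set ℕ} (h : IndRows A n q P Q) (hPQ : Disjoint P Q)
    (hQ : Q' ⊆ Q) : IndRows A n q P Q' := by
  intro c
  obtain ⟨T, hT, hsum⟩ := exists_colNum_eq_sum (A := A) (n := n) (q := q) hQ c
  have h0 := hsum ∅ (Set.empty_disjoint _)
  rw [Set.empty_union, Set.empty_union] at h0
  rw [hsum P hPQ, h0, Finset.sum_mul, Finset.mul_sum]
  refine Finset.sum_congr rfl fun b hb => ?_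
  rw [← h b]
  congr 1
  exact colNum_congr fun x hx => (hT b hb x (Set.disjoint_left.1 hPQ hx)).symm

theorem IndRows.mono_left {P' : Set ℕ} (h : IndRows A n q P Q) (hPQ : Disjoint P Q)
    (hP : P' ⊆ P) : IndRows A n q P' Q :=
  (h.symm.mono_right hPQ.symm hP).symm

/-- The contraction rule for independence. Writing sets for their counts and `N` for the number of
columns, `K * LR * N = K * L * R = KL * N * R = KLR * N * N`, where `L * R = LR * N` by
marginalisation. Cancel `N`; if `N = 0`, all counts vanish. -/
theorem IndRows.assoc (h : IndRows A n q K L) (h' : IndRows A n q (K ∪ L) R)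
    (hd : Disjoint (K ∪ L) R) : IndRows A n q K (L ∪ R) := by
  intro c
  have hLR := h'.mono_left hd Set.subset_union_right c
  have h1 := h c
  have h2 := h' c
  rw [Set.union_assoc] at h2
  rcases Nat.eq_zero_or_pos (cnt n q) with h0 | h0
  · have := colNum_le (A := A) (n := n) (q := q) (P := K) c
    rw [h0] at this ⊢
    simp [Nat.le_zero.1 this]
  · refine Nat.eq_of_mul_eq_mul_right h0 ?_
    rw [mul_assoc, ← hLR, ← mul_assoc, h1, mul_right_comm, h2]

/-- This makes separable sets closed under disjoint unions: `KL * R * N = K * L * R = K * LR * N =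
KLR * N * N`, then cancel `N`. -/
theorem IndRows.union (h : IndRows A n q K (L ∪ R)) (h' : IndRows A n q L (K ∪ R))
    (hd : Disjoint K L) (hd' : Disjoint (K ∪ L) R) : IndRows A n q (K ∪ L) R := by
  intro c
  have hdK : Disjoint K (L ∪ R) := hd.union_right (hd'.mono_left Set.subset_union_left)
  have hdL : Disjoint L (K ∪ R) := hd.symm.union_right (hd'.mono_left Set.subset_union_right)
  have h1 := h c
  have h2 := h'.mono_right hdL Set.subset_union_right c
  have h3 := h.mono_right hdK Set.subset_union_left c
  rw [← Set.union_assoc] at h1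
  rcases Nat.eq_zero_or_pos (cnt n q) with h0 | h0
  · have := colNum_le (A := A) (n := n) (q := q) (P := R) c
    rw [h0] at this ⊢
    simp [Nat.le_zero.1 this]
  · refine Nat.eq_of_mul_eq_mul_right h0 ?_
    rw [mul_right_comm, ← h3, mul_assoc, h2, ← mul_assoc, h1]

/-- A constant is independent of everything. Applied to the conditioning row, this isolates `r` in
the finest partition and allows moving `r` to either side. -/
theorem indRows_singleton {r : ℕ} {a : ℝ} (hq : ∀ k < n, q k → A r k = a) :
    IndRows A n q {r} Q := by
  intro c
  by_cases hc : c r = a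
  · have h1 : colNum A n q {r} c = cnt n q := cnt_congr fun k hk =>
      ⟨fun h => h.1, fun h => ⟨h, fun x hx => by rw [Set.mem_singleton_iff.1 hx, hq k hk h, hc]⟩⟩
    have h2 : colNum A n q ({r} ∪ Q) c = colNum A n q Q c := cnt_congr fun k hk =>
      ⟨fun h => ⟨h.1, fun x hx => h.2 x (Or.inr hx)⟩, fun h => ⟨h.1, fun x hx => by
        rcases hx with hx | hx
        · rw [Set.mem_singleton_iff.1 hx, hq k hk h.1, hc]
        · exact h.2 x hx⟩⟩
    rw [h1, h2, mul_comm]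
  · have h1 : colNum A n q {r} c = 0 := cnt_eq_zero fun k hk h =>
      hc ((h.2 r rfl).symm.trans (hq k hk h.1))
    have h2 : colNum A n q ({r} ∪ Q) c = 0 := cnt_eq_zero fun k hk h =>
      hc ((h.2 r (Or.inl rfl)).symm.trans (hq k hk h.1))
    rw [h1, h2, zero_mul, zero_mul]

end

/-! ### The finest partition into independent sets of rows -/

/-- For every value `a`, the rows of `P` and of `Q` are independent for a random column with
entry `a` in row `r`. -/
def CondInd (A : ℕ → ℕ → ℝ) (n r : ℕ) (P Q : Set ℕ) : Prop :=
  ∀ a, IndRows A n (fun k => A r k = a) P Q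

open Classical in
/-- Labels of the rows below `v` for the finest partition into conditionally independent sets: the
classes for `v` that are not separated from the other rows below `v + 1` are merged with `v`. -/
noncomputable def labels (A : ℕ → ℕ → ℝ) (n r : ℕ) : ℕ → ℕ → ℕ
  | 0, _ => 0
  | v + 1, u =>
    if u ≠ v ∧ CondInd A n r {x | x < v ∧ labels A n r v x = labels A n r v u}
      {x | x < v + 1 ∧ ¬ (x < v ∧ labels A n r v x = labels A n r v u)}
    then labels A n r v u else v

section
variable {A : ℕ → ℕ → ℝ} {n r : ℕ}

/-- Hence `v` is a fresh label when the class of the new row `v` is formed. -/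
theorem labels_lt : ∀ {v x : ℕ}, x < v → labels A n r v x < v
  | 0, _, h => absurd h (Nat.not_lt_zero _)
  | v + 1, x, h => by
    rw [labels]
    split_ifs with h1
    · have := labels_lt (v := v) (x := x) (by omega)
      omega
    · omega

theorem labels_succ_self (v : ℕ) : labels A n r (v + 1) v = v := by
  rw [labels, if_neg (fun h => h.1 rfl)]

theorem labels_succ_of_ne {v u : ℕ} (h : labels A n r (v + 1) u ≠ v) :
    u ≠ v ∧ CondInd A n r {x | x < v ∧ labels A n r v x = labels A n r v u}
      {x | x < v + 1 ∧ ¬ (x < v ∧ labels A n r v x = labels A n r v u)} ∧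
      labels A n r (v + 1) u = labels A n r v u := by
  rw [labels] at h ⊢
  split_ifs at h ⊢ with h1
  · exact ⟨h1.1, h1.2, rfl⟩
  · exact absurd rfl h

theorem labels_succ_of_condInd {v u : ℕ} (h : u ≠ v)
    (h' : CondInd A n r {x | x < v ∧ labels A n r v x = labels A n r v u}
      {x | x < v + 1 ∧ ¬ (x < v ∧ labels A n r v x = labels A n r v u)}) :
    labels A n r (v + 1) u = labels A n r v u := by
  rw [labels, if_pos ⟨h, h'⟩]

/-- Induction on the set of labels, adding one separable class at a time by `IndRows.union`. -/
theorem condInd_of_closed_aux {v : ℕ} (f : ℕ → ℕ) (T : Finset ℕ)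
    (hT : ∀ t ∈ T, CondInd A n r {x | x < v ∧ f x = t} {x | x < v + 1 ∧ ¬ (x < v ∧ f x = t)}) :
    CondInd A n r {x | x < v ∧ f x ∈ T} {x | x < v + 1 ∧ ¬ (x < v ∧ f x ∈ T)} := by
  classical
  induction T using Finset.induction_on with
  | empty =>
    intro a
    have : {x | x < v ∧ f x ∈ (∅ : Finset ℕ)} = ∅ := by ext; simp
    rw [this]
    exact indRows_empty_left
  | insert t T ht ih =>
    intro a
    have h1 := ih (fun s hs => hT s (Finset.mem_insert_of_mem hs)) a
    have h2 := hT t (Finset.mem_insert_self _ _) a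
    have e : {x | x < v ∧ f x ∈ insert t T} = {x | x < v ∧ f x ∈ T} ∪ {x | x < v ∧ f x = t} := by
      ext x; simp only [Finset.mem_insert, Set.mem_ofPred_eq, Set.mem_union]; tauto
    rw [e]
    refine IndRows.union ?_ ?_ ?_ ?_
    · convert h1 using 1
      ext x
      simp only [Finset.mem_insert, Set.mem_ofPred_eq, Set.mem_union]
      by_cases hx : f x = t
      · subst hx
        constructor
        · rintro (h | h)
          · exact ⟨by omega, fun h' => ht h'.2⟩
          · tauto
        · intro h
          by_cases hv : x < v <;> tauto
      · constructor
        · tauto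
        · tauto
    · convert h2 using 1
      ext x
      simp only [Finset.mem_insert, Set.mem_ofPred_eq, Set.mem_union]
      constructor
      · rintro (h | h)
        · exact ⟨by omega, fun h' => ht (h'.2 ▸ h.2)⟩
        · tauto
      · tauto
    · rw [Set.disjoint_left]
      rintro x ⟨-, h⟩ ⟨-, rfl⟩
      exact ht h
    · rw [Set.disjoint_left]
      simp only [Finset.mem_insert, Set.mem_ofPred_eq, Set.mem_union]
      tauto

theorem condInd_compl_iff {v : ℕ} {L : Set ℕ} (hL : L ⊆ Set.Iio v) :
    CondInd A n r L (Set.Iio v \ L) ↔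
      CondInd A n r (Set.Iio v \ L) (Set.Iio v \ (Set.Iio v \ L)) := by
  have : Set.Iio v \ (Set.Iio v \ L) = L := by
    ext x
    have := @hL x
    simp only [Set.mem_sdiff]
    tauto
  rw [this]
  exact ⟨fun h a => (h a).symm, fun h a => (h a).symm⟩

/-- A set of rows is conditionally independent of the other rows exactly if it is a union of
classes. -/
theorem condInd_iff_closed (v : ℕ) : ∀ L ⊆ Set.Iio v,
    CondInd A n r L (Set.Iio v \ L) ↔
      ∀ x < v, ∀ y < v, labels A n r v x = labels A n r v y → x ∈ L → y ∈ L := by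
  induction v with
  | zero =>
    intro L hL
    have : L = ∅ := Set.eq_empty_of_forall_notMem fun x hx => Nat.not_lt_zero _ (hL hx)
    subst this
    exact ⟨fun _ x hx => absurd hx (Nat.not_lt_zero _), fun _ a => indRows_empty_left⟩
  | succ v ih =>
    have hset : ∀ u, {x | x < v + 1 ∧ ¬ (x < v ∧ labels A n r v x = labels A n r v u)} =
        Set.Iio (v + 1) \ {x | x < v ∧ labels A n r v x = labels A n r v u} := fun u => rfl
    -- Both sides are invariant under complementation, so it suffices to treat sets avoiding the new
    -- row `v`.
    have key : ∀ L ⊆ Set.Iio (v + 1), v ∉ L → (CondInd A n r L (Set.Iio (v + 1) \ L) ↔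
        ∀ x < v + 1, ∀ y < v + 1, labels A n r (v + 1) x = labels A n r (v + 1) y →
          x ∈ L → y ∈ L) := by
      intro L hL hv
      have hLv : L ⊆ Set.Iio v := fun x hx => by
        have h1 := hL hx
        have h2 : x ≠ v := fun h => hv (h ▸ hx)
        simp only [Set.mem_Iio] at h1 ⊢
        omega
      constructor
      · intro h x hx y hy hxy hxL
        have hxv : x < v := hLv hxL
        have hLs : CondInd A n r L (Set.Iio v \ L) := fun a =>
          (h a).mono_right Set.disjoint_sdiff_right
            (Set.sdiff_subset_sdiff_left (Set.Iio_subset_Iio (Nat.le_succ v)))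
        have hcl := (ih L hLv).1 hLs
        set K := {z | z < v ∧ labels A n r v z = labels A n r v x} with hK
        have hKL : K ⊆ L := fun z hz => hcl x hxv z hz.1 hz.2.symm hxL
        have hKs := (ih K (fun z hz => hz.1)).2
          (fun z hz z' hz' hzz h => ⟨hz', hzz.symm.trans h.2⟩)
        -- The old class `K` separates from `L \ K` among the old rows, and `L` separates from
        -- everything else including `v`. By contraction `K` separates from all other rows, so it is
        -- not merged with `v`.
        have hKs' : CondInd A n r K (Set.Iio (v + 1) \ K) := by
          intro a
          have h1 : IndRows A n (fun k => A r k = a) K (L \ K) :=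
            (hKs a).mono_right Set.disjoint_sdiff_right (Set.sdiff_subset_sdiff_left hLv)
          have h2 : K ∪ L \ K = L := Set.union_sdiff_cancel hKL
          have h3 := h1.assoc (R := Set.Iio (v + 1) \ L) (by rw [h2]; exact h a)
            (by rw [h2]; exact Set.disjoint_sdiff_right)
          convert h3 using 1
          ext z
          have := @hL z
          have := @hKL z
          simp only [Set.mem_sdiff, Set.mem_union]
          tauto
        have e1 := labels_succ_of_condInd (by omega) hKs'
        have hne : labels A n r (v + 1) y ≠ v := by
          rw [← hxy, e1]
          exact (labels_lt hxv).ne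
        obtain ⟨h1, -, h2⟩ := labels_succ_of_ne hne
        exact hcl x hxv y (by omega) (by rw [← e1, hxy, h2]) hxL
      · intro h
        -- A closed set without `v` contains no row merged with `v`; it is therefore a union of
        -- surviving old classes, each of which is separable.
        have hne : ∀ x ∈ L, labels A n r (v + 1) x ≠ v := fun x hx hxv =>
          hv (h x (hL hx) v (by omega) (by rw [hxv, labels_succ_self]) hx)
        classical
        set T := ((Finset.range v).filter (· ∈ L)).image (labels A n r v) with hT
        have hLT : L = {x | x < v ∧ labels A n r v x ∈ T} := by
          ext x
          simp only [hT, Set.mem_ofPred_eq, Finset.mem_image, Finset.mem_filter, Finset.mem_range]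
          constructor
          · exact fun hx => ⟨hLv hx, x, ⟨hLv hx, hx⟩, rfl⟩
          · rintro ⟨hx, y, ⟨hy, hyL⟩, hxy⟩
            obtain ⟨h1, h2, h3⟩ := labels_succ_of_ne (hne y hyL)
            rw [hxy] at h2
            refine h y (by omega) x (by omega) ?_ hyL
            rw [h3, hxy, labels_succ_of_condInd (by omega) h2]
        have := condInd_of_closed_aux (A := A) (n := n) (r := r) (v := v) (labels A n r v) T ?_
        · have e : Set.Iio (v + 1) \ L = {x | x < v + 1 ∧ ¬ (x < v ∧ labels A n r v x ∈ T)} := by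
            conv_lhs => rw [hLT]
            rfl
          rw [e, hLT]
          exact this
        · intro t ht
          rw [hT, Finset.mem_image] at ht
          obtain ⟨x, hx, rfl⟩ := ht
          exact (labels_succ_of_ne (hne x (Finset.mem_filter.1 hx).2)).2.1
    intro L hL
    by_cases hv : v ∈ L
    · rw [condInd_compl_iff hL, key _ Set.sdiff_subset (fun h => h.2 hv)]
      constructor
      · intro h x hx y hy hxy hxL
        by_contra hyL
        exact (h y hy x hx hxy.symm ⟨hy, hyL⟩).2 hxL
      · intro h x hx y hy hxy hxL
        exact ⟨hy, fun hyL => hxL.2 (h y hy x hx hxy.symm hyL)⟩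
    · exact key L hL hv

end

/-! ### 2-products and counting columns -/

/-- Bijections between corresponding fibres are glued. Applied to columns, equal multiplicities of
all patterns yield a permutation of columns. -/
theorem exists_equiv_of_card_fiber_eq {α β γ : Type*} [Finite α] [Finite β] (F : α → γ) (G : β → γ)
    (h : ∀ c, Nat.card {a // F a = c} = Nat.card {b // G b = c}) :
    ∃ f : α ≃ β, ∀ a, G (f a) = F a := by
  have e : ∀ c, Nonempty ({a // F a = c} ≃ {b // G b = c}) := fun c =>
    (Finite.card_eq).1 (h c)
  refine ⟨(Equiv.sigmaFiberEquiv F).symm.trans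
    ((Equiv.sigmaCongrRight fun c => (e c).some).trans (Equiv.sigmaFiberEquiv G)), fun a => ?_⟩
  exact ((e (F a)).some ⟨a, rfl⟩).2

section
variable {ι κ ι₁ κ₁ ι₂ κ₂ : Type*}
  {S : Matrix ι κ ℝ} {S₁ : Matrix ι₁ κ₁ ℝ} {x₁ : ι₁} {S₂ : Matrix ι₂ κ₂ ℝ} {y₁ : ι₂}

/-- A column of the 2-product is a pair of columns of the factors with the same special entry, so
multiplicities multiply. The special entry selects the block. -/
theorem card_twoProduct_fiber
    (c : ({i : ι₁ // i ≠ x₁} ⊕ {i : ι₂ // i ≠ y₁}) ⊕ Unit → ℝ)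
    (hc : c (Sum.inr ()) = 0 ∨ c (Sum.inr ()) = 1) :
    Nat.card {q // (fun g => twoProduct S₁ x₁ S₂ y₁ g q) = c} =
      Nat.card {j : κ₁ // S₁ x₁ j = c (Sum.inr ()) ∧
        ∀ i : {i : ι₁ // i ≠ x₁}, S₁ i j = c (Sum.inl (Sum.inl i))} *
      Nat.card {j : κ₂ // S₂ y₁ j = c (Sum.inr ()) ∧
        ∀ i : {i : ι₂ // i ≠ y₁}, S₂ i j = c (Sum.inl (Sum.inr i))} := by
  rw [← Nat.card_prod]
  symm
  rcases hc with hc | hc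
  · refine Nat.card_eq_of_bijective (fun j => ⟨Sum.inl (⟨j.1.1, j.1.2.1.trans hc⟩,
      ⟨j.2.1, j.2.2.1.trans hc⟩), ?_⟩) ⟨?_, ?_⟩
    · funext g
      rcases g with (i | i) | i
      · exact j.1.2.2 i
      · exact j.2.2.2 i
      · exact hc.symm
    · rintro ⟨⟨j, hj⟩, ⟨k, hk⟩⟩ ⟨⟨j', hj'⟩, ⟨k', hk'⟩⟩ h
      simp only [Subtype.mk.injEq, Sum.inl.injEq, Prod.mk.injEq] at h
      obtain ⟨rfl, rfl⟩ := h
      rfl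
    · rintro ⟨q | q, hq⟩
      · exact ⟨⟨⟨q.1.1, q.1.2.trans hc.symm, fun i => congrFun hq (Sum.inl (Sum.inl i))⟩,
          ⟨q.2.1, q.2.2.trans hc.symm, fun i => congrFun hq (Sum.inl (Sum.inr i))⟩⟩, rfl⟩
      · exact absurd ((congrFun hq (Sum.inr ())).trans hc) one_ne_zero
  · refine Nat.card_eq_of_bijective (fun j => ⟨Sum.inr (⟨j.1.1, j.1.2.1.trans hc⟩,
      ⟨j.2.1, j.2.2.1.trans hc⟩), ?_⟩) ⟨?_, ?_⟩
    · funext g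
      rcases g with (i | i) | i
      · exact j.1.2.2 i
      · exact j.2.2.2 i
      · exact hc.symm
    · rintro ⟨⟨j, hj⟩, ⟨k, hk⟩⟩ ⟨⟨j', hj'⟩, ⟨k', hk'⟩⟩ h
      simp only [Subtype.mk.injEq, Sum.inr.injEq, Prod.mk.injEq] at h
      obtain ⟨rfl, rfl⟩ := h
      rfl
    · rintro ⟨q | q, hq⟩
      · exact absurd ((congrFun hq (Sum.inr ())).trans hc) zero_ne_one
      · exact ⟨⟨⟨q.1.1, q.1.2.trans hc.symm, fun i => congrFun hq (Sum.inl (Sum.inl i))⟩,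
          ⟨q.2.1, q.2.2.trans hc.symm, fun i => congrFun hq (Sum.inl (Sum.inr i))⟩⟩, rfl⟩

/-- A matrix is the 2-product of two matrices on complementary sets of rows (sharing the row `r`)
if the multiplicities of the columns multiply. -/
theorem matrixIso_twoProduct [Finite κ] [Finite κ₁] [Finite κ₂] {r : ι} (α₁ : ι₁ → ι) (α₂ : ι₂ → ι)
    (h₁ : Function.Injective α₁) (h₂ : Function.Injective α₂) (hx : α₁ x₁ = r) (hy : α₂ y₁ = r)
    (hdisj : ∀ i j, α₁ i = α₂ j → α₁ i = r)
    (hcov : ∀ x, (∃ i, α₁ i = x) ∨ ∃ i, α₂ i = x)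
    (hr : ∀ j, S r j = 0 ∨ S r j = 1)
    (hcard : ∀ c : ι → ℝ, c r = 0 ∨ c r = 1 → Nat.card {j // ∀ x, S x j = c x} =
      Nat.card {j // ∀ i, S₁ i j = c (α₁ i)} * Nat.card {j // ∀ i, S₂ i j = c (α₂ i)}) :
    MatrixIso S (twoProduct S₁ x₁ S₂ y₁) := by
  -- The row `r` is present in both factors but only once in the product.
  let G : ({i : ι₁ // i ≠ x₁} ⊕ {i : ι₂ // i ≠ y₁}) ⊕ Unit → ι :=
    Sum.elim (Sum.elim (fun i => α₁ i) fun i => α₂ i) fun _ => r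
  have hG : Function.Bijective G := by
    constructor
    · rintro ((i | i) | i) ((j | j) | j) h
      · exact congrArg _ (congrArg _ (Subtype.ext (h₁ h)))
      · exact absurd (h₁ ((hdisj _ _ h).trans hx.symm)) i.2
      · exact absurd (h₁ (Eq.trans h hx.symm)) i.2
      · exact absurd (h₁ ((hdisj _ _ h.symm).trans hx.symm)) j.2
      · exact congrArg _ (congrArg _ (Subtype.ext (h₂ h)))
      · exact absurd (h₂ (Eq.trans h hy.symm)) i.2
      · exact absurd (h₁ (Eq.trans h.symm hx.symm)) j.2
      · exact absurd (h₂ (Eq.trans h.symm hy.symm)) j.2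
      · rfl
    · intro x
      by_cases hxr : x = r
      · exact ⟨Sum.inr (), hxr.symm⟩
      · rcases hcov x with ⟨i, rfl⟩ | ⟨i, rfl⟩
        · exact ⟨Sum.inl (Sum.inl ⟨i, fun h => hxr (h ▸ hx)⟩), rfl⟩
        · exact ⟨Sum.inl (Sum.inr ⟨i, fun h => hxr (h ▸ hy)⟩), rfl⟩
  let E := Equiv.ofBijective G hG
  have hfib : ∀ c, Nat.card {j : κ // (fun g => S (G g) j) = c} =
      Nat.card {q // (fun g => twoProduct S₁ x₁ S₂ y₁ g q) = c} := by
    intro c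
    by_cases hc : c (Sum.inr ()) = 0 ∨ c (Sum.inr ()) = 1
    · rw [card_twoProduct_fiber c hc]
      set c' : ι → ℝ := fun x => c (E.symm x) with hc'
      have hcG : ∀ g, c' (G g) = c g := fun g => congrArg c (E.symm_apply_apply g)
      have hcr : c' r = c (Sum.inr ()) := hcG (Sum.inr ())
      have := hcard c' (by rwa [hcr])
      convert this using 1
      · refine Nat.card_congr (Equiv.subtypeEquivRight fun j => ?_)
        constructor
        · intro h x
          obtain ⟨g, rfl⟩ := hG.2 x
          exact (congrFun h g).trans (hcG g).symm
        · intro h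
          funext g
          exact (h (G g)).trans (hcG g)
      · congr 1
        · refine Nat.card_congr (Equiv.subtypeEquivRight fun j => ?_)
          constructor
          · rintro ⟨h, h'⟩ i
            by_cases hi : i = x₁
            · rw [hi, hx, hcr, h]
            · exact (h' ⟨i, hi⟩).trans (hcG (Sum.inl (Sum.inl ⟨i, hi⟩))).symm
          · intro h
            refine ⟨by rw [h, hx, hcr], fun i => ?_⟩
            rw [h]
            exact hcG (Sum.inl (Sum.inl i))
        · refine Nat.card_congr (Equiv.subtypeEquivRight fun j => ?_)
          constructor
          · rintro ⟨h, h'⟩ i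
            by_cases hi : i = y₁
            · rw [hi, hy, hcr, h]
            · exact (h' ⟨i, hi⟩).trans (hcG (Sum.inl (Sum.inr ⟨i, hi⟩))).symm
          · intro h
            refine ⟨by rw [h, hy, hcr], fun i => ?_⟩
            rw [h]
            exact hcG (Sum.inl (Sum.inr i))
    -- A pattern whose special entry is neither 0 nor 1 occurs on neither side.
    · have h1 : IsEmpty {j : κ // (fun g => S (G g) j) = c} :=
        ⟨fun j => hc (by
          have := congrFun j.2 (Sum.inr ())
          rw [← this]
          exact hr j.1)⟩
      have h2 : IsEmpty {q // (fun g => twoProduct S₁ x₁ S₂ y₁ g q) = c} :=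
        ⟨fun q => hc (by
          have := congrFun q.2 (Sum.inr ())
          rw [← this]
          rcases q.1 with q | q
          · exact Or.inl rfl
          · exact Or.inr rfl)⟩
      rw [Nat.card_of_isEmpty, Nat.card_of_isEmpty]
  obtain ⟨f, hf⟩ := exists_equiv_of_card_fiber_eq (fun j : κ => fun g => S (G g) j)
    (fun q => fun g => twoProduct S₁ x₁ S₂ y₁ g q) hfib
  refine ⟨E.symm, f, fun i j => ?_⟩
  have := congrFun (hf j) (E.symm i)
  rw [this]
  exact congrArg (fun x => S x j) (E.apply_symm_apply i).symm

end

/-! ### Extracting submatrices by numbering the selected rows and columns -/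

theorem cnt_le_cnt {p : ℕ → Prop} {i j : ℕ} (h : i ≤ j) : cnt i p ≤ cnt j p := by
  induction j, h using Nat.le_induction with
  | base => rfl
  | succ j _ ih => rw [cnt_succ]; omega

theorem cnt_lt_cnt {p : ℕ → Prop} {i j : ℕ} (h : i < j) (hi : p i) : cnt i p < cnt j p := by
  have h1 : cnt (i + 1) p = cnt i p + 1 := by rw [cnt_succ, if_pos hi]
  have h2 : cnt (i + 1) p ≤ cnt j p := cnt_le_cnt h
  omega

/-- For a selected index `k`, `cnt k p` is its rank among the selected indices and hence its
position in the submatrix; different selected indices get different positions. -/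
theorem cnt_inj {p : ℕ → Prop} {i j : ℕ} (hi : p i) (hj : p j) (h : cnt i p = cnt j p) : i = j := by
  rcases lt_trichotomy i j with h' | h' | h'
  · exact absurd h (cnt_lt_cnt h' hi).ne
  · exact h'
  · exact absurd h (cnt_lt_cnt h' hj).ne'

theorem card_subtype_fin {n : ℕ} (p : ℕ → Prop) : Nat.card {k : Fin n // p k} = cnt n p := by
  rw [cnt, ← Nat.card_coe_set_eq]
  exact Nat.card_congr ⟨fun k => ⟨k.1, k.1.2, k.2⟩, fun k => ⟨⟨k.1, k.2.1⟩, k.2.2⟩,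
    fun _ => rfl, fun _ => rfl⟩

/-- The numbering of the indices with `p`. -/
noncomputable def numbering (n : ℕ) (p : ℕ → Prop) : {k : Fin n // p k} ≃ Fin (cnt n p) :=
  Equiv.ofBijective (fun k => ⟨cnt k.1 p, cnt_lt_cnt k.1.2 k.2⟩) <| by
    classical
    rw [Fintype.bijective_iff_injective_and_card]
    constructor
    · intro k l h
      exact Subtype.ext (Fin.ext (cnt_inj k.2 l.2 (Fin.ext_iff.1 h)))
    · rw [← Nat.card_eq_fintype_card, card_subtype_fin, Fintype.card_fin]

/-! ### Splitting a matrix into two factors -/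

/-- The columns `k` and `l` agree in the rows with `ρ`. -/
def SameCol (A : ℕ → ℕ → ℝ) (m : ℕ) (ρ : ℕ → Prop) (k l : ℕ) : Prop :=
  ∀ x < m, ρ x → A x k = A x l

/-- The rows with `ρ₁` and `ρ₂` and the columns with `σ₁` and `σ₂` give matrices whose 2-product, with
the special row `r`, has the columns of `A` with the right multiplicities. -/
structure Splits (A : ℕ → ℕ → ℝ) (m n r : ℕ) (ρ₁ ρ₂ σ₁ σ₂ : ℕ → Prop) : Prop where
  zero_or_one : ∀ j < n, A r j = 0 ∨ A r j = 1
  exists_zero : ∃ j < n, A r j = 0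
  exists_one : ∃ j < n, A r j = 1
  left_special : ρ₁ r
  right_special : ρ₂ r
  left_or_right : ∀ x < m, ρ₁ x ∨ ρ₂ x
  left_and_right : ∀ x < m, ρ₁ x → ρ₂ x → x = r
  exists_left : ∃ x < m, x ≠ r ∧ ρ₁ x
  exists_right : ∃ x < m, x ≠ r ∧ ρ₂ x
  mul_eq : ∀ i < n, ∀ j < n, A r i = A r j →
    cnt n (fun k => σ₁ k ∧ SameCol A m ρ₁ k i) * cnt n (fun k => σ₂ k ∧ SameCol A m ρ₂ k j) =
      cnt n fun k => SameCol A m ρ₁ k i ∧ SameCol A m ρ₂ k j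

/-- `S'` is the submatrix of `A` on the rows with `ρ` and the columns with `σ`. -/
def IsSub (A : ℕ → ℕ → ℝ) (m n : ℕ) (ρ σ : ℕ → Prop) (S' : Matrix (Fin (cnt m ρ)) (Fin (cnt n σ)) ℝ) :
    Prop :=
  ∀ i j, S' (numbering m ρ i) (numbering n σ j) = A i j

theorem isSpecialRow_of_isSub {A : ℕ → ℕ → ℝ} {m n r : ℕ} {ρ σ : ℕ → Prop} (hr : r < m)
    (hρ : ρ r) (h01 : ∀ j < n, A r j = 0 ∨ A r j = 1) (h0 : ∃ j < n, σ j ∧ A r j = 0)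
    (h1 : ∃ j < n, σ j ∧ A r j = 1) (hne : ∃ x < m, x ≠ r ∧ ρ x)
    {S' : Matrix (Fin (cnt m ρ)) (Fin (cnt n σ)) ℝ} (hS : IsSub A m n ρ σ S') :
    IsSpecialRow S' (numbering m ρ ⟨⟨r, hr⟩, hρ⟩) where
  zero_or_one j := by
    obtain ⟨j, rfl⟩ := (numbering n σ).surjective j
    rw [hS]
    exact h01 _ j.1.2
  exists_zero := by
    obtain ⟨j, hj, hσ, h⟩ := h0
    exact ⟨numbering n σ ⟨⟨j, hj⟩, hσ⟩, by rw [hS]; exact h⟩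
  exists_one := by
    obtain ⟨j, hj, hσ, h⟩ := h1
    exact ⟨numbering n σ ⟨⟨j, hj⟩, hσ⟩, by rw [hS]; exact h⟩
  exists_other_row := by
    obtain ⟨x, hx, hxr, h⟩ := hne
    refine ⟨numbering m ρ ⟨⟨x, hx⟩, h⟩, fun h => hxr ?_⟩
    have := (numbering m ρ).injective h
    simpa using this

theorem IsSub.card_eq {A : ℕ → ℕ → ℝ} {m n : ℕ} {ρ σ : ℕ → Prop}
    {S' : Matrix (Fin (cnt m ρ)) (Fin (cnt n σ)) ℝ} (hS : IsSub A m n ρ σ S') (c : Fin m → ℝ) :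
    Nat.card {j // ∀ i, S' i j = c ((numbering m ρ).symm i).1} =
      cnt n fun k => σ k ∧ ∀ (x : ℕ) (hx : x < m), ρ x → A x k = c ⟨x, hx⟩ := by
  refine Eq.trans (Eq.symm ?_) (card_subtype_fin _)
  refine Nat.card_eq_of_bijective (fun k => ⟨numbering n σ ⟨k.1, k.2.1⟩, fun i => ?_⟩) ⟨?_, ?_⟩
  · obtain ⟨i, rfl⟩ := (numbering m ρ).surjective i
    rw [hS, Equiv.symm_apply_apply]
    exact k.2.2 _ i.1.2 i.2
  · intro k l h
    have := (numbering n σ).injective (Subtype.ext_iff.1 h)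
    exact Subtype.ext (congrArg (fun z => z.1) this)
  · rintro ⟨j, hj⟩
    obtain ⟨j, rfl⟩ := (numbering n σ).surjective j
    refine ⟨⟨j.1, j.2, fun x hx hρ => ?_⟩, rfl⟩
    have := hj (numbering m ρ ⟨⟨x, hx⟩, hρ⟩)
    rwa [hS, Equiv.symm_apply_apply] at this

/-- Soundness of a candidate: `mul_eq` is the multiplicity criterion of `matrixIso_twoProduct`,
tested only on patterns that occur in columns. -/
theorem Splits.isTwoProductOf {A : ℕ → ℕ → ℝ} {m n r : ℕ} {ρ₁ ρ₂ σ₁ σ₂ : ℕ → Prop}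
    (h : Splits A m n r ρ₁ ρ₂ σ₁ σ₂) (hr : r < m) {S : Matrix (Fin m) (Fin n) ℝ}
    (hS : ∀ i j, S i j = A i j)
    {S₁ : Matrix (Fin (cnt m ρ₁)) (Fin (cnt n σ₁)) ℝ} (h₁ : IsSub A m n ρ₁ σ₁ S₁)
    {S₂ : Matrix (Fin (cnt m ρ₂)) (Fin (cnt n σ₂)) ℝ} (h₂ : IsSub A m n ρ₂ σ₂ S₂) :
    IsTwoProductOf S S₁ (numbering m ρ₁ ⟨⟨r, hr⟩, h.left_special⟩)
      S₂ (numbering m ρ₂ ⟨⟨r, hr⟩, h.right_special⟩) := by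
  have hpos : ∀ i < n, 0 < cnt n fun k => SameCol A m ρ₁ k i ∧ SameCol A m ρ₂ k i := fun i hi =>
    cnt_pos.2 ⟨i, hi, fun _ _ _ => rfl, fun _ _ _ => rfl⟩
  -- The joint multiplicity of an existing column is positive, so by `mul_eq` neither factor has
  -- lost its pattern. In particular both special rows keep a 0 and a 1.
  have hex₁ : ∀ i < n, ∃ j < n, σ₁ j ∧ A r j = A r i := fun i hi => by
    have h1 := hpos i hi
    rw [← h.mul_eq i hi i hi rfl] at h1
    obtain ⟨j, hj, h2, h3⟩ := cnt_pos.1 (Nat.pos_of_mul_pos_right h1)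
    exact ⟨j, hj, h2, h3 r hr h.left_special⟩
  have hex₂ : ∀ i < n, ∃ j < n, σ₂ j ∧ A r j = A r i := fun i hi => by
    have h1 := hpos i hi
    rw [← h.mul_eq i hi i hi rfl] at h1
    obtain ⟨j, hj, h2, h3⟩ := cnt_pos.1 (Nat.pos_of_mul_pos_left h1)
    exact ⟨j, hj, h2, h3 r hr h.right_special⟩
  obtain ⟨j0, hj0, hj0'⟩ := h.exists_zero
  obtain ⟨j1, hj1, hj1'⟩ := h.exists_one
  refine ⟨isSpecialRow_of_isSub hr _ h.zero_or_one (hj0' ▸ hex₁ j0 hj0) (hj1' ▸ hex₁ j1 hj1)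
    h.exists_left h₁, isSpecialRow_of_isSub hr _ h.zero_or_one (hj0' ▸ hex₂ j0 hj0)
    (hj1' ▸ hex₂ j1 hj1) h.exists_right h₂, ?_⟩
  refine matrixIso_twoProduct (r := ⟨r, hr⟩) (fun i => ((numbering m ρ₁).symm i).1)
    (fun i => ((numbering m ρ₂).symm i).1) (Subtype.val_injective.comp (Equiv.injective _))
    (Subtype.val_injective.comp (Equiv.injective _)) (by simp) (by simp) ?_ ?_ ?_ ?_
  · intro i j hij
    refine Fin.ext (h.left_and_right _ (Fin.is_lt _) ((numbering m ρ₁).symm i).2 ?_)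
    rw [hij]
    exact ((numbering m ρ₂).symm j).2
  · intro x
    rcases h.left_or_right x x.2 with hx | hx
    · exact Or.inl ⟨numbering m ρ₁ ⟨x, hx⟩, by simp⟩
    · exact Or.inr ⟨numbering m ρ₂ ⟨x, hx⟩, by simp⟩
  · intro j
    rw [hS]
    exact h.zero_or_one j j.2
  · intro c _
    rw [h₁.card_eq c, h₂.card_eq c]
    have e : Nat.card {j // ∀ x, S x j = c x} = cnt n fun k =>
        (∀ (x : ℕ) (hx : x < m), ρ₁ x → A x k = c ⟨x, hx⟩) ∧
        ∀ (x : ℕ) (hx : x < m), ρ₂ x → A x k = c ⟨x, hx⟩ := by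
      rw [← card_subtype_fin]
      refine Nat.card_congr (Equiv.subtypeEquivRight fun j => ?_)
      simp only [hS]
      constructor
      · exact fun hj => ⟨fun x hx _ => hj ⟨x, hx⟩, fun x hx _ => hj ⟨x, hx⟩⟩
      · intro hj x
        rcases h.left_or_right x x.2 with hx | hx
        · exact hj.1 x x.2 hx
        · exact hj.2 x x.2 hx
    rw [e]
    -- If the pattern occurs in no column on one of the sides, both counts are zero. Otherwise
    -- columns `i` and `j` represent it, and they agree in row `r`, which belongs to both sides.
    by_cases hi : ∃ i < n, ∀ (x : ℕ) (hx : x < m), ρ₁ x → A x i = c ⟨x, hx⟩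
    · by_cases hj : ∃ j < n, ∀ (x : ℕ) (hx : x < m), ρ₂ x → A x j = c ⟨x, hx⟩
      · obtain ⟨i, hi, hi'⟩ := hi
        obtain ⟨j, hj, hj'⟩ := hj
        have e1 : ∀ k, (∀ (x : ℕ) (hx : x < m), ρ₁ x → A x k = c ⟨x, hx⟩) ↔ SameCol A m ρ₁ k i :=
          fun k => forall₃_congr fun x hx hρ => by rw [hi' x hx hρ]
        have e2 : ∀ k, (∀ (x : ℕ) (hx : x < m), ρ₂ x → A x k = c ⟨x, hx⟩) ↔ SameCol A m ρ₂ k j :=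
          fun k => forall₃_congr fun x hx hρ => by rw [hj' x hx hρ]
        simp only [e1, e2]
        exact (h.mul_eq i hi j hj ((hi' r hr h.left_special).trans
          (hj' r hr h.right_special).symm)).symm
      · push Not at hj
        rw [cnt_eq_zero, cnt_eq_zero (n := n) (p := fun k => σ₂ k ∧ _), mul_zero]
        · rintro k hk ⟨-, h2⟩
          obtain ⟨x, hx, hρ, hne⟩ := hj k hk
          exact hne (h2 x hx hρ)
        · rintro k hk ⟨-, h2⟩
          obtain ⟨x, hx, hρ, hne⟩ := hj k hk
          exact hne (h2 x hx hρ)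
    · push Not at hi
      rw [cnt_eq_zero, cnt_eq_zero (n := n) (p := fun k => σ₁ k ∧ _), zero_mul]
      · rintro k hk ⟨-, h2⟩
        obtain ⟨x, hx, hρ, hne⟩ := hi k hk
        exact hne (h2 x hx hρ)
      · rintro k hk ⟨h2, -⟩
        obtain ⟨x, hx, hρ, hne⟩ := hi k hk
        exact hne (h2 x hx hρ)

/-! ### Factors of a 2-product are found -/

theorem cnt_eq_card_of_bij {α : Type*} {n : ℕ} {p : ℕ → Prop} (g : α → ℕ)
    (hg : Function.Injective g) (h : ∀ k, k < n ∧ p k ↔ k ∈ Set.range g) : cnt n p = Nat.card α := by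
  have : {k | k < n ∧ p k} = Set.range g := Set.ext h
  rw [cnt, this, ← Nat.card_coe_set_eq, Nat.card_range_of_injective hg]

/-- If the columns are indexed by `α × β`, the pattern on `P` depends on `α` only and that on `Q` on
`β` only, then with `u`, `v` the numbers of matching indices, independence reads `(u * |β|) * (|α| *
v) = (u * v) * (|α| * |β|)`. -/
theorem indRows_of_prod {A : ℕ → ℕ → ℝ} {n : ℕ} {q : ℕ → Prop} {P Q : Set ℕ} {α β : Type*}
    (g : α × β → ℕ) (hg : Function.Injective g) (h : ∀ k, k < n ∧ q k ↔ k ∈ Set.range g)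
    (hP : ∀ x ∈ P, ∀ a b b', A x (g (a, b)) = A x (g (a, b')))
    (hQ : ∀ x ∈ Q, ∀ a a' b, A x (g (a, b)) = A x (g (a', b))) : IndRows A n q P Q := by
  intro c
  have key : ∀ (R : Set ℕ) (u : α → Prop) (v : β → Prop),
      (∀ a b, (∀ x ∈ R, A x (g (a, b)) = c x) ↔ u a ∧ v b) →
      colNum A n q R c = Nat.card {a // u a} * Nat.card {b // v b} := by
    intro R u v huv
    rw [← Nat.card_prod]
    refine cnt_eq_card_of_bij (fun z => g (z.1.1, z.2.1)) ?_ ?_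
    · rintro ⟨⟨a, ha⟩, ⟨b, hb⟩⟩ ⟨⟨a', ha'⟩, ⟨b', hb'⟩⟩ hz
      have := hg hz
      simp only [Prod.mk.injEq] at this
      obtain ⟨rfl, rfl⟩ := this
      rfl
    · intro k
      constructor
      · rintro ⟨h1, h2, h3⟩
        obtain ⟨⟨a, b⟩, rfl⟩ := (h k).1 ⟨h1, h2⟩
        have := (huv a b).1 h3
        exact ⟨(⟨a, this.1⟩, ⟨b, this.2⟩), rfl⟩
      · rintro ⟨⟨⟨a, ha⟩, ⟨b, hb⟩⟩, rfl⟩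
        have h1 := (h _).2 ⟨(a, b), rfl⟩
        exact ⟨h1.1, h1.2, (huv a b).2 ⟨ha, hb⟩⟩
  let u : α → Prop := fun a => ∀ b, ∀ x ∈ P, A x (g (a, b)) = c x
  let v : β → Prop := fun b => ∀ a, ∀ x ∈ Q, A x (g (a, b)) = c x
  have hu : ∀ a b, (∀ x ∈ P, A x (g (a, b)) = c x) ↔ u a := fun a b =>
    ⟨fun h b' x hx => by rw [hP x hx a b' b, h x hx], fun h => h b⟩
  have hv : ∀ a b, (∀ x ∈ Q, A x (g (a, b)) = c x) ↔ v b := fun a b =>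
    ⟨fun h a' x hx => by rw [hQ x hx a' a b, h x hx], fun h => h a⟩
  have h0 : cnt n q = colNum A n q ∅ c := cnt_congr fun k _ => by simp
  rw [h0, key P u (fun _ => True) (fun a b => by rw [hu, and_true]),
    key Q (fun _ => True) v (fun a b => by rw [hv, true_and]),
    key (P ∪ Q) u v (fun a b => by rw [← hu a b, ← hv a b]; simp [or_imp, forall_and]),
    key ∅ (fun _ => True) (fun _ => True) (by simp)]
  ring

/-- `P` and `Q` are the nonspecial rows of the two factors. Within each block of the 2-product the
columns form a full Cartesian product, which gives independence. -/
theorem IsTwoProduct.exists_condInd {m n : ℕ} {S : Matrix (Fin m) (Fin n) ℝ} {A : ℕ → ℕ → ℝ}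
    (hS : ∀ i j, S i j = A i j) (h : IsTwoProduct S) :
    ∃ r < m, ∃ P Q : Set ℕ, P ⊆ Set.Iio m ∧ (∀ x < m, x = r ∨ x ∈ P ∨ x ∈ Q) ∧ r ∉ P ∧ r ∉ Q ∧
      Disjoint P Q ∧ P.Nonempty ∧ (∃ x < m, x ∈ Q) ∧ CondInd A n r P Q ∧
      (∀ j < n, A r j = 0 ∨ A r j = 1) ∧ (∃ j < n, A r j = 0) ∧ ∃ j < n, A r j = 1 := by
  obtain ⟨m₁, n₁, m₂, n₂, S₁, x₁, S₂, y₁, h₁, h₂, e, f, hef⟩ := h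
  let r : Fin m := e.symm (Sum.inr ())
  have hrow : ∀ i j, A (e.symm i) (f.symm j) = twoProduct S₁ x₁ S₂ y₁ i j := fun i j => by
    rw [← hS, hef]; simp
  let P : Set ℕ := Set.range fun i => ((e.symm (Sum.inl (Sum.inl i)) : Fin m) : ℕ)
  let Q : Set ℕ := Set.range fun i => ((e.symm (Sum.inl (Sum.inr i)) : Fin m) : ℕ)
  have inj : ∀ i j, ((e.symm i : Fin m) : ℕ) = e.symm j → i = j := fun i j hij =>
    e.symm.injective (Fin.ext hij)
  have hr0 : ∀ j, A r (f.symm (Sum.inl j)) = 0 := fun j => hrow (Sum.inr ()) (Sum.inl j)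
  have hr1 : ∀ j, A r (f.symm (Sum.inr j)) = 1 := fun j => hrow (Sum.inr ()) (Sum.inr j)
  have h01 : ∀ j < n, A r j = 0 ∨ A r j = 1 := by
    intro j hj
    obtain ⟨j', hj'⟩ := f.symm.surjective ⟨j, hj⟩
    have hj'' : j = (f.symm j' : Fin n) := by rw [hj']
    rw [hj'']
    rcases j' with j' | j'
    · exact Or.inl (hr0 j')
    · exact Or.inr (hr1 j')
  refine ⟨r, r.2, P, Q, ?_, ?_, ?_, ?_, ?_, ?_, ?_, ?_, h01, ?_, ?_⟩
  · rintro _ ⟨i, rfl⟩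
    exact Fin.is_lt _
  · intro x hx
    obtain ⟨i, hi⟩ := e.symm.surjective ⟨x, hx⟩
    have hi' : x = (e.symm i : Fin m) := by rw [hi]
    rcases i with (i | i) | i
    · exact Or.inr (Or.inl ⟨i, hi'.symm⟩)
    · exact Or.inr (Or.inr ⟨i, hi'.symm⟩)
    · exact Or.inl hi'
  · rintro ⟨i, hi⟩
    simpa using inj _ _ hi
  · rintro ⟨i, hi⟩
    simpa using inj _ _ hi
  · rw [Set.disjoint_left]
    rintro _ ⟨i, rfl⟩ ⟨j, hj⟩
    simpa using inj _ _ hj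
  · obtain ⟨i, hi⟩ := h₁.exists_other_row
    exact ⟨_, ⟨i, hi⟩, rfl⟩
  · obtain ⟨i, hi⟩ := h₂.exists_other_row
    exact ⟨_, Fin.is_lt _, ⟨i, hi⟩, rfl⟩
  · intro a
    by_cases ha0 : a = 0
    · subst ha0
      refine indRows_of_prod (fun z => ((f.symm (Sum.inl z) : Fin n) : ℕ)) ?_ ?_ ?_ ?_
      · exact fun z z' hz => Sum.inl_injective (f.symm.injective (Fin.ext hz))
      · intro k
        constructor
        · rintro ⟨hk, hk0⟩
          obtain ⟨j, hj⟩ := f.symm.surjective ⟨k, hk⟩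
          have hj' : k = (f.symm j : Fin n) := by rw [hj]
          rcases j with j | j
          · exact ⟨j, hj'.symm⟩
          · rw [hj', hr1] at hk0
            exact absurd hk0 one_ne_zero
        · rintro ⟨j, rfl⟩
          exact ⟨Fin.is_lt _, hr0 j⟩
      · rintro _ ⟨i, rfl⟩ a b b'
        simp only [hrow]
        rfl
      · rintro _ ⟨i, rfl⟩ a a' b
        simp only [hrow]
        rfl
    · by_cases ha1 : a = 1
      · subst ha1
        refine indRows_of_prod (fun z => ((f.symm (Sum.inr z) : Fin n) : ℕ)) ?_ ?_ ?_ ?_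
        · exact fun z z' hz => Sum.inr_injective (f.symm.injective (Fin.ext hz))
        · intro k
          constructor
          · rintro ⟨hk, hk1⟩
            obtain ⟨j, hj⟩ := f.symm.surjective ⟨k, hk⟩
            have hj' : k = (f.symm j : Fin n) := by rw [hj]
            rcases j with j | j
            · rw [hj', hr0] at hk1
              exact absurd hk1 zero_ne_one
            · exact ⟨j, hj'.symm⟩
          · rintro ⟨j, rfl⟩
            exact ⟨Fin.is_lt _, hr1 j⟩
        · rintro _ ⟨i, rfl⟩ a b b'
          simp only [hrow]
          rfl
        · rintro _ ⟨i, rfl⟩ a a' b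
          simp only [hrow]
          rfl
      -- No column has an entry other than 0 or 1 in row `r`, so all counts vanish.
      · intro c
        have hn : ∀ k < n, ¬ A r k = a := fun k hk h => by
          rcases h01 k hk with h' | h'
          · exact ha0 (h.symm.trans h')
          · exact ha1 (h.symm.trans h')
        have e0 : ∀ R, colNum A n (fun k => A r k = a) R c = 0 := fun R =>
          cnt_eq_zero fun k hk h => hn k hk h.1
        rw [e0, e0 (P ∪ Q), zero_mul, zero_mul]
  · obtain ⟨j, hj⟩ := h₁.exists_zero
    obtain ⟨j', hj'⟩ := h₂.exists_zero
    exact ⟨_, Fin.is_lt _, hr0 (⟨j, hj⟩, ⟨j', hj'⟩)⟩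
  · obtain ⟨j, hj⟩ := h₁.exists_one
    obtain ⟨j', hj'⟩ := h₂.exists_one
    exact ⟨_, Fin.is_lt _, hr1 (⟨j, hj⟩, ⟨j', hj'⟩)⟩

/-- The finest partition yields a class that can be split off. -/
theorem exists_class_condInd {A : ℕ → ℕ → ℝ} {m n r : ℕ} {P Q : Set ℕ} (hr : r < m)
    (hPm : P ⊆ Set.Iio m) (hcov : ∀ x < m, x = r ∨ x ∈ P ∨ x ∈ Q) (hrP : r ∉ P) (hrQ : r ∉ Q)
    (hPQ : Disjoint P Q) (hP : P.Nonempty) (hQ : ∃ x < m, x ∈ Q) (h : CondInd A n r P Q) :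
    ∃ w < m, w ≠ r ∧ labels A n r m r ≠ labels A n r m w ∧
      (∃ u < m, u ≠ r ∧ labels A n r m u ≠ labels A n r m w) ∧
      CondInd A n r {x | x < m ∧ labels A n r m x = labels A n r m w}
        {x | x < m ∧ labels A n r m x ≠ labels A n r m w} := by
  have hrs : CondInd A n r {r} (Set.Iio m \ {r}) := fun a =>
    indRows_singleton (fun k _ hk => hk)
  have hrc := (condInd_iff_closed m {r} (by simpa using hr)).1 hrs
  -- The row `r` is added to the side of `Q`, so that `P` is separated from all other rows and hence
  -- is a union of classes.
  have hPs : CondInd A n r P (Set.Iio m \ P) := by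
    intro a
    have h1 : IndRows A n (fun k => A r k = a) P (Q ∪ {r}) :=
      (h a).assoc (indRows_singleton fun k _ hk => hk).symm (by
        rw [Set.disjoint_singleton_right]
        simp [hrP, hrQ])
    refine h1.mono_right ?_ ?_
    · rw [Set.disjoint_union_right]
      exact ⟨hPQ, by simpa using hrP⟩
    · rintro x ⟨hx, hxP⟩
      rcases hcov x hx with h | h | h
      · exact Or.inr h
      · exact absurd h hxP
      · exact Or.inl h
  have hPc := (condInd_iff_closed m P hPm).1 hPs
  obtain ⟨w, hw⟩ := hP
  obtain ⟨u, hu, huQ⟩ := hQ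
  -- Any `w` in `P` will do: its class lies within `P`, so it misses both `r` and the row `u` of
  -- `Q`.
  refine ⟨w, hPm hw, fun h => hrP (h ▸ hw), fun h => ?_, ⟨u, hu, fun h => hrQ (h ▸ huQ), fun h => ?_⟩,
    ?_⟩
  · exact hrP ((hrc r hr w (hPm hw) h rfl : w = r) ▸ hw)
  · exact Set.disjoint_left.1 hPQ (hPc w (hPm hw) u hu h.symm hw) huQ
  · have := (condInd_iff_closed (A := A) (n := n) (r := r) m
      {x | x < m ∧ labels A n r m x = labels A n r m w} (fun x hx => hx.1)).2
      (fun x hx y hy hxy h => ⟨hy, hxy.symm.trans h.2⟩)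
    convert this using 1
    ext x
    simp only [Set.mem_ofPred_eq, Set.mem_sdiff, Set.mem_Iio]
    tauto

/-- The multiplicities of the columns can be distributed to the two factors. -/
theorem IndRows.exists_factor {A : ℕ → ℕ → ℝ} {n : ℕ} {q : ℕ → Prop} {P Q : Set ℕ}
    (h : IndRows A n q P Q) (hPQ : Disjoint P Q) (hne : ∃ k < n, q k) :
    ∃ t < n, ∃ s < n, (∀ k < n, q k → t + 1 ∣ colNum A n q P (fun x => A x k)) ∧
      (∀ k < n, q k → s + 1 ∣ colNum A n q Q (fun x => A x k)) ∧ (t + 1) * (s + 1) = cnt n q := by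
  classical
  set D := (Finset.range n).filter q with hD
  have hmem : ∀ k, k ∈ D ↔ k < n ∧ q k := by simp [hD]
  set g := D.gcd fun k => colNum A n q P (fun x => A x k) with hg
  have hgdvd : ∀ k < n, q k → g ∣ colNum A n q P (fun x => A x k) := fun k hk hq =>
    Finset.gcd_dvd ((hmem k).2 ⟨hk, hq⟩)
  -- The total `cnt n q` is the sum of the multiplicities of the patterns on `P`.
  have hgN : g ∣ cnt n q := by
    obtain ⟨T, -, hsum⟩ := exists_colNum_eq_sum (A := A) (n := n) (q := q) (Set.empty_subset P) 0
    have h0 := hsum ∅ (Set.empty_disjoint _)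
    rw [Set.empty_union, Set.empty_union] at h0
    have h1 : cnt n q = colNum A n q ∅ 0 := cnt_congr fun k _ => by simp
    rw [h1, h0]
    refine Finset.dvd_sum fun b _ => ?_
    by_cases hb : ∃ k < n, q k ∧ ∀ x ∈ P, A x k = b x
    · obtain ⟨k, hk, hq, hb⟩ := hb
      rw [← colNum_congr hb]
      exact hgdvd k hk hq
    · rw [colNum, cnt_eq_zero fun k hk h => hb ⟨k, hk, h⟩]
      exact dvd_zero _
  have hNpos : 0 < cnt n q := cnt_pos.2 hne
  have hNn : cnt n q ≤ n := by
    rw [cnt_eq_card]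
    exact (Finset.card_filter_le _ _).trans (Finset.card_range n).le
  obtain ⟨s, hs⟩ := hgN
  have hgpos : 0 < g := Nat.pos_of_ne_zero fun h0 => by rw [hs, h0, zero_mul] at hNpos; omega
  have hspos : 0 < s := Nat.pos_of_ne_zero fun h0 => by rw [hs, h0, mul_zero] at hNpos; omega
  have hgle : g ≤ cnt n q := by rw [hs]; exact Nat.le_mul_of_pos_right _ hspos
  have hsle : s ≤ cnt n q := by rw [hs]; exact Nat.le_mul_of_pos_left _ hgpos
  -- The divisors are positive and at most `n`; they are encoded as `t + 1` with `t < n`, the range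
  -- of a loop.
  refine ⟨g - 1, by omega, s - 1, by omega, ?_, ?_, ?_⟩
  · rwa [Nat.sub_add_cancel hgpos]
  · rw [Nat.sub_add_cancel hspos]
    intro j hj hqj
    -- By independence the total divides every product of a multiplicity on `P` and one on `Q`.
    -- Taking the gcd over `k`, `g * s` divides `g` times the multiplicity on `Q`; cancel `g`.
    have hall : ∀ k ∈ D, cnt n q ∣
        colNum A n q P (fun x => A x k) * colNum A n q Q (fun x => A x j) := by
      intro k hk
      have := h fun x => if x ∈ P then A x k else A x j
      rw [colNum_congr (P := P) (c' := fun x => A x k) (fun x hx => by simp [hx]),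
        colNum_congr (P := Q) (c' := fun x => A x j)
          (fun x hx => by simp [Set.disjoint_right.1 hPQ hx])] at this
      exact ⟨_, this.trans (mul_comm _ _)⟩
    have h2 := Finset.dvd_gcd hall
    rw [Finset.gcd_mul_right] at h2
    simp only [normalize_eq] at h2
    rw [hs] at h2
    exact Nat.dvd_of_mul_dvd_mul_left hgpos h2
  · rw [Nat.sub_add_cancel hgpos, Nat.sub_add_cancel hspos, hs]

/-- The ranks of the indices with `p` run through `0, 1, 2, …`, so bounding the rank by `w` selects
the first `w` of them, if there are that many. -/
theorem cnt_and_cnt_lt (p : ℕ → Prop) (w n : ℕ) :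
    cnt n (fun k => p k ∧ cnt k p < w) = min w (cnt n p) := by
  induction n with
  | zero => simp
  | succ n ih =>
    rw [cnt_succ, cnt_succ, ih]
    by_cases hp : p n <;> by_cases hw : cnt n p < w <;> simp [hp, hw] <;> omega

/-- Formulas multiply only counts, so the divisor `t + 1` has to be written as a count; `t < n`
makes this possible. In the same way `cnt_eq_self` supplies the factor 1. -/
theorem cnt_le_of_lt {t n : ℕ} (h : t < n) : cnt n (fun l => l ≤ t) = t + 1 := by
  induction n, Nat.succ_le_of_lt h using Nat.le_induction with
  | base =>
    have : ∀ j ≤ t + 1, cnt j (fun l => l ≤ t) = j := by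
      intro j hj
      induction j with
      | zero => simp
      | succ j ih => rw [cnt_succ, ih (by omega), if_pos (by omega)]
    exact this _ le_rfl
  | succ n hn ih => rw [cnt_succ, ih (by omega), if_neg (by omega)]

theorem cnt_eq_self {k n : ℕ} (h : k < n) : cnt n (fun l => l = k) = 1 := by
  rw [cnt_eq_card, Finset.filter_eq', if_pos (Finset.mem_range.2 h), Finset.card_singleton]

/-- Among the columns that agree with `k` in the rows with `ρ`, select each `(t₀ + 1)`-th (or
`(t₁ + 1)`-th, according to the entry in row `r`), those coming first. -/
def Sel (A : ℕ → ℕ → ℝ) (m n r : ℕ) (ρ : ℕ → Prop) (t₀ t₁ k : ℕ) : Prop :=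
  cnt n (fun l => l < k ∧ SameCol A m ρ l k) *
      cnt n (fun l => (A r k = 0 ∧ l ≤ t₀) ∨ (A r k ≠ 0 ∧ l ≤ t₁)) <
    cnt n (fun l => SameCol A m ρ l k) * cnt n (fun l => l = k)

theorem cnt_lt_and {p : ℕ → Prop} {k n : ℕ} (h : k ≤ n) :
    cnt n (fun l => l < k ∧ p l) = cnt k p := by
  rw [cnt, cnt]
  congr 1
  ext l
  simp only [Set.mem_ofPred_eq]
  constructor
  · exact fun h => h.2
  · exact fun h' => ⟨by omega, h'⟩

theorem SameCol.congr {A : ℕ → ℕ → ℝ} {m : ℕ} {ρ : ℕ → Prop} {k i : ℕ} (h : SameCol A m ρ k i)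
    (l : ℕ) : SameCol A m ρ l k ↔ SameCol A m ρ l i :=
  forall₃_congr fun x hx hρ => by rw [h x hx hρ]

/-- In a group of `(t + 1) * w` equal columns, `k` is selected if `rank * (t + 1) < (t + 1) * w`,
that is, if its rank is below `w`. Thus exactly `w` columns are kept. -/
theorem cnt_sel {A : ℕ → ℕ → ℝ} {m n r t₀ t₁ i t : ℕ} {ρ : ℕ → Prop} (hr : r < m) (hρ : ρ r)
    (ht₀ : t₀ < n) (ht₁ : t₁ < n) (ht : A r i = 0 ∧ t = t₀ ∨ A r i ≠ 0 ∧ t = t₁)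
    (hdvd : t + 1 ∣ cnt n fun k => SameCol A m ρ k i) :
    cnt n (fun k => Sel A m n r ρ t₀ t₁ k ∧ SameCol A m ρ k i) * (t + 1) =
      cnt n fun k => SameCol A m ρ k i := by
  obtain ⟨w, hw⟩ := hdvd
  have e : cnt n (fun k => Sel A m n r ρ t₀ t₁ k ∧ SameCol A m ρ k i) =
      cnt n (fun k => SameCol A m ρ k i ∧ cnt k (fun l => SameCol A m ρ l i) < w) := by
    refine cnt_congr fun k hk => ?_
    rw [and_comm]
    refine and_congr_right fun hki => ?_
    have e1 : cnt n (fun l => (A r k = 0 ∧ l ≤ t₀) ∨ (A r k ≠ 0 ∧ l ≤ t₁)) = t + 1 := by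
      rw [hki r hr hρ]
      rcases ht with ⟨h, rfl⟩ | ⟨h, rfl⟩
      · simpa [h] using cnt_le_of_lt ht₀
      · simpa [h] using cnt_le_of_lt ht₁
    rw [Sel, e1, cnt_eq_self hk, mul_one]
    simp only [hki.congr]
    rw [hw, cnt_lt_and hk.le, mul_comm]
    exact Nat.mul_lt_mul_left (Nat.succ_pos t)
  rw [e, cnt_and_cnt_lt, min_eq_left, hw, mul_comm]
  rw [hw]
  exact Nat.le_mul_of_pos_left _ (Nat.succ_pos t)

/-- The rows of the first factor: the class of `w` and the special row. -/
def LeftRow (lab : ℕ → ℕ) (r w x : ℕ) : Prop := x = r ∨ lab x = lab w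

/-- The rows of the second factor: all rows outside of the class of `w`. -/
def RightRow (lab : ℕ → ℕ) (w x : ℕ) : Prop := lab x ≠ lab w

/-- Completeness of the search. The class of a suitable `w` is split off, and the divisors come from
`IndRows.exists_factor` for the values 0 and 1 in row `r` separately. -/
theorem exists_splits {m n : ℕ} {S : Matrix (Fin m) (Fin n) ℝ} {A : ℕ → ℕ → ℝ}
    (hS : ∀ i j, S i j = A i j) (h : IsTwoProduct S) :
    ∃ r < m, ∃ w < m, ∃ t₀ < n, ∃ t₁ < n, ∃ s₀ < n, ∃ s₁ < n,
      Splits A m n r (LeftRow (labels A n r m) r w) (RightRow (labels A n r m) w)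
        (Sel A m n r (LeftRow (labels A n r m) r w) t₀ t₁)
        (Sel A m n r (RightRow (labels A n r m) w) s₀ s₁) := by
  obtain ⟨r, hr, P, Q, hPm, hcov, hrP, hrQ, hPQ, hP, hQ, hind, h01, h0, h1⟩ :=
    IsTwoProduct.exists_condInd hS h
  obtain ⟨w, hw, hwr, hrw, ⟨u, hu, hur, huw⟩, hc⟩ :=
    exists_class_condInd hr hPm hcov hrP hrQ hPQ hP hQ hind
  clear hPm hcov hrP hrQ hPQ hP hQ hind P Q h
  set lab := labels A n r m with hlab
  set P := {x | x < m ∧ lab x = lab w} with hP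
  set Q := {x | x < m ∧ lab x ≠ lab w} with hQ
  have hPQ : Disjoint P Q := Set.disjoint_left.2 fun x hx hx' => hx'.2 hx.2
  obtain ⟨t₀, ht₀, s₀, hs₀, dt₀, ds₀, hts₀⟩ := (hc 0).exists_factor hPQ h0
  obtain ⟨t₁, ht₁, s₁, hs₁, dt₁, ds₁, hts₁⟩ := (hc 1).exists_factor hPQ h1
  have e1 : ∀ k i, SameCol A m (LeftRow lab r w) k i ↔ A r k = A r i ∧ ∀ x ∈ P, A x k = A x i := by
    intro k i
    constructor
    · exact fun h => ⟨h r hr (Or.inl rfl), fun x hx => h x hx.1 (Or.inr hx.2)⟩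
    · rintro ⟨h, h'⟩ x hx (rfl | hx')
      · exact h
      · exact h' x ⟨hx, hx'⟩
  have e2 : ∀ k i, SameCol A m (RightRow lab w) k i ↔ A r k = A r i ∧ ∀ x ∈ Q, A x k = A x i := by
    intro k i
    constructor
    · exact fun h => ⟨h r hr hrw, fun x hx => h x hx.1 hx.2⟩
    · rintro ⟨h, h'⟩ x hx hx'
      exact h' x ⟨hx, hx'⟩
  refine ⟨r, hr, w, hw, t₀, ht₀, t₁, ht₁, s₀, hs₀, s₁, hs₁, ?_⟩
  refine ⟨h01, h0, h1, Or.inl rfl, hrw, ?_, ?_, ⟨w, hw, hwr, Or.inr rfl⟩, ⟨u, hu, hur, huw⟩, ?_⟩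
  · intro x _
    by_cases hx : lab x = lab w
    · exact Or.inl (Or.inr hx)
    · exact Or.inr hx
  · rintro x _ (hx | hx) hx'
    · exact hx
    · exact absurd hx hx'
  · intro i hi j hj hij
    -- If the selections keep `a` and `b` columns, the full multiplicities are `a * (t + 1)` and `b
    -- * (s + 1)`. Independence equates their product with the joint count times `(t + 1) * (s +
    -- 1)`, and this factor cancels.
    have key : ∀ t s, (A r i = 0 ∧ t = t₀ ∨ A r i ≠ 0 ∧ t = t₁) →
        (A r j = 0 ∧ s = s₀ ∨ A r j ≠ 0 ∧ s = s₁) →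
        t + 1 ∣ colNum A n (fun k => A r k = A r i) P (fun x => A x i) →
        s + 1 ∣ colNum A n (fun k => A r k = A r j) Q (fun x => A x j) →
        (t + 1) * (s + 1) = cnt n (fun k => A r k = A r i) →
        cnt n (fun k => Sel A m n r (LeftRow lab r w) t₀ t₁ k ∧ SameCol A m (LeftRow lab r w) k i) *
          cnt n (fun k => Sel A m n r (RightRow lab w) s₀ s₁ k ∧ SameCol A m (RightRow lab w) k j) =
        cnt n fun k => SameCol A m (LeftRow lab r w) k i ∧ SameCol A m (RightRow lab w) k j := by
      intro t s ht hs dt ds hts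
      have f1 : (cnt n fun k => SameCol A m (LeftRow lab r w) k i) =
          colNum A n (fun k => A r k = A r i) P (fun x => A x i) := by simp only [e1]; rfl
      have f2 : (cnt n fun k => SameCol A m (RightRow lab w) k j) =
          colNum A n (fun k => A r k = A r j) Q (fun x => A x j) := by simp only [e2]; rfl
      have g1 := cnt_sel (i := i) (ρ := LeftRow lab r w) hr (Or.inl rfl) ht₀ ht₁ ht (by rwa [f1])
      have g2 := cnt_sel (i := j) (ρ := RightRow lab w) hr hrw hs₀ hs₁ hs (by rwa [f2])
      classical
      have h3 := hc (A r i) fun x => if x ∈ P then A x i else A x j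
      rw [colNum_congr (P := P) (c' := fun x => A x i) (fun x hx => by simp [hx]),
        colNum_congr (P := Q) (c' := fun x => A x j)
          (fun x hx => by simp [Set.disjoint_right.1 hPQ hx]), ← f1, ← g1, hij, ← f2, ← g2] at h3
      have f3 : colNum A n (fun k => A r k = A r j) (P ∪ Q) (fun x => if x ∈ P then A x i else A x j)
          = cnt n fun k => SameCol A m (LeftRow lab r w) k i ∧ SameCol A m (RightRow lab w) k j := by
        refine cnt_congr fun k _ => ?_
        rw [e1, e2, hij]
        constructor
        · rintro ⟨h, h'⟩
          refine ⟨⟨h, fun x hx => ?_⟩, h, fun x hx => ?_⟩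
          · simpa [hx] using h' x (Or.inl hx)
          · simpa [Set.disjoint_right.1 hPQ hx] using h' x (Or.inr hx)
        · rintro ⟨⟨h, h'⟩, -, h''⟩
          refine ⟨h, fun x hx => ?_⟩
          rcases hx with hx | hx
          · simpa [hx] using h' x hx
          · simpa [Set.disjoint_right.1 hPQ hx] using h'' x hx
      rw [f3, ← hij, ← hts] at h3
      refine Nat.eq_of_mul_eq_mul_right (by positivity : 0 < (t + 1) * (s + 1)) ?_
      rw [← h3]
      ring
    rcases h01 i hi with ha | ha
    · refine key t₀ s₀ (Or.inl ⟨ha, rfl⟩) (Or.inl ⟨by rw [← hij, ha], rfl⟩) ?_ ?_ ?_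
      · rw [ha]; exact dt₀ i hi ha
      · rw [← hij, ha]; exact ds₀ j hj (by rw [← hij, ha])
      · rw [ha]; exact hts₀
    · have hne : A r i ≠ 0 := by rw [ha]; exact one_ne_zero
      refine key t₁ s₁ (Or.inr ⟨hne, rfl⟩) (Or.inr ⟨by rwa [← hij], rfl⟩) ?_ ?_ ?_
      · rw [ha]; exact dt₁ i hi ha
      · rw [← hij, ha]; exact ds₁ j hj (by rw [← hij, ha])
      · rw [ha]; exact hts₁

/-! ### The formulas used by the algorithm -/

/-- Only patterns taken from existing columns matter, that on `P` from a column `i` and that on `Q`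
from a column `j`; for all others both sides are zero. This reduces independence to polynomially
many equations between counts. -/
theorem condInd_iff_cnt {A : ℕ → ℕ → ℝ} {n r : ℕ} {P Q : Set ℕ} (hPQ : Disjoint P Q) :
    CondInd A n r P Q ↔ ∀ i < n, ∀ j < n, A r i = A r j →
      cnt n (fun k => A r k = A r i ∧ ∀ x ∈ P, A x k = A x i) *
        cnt n (fun k => A r k = A r i ∧ ∀ x ∈ Q, A x k = A x j) =
      cnt n (fun k => A r k = A r i ∧ (∀ x ∈ P, A x k = A x i) ∧ ∀ x ∈ Q, A x k = A x j) *
        cnt n (fun k => A r k = A r i) := by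
  classical
  have key : ∀ (a : ℝ) (c d : ℕ → ℝ), (∀ x ∈ P, c x = d x) → ∀ d' : ℕ → ℝ, (∀ x ∈ Q, c x = d' x) →
      colNum A n (fun k => A r k = a) (P ∪ Q) c =
        cnt n (fun k => A r k = a ∧ (∀ x ∈ P, A x k = d x) ∧ ∀ x ∈ Q, A x k = d' x) := by
    intro a c d hd d' hd'
    refine cnt_congr fun k _ => and_congr_right fun _ => ?_
    simp only [Set.mem_union, or_imp, forall_and]
    exact and_congr (forall₂_congr fun x hx => by rw [hd x hx])
      (forall₂_congr fun x hx => by rw [hd' x hx])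
  constructor
  · intro h i _ j _ _
    have := h (A r i) fun x => if x ∈ P then A x i else A x j
    rw [colNum_congr (P := P) (c' := fun x => A x i) (fun x hx => by simp [hx]),
      colNum_congr (P := Q) (c' := fun x => A x j)
        (fun x hx => by simp [Set.disjoint_right.1 hPQ hx]),
      key _ _ (fun x => A x i) (fun x hx => by simp [hx]) (fun x => A x j)
        (fun x hx => by simp [Set.disjoint_right.1 hPQ hx])] at this
    exact this
  · intro h a c
    by_cases hi : ∃ i < n, A r i = a ∧ ∀ x ∈ P, A x i = c x
    · by_cases hj : ∃ j < n, A r j = a ∧ ∀ x ∈ Q, A x j = c x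
      · obtain ⟨i, hi, rfl, hi'⟩ := hi
        obtain ⟨j, hj, hji, hj'⟩ := hj
        rw [key _ _ (fun x => A x i) (fun x hx => (hi' x hx).symm) (fun x => A x j)
          (fun x hx => (hj' x hx).symm), ← h i hi j hj hji.symm,
          ← colNum_congr hi', ← colNum_congr hj']
        rfl
      · rw [colNum, colNum, colNum, cnt_eq_zero (p := fun k => A r k = a ∧ ∀ x ∈ Q, A x k = c x)
          (fun k hk h => hj ⟨k, hk, h⟩), cnt_eq_zero (p := fun k => _ ∧ ∀ x ∈ P ∪ Q, _)
          (fun k hk h => hj ⟨k, hk, h.1, fun x hx => h.2 x (Or.inr hx)⟩), mul_zero, zero_mul]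
    · rw [colNum, colNum, colNum, cnt_eq_zero (p := fun k => A r k = a ∧ ∀ x ∈ P, A x k = c x)
        (fun k hk h => hi ⟨k, hk, h⟩), cnt_eq_zero (p := fun k => _ ∧ ∀ x ∈ P ∪ Q, _)
        (fun k hk h => hi ⟨k, hk, h.1, fun x hx => h.2 x (Or.inl hx)⟩), zero_mul, zero_mul]

namespace RealRAM

/-- A false test. -/
def Fm.false : Fm := .test (.natLt (.lit 0) (.lit 0))

/-- Bounded existential quantification. -/
def Fm.ex (b : ℕ) (φ : Fm) : Fm := .cntLt b .false .false φ φ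

/-- Bounded universal quantification. -/
def Fm.all (b : ℕ) (φ : Fm) : Fm := .not (.ex b (.not φ))

/-- Implication. -/
def Fm.imp (φ ψ : Fm) : Fm := .not (.and φ (.not ψ))

/-- Equality of products of two counts. -/
def Fm.cntEq (b : ℕ) (φ₁ φ₂ φ₃ φ₄ : Fm) : Fm :=
  .and (.not (.cntLt b φ₁ φ₂ φ₃ φ₄)) (.not (.cntLt b φ₃ φ₄ φ₁ φ₂))

-- The formula reads `0 * 0 < c * c`, with `c` the number of witnesses.
@[simp] theorem Fm.holds_ex (b : ℕ) (φ : Fm) (d : ℕ) (s : State) :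
    (Fm.ex b φ).Holds d s ↔ ∃ k < s.nat (b, 0, 0), φ.Holds (d + 1) (s.setN d 0 0 k) := by
  rw [Fm.ex, Fm.Holds, cnt_eq_zero (fun k _ h => by simp [Fm.false, Fm.Holds, Test.Holds] at h),
    zero_mul, ← cnt_pos]
  constructor
  · exact fun h => Nat.pos_of_mul_pos_left h
  · exact fun h => Nat.mul_pos h h

@[simp] theorem Fm.holds_all (b : ℕ) (φ : Fm) (d : ℕ) (s : State) :
    (Fm.all b φ).Holds d s ↔ ∀ k < s.nat (b, 0, 0), φ.Holds (d + 1) (s.setN d 0 0 k) := by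
  rw [Fm.all, Fm.Holds, Fm.holds_ex]
  simp [Fm.Holds]

@[simp] theorem Fm.holds_imp (φ ψ : Fm) (d : ℕ) (s : State) :
    (Fm.imp φ ψ).Holds d s ↔ (φ.Holds d s → ψ.Holds d s) := by
  simp [Fm.imp, Fm.Holds]

@[simp] theorem Fm.holds_cntEq (b : ℕ) (φ₁ φ₂ φ₃ φ₄ : Fm) (d : ℕ) (s : State) :
    (Fm.cntEq b φ₁ φ₂ φ₃ φ₄).Holds d s ↔
      cnt (s.nat (b, 0, 0)) (fun k => φ₁.Holds (d + 1) (s.setN d 0 0 k)) *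
        cnt (s.nat (b, 0, 0)) (fun k => φ₂.Holds (d + 1) (s.setN d 0 0 k)) =
      cnt (s.nat (b, 0, 0)) (fun k => φ₃.Holds (d + 1) (s.setN d 0 0 k)) *
        cnt (s.nat (b, 0, 0)) (fun k => φ₄.Holds (d + 1) (s.setN d 0 0 k)) := by
  simp only [Fm.cntEq, Fm.Holds]
  omega

/-- The entry of the input matrix at the row and column given by two registers. -/
abbrev entry (x k : ℕ) : RealExpr := .get 0 (reg x) (reg k)

/-- The columns in the registers `k` and `l` agree in all rows that satisfy the test `ρ`. -/
def sameF (ρ : ℕ → Test) (d k l : ℕ) : Fm :=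
  .all 10 (.imp (.test (ρ d)) (.test (.realEq (entry d k) (entry d l))))

/-- The column in register `k` is selected, with the parameters in the registers `t₀`, `t₁`. -/
def selF (ρ : ℕ → Test) (t₀ t₁ d k : ℕ) : Fm :=
  .cntLt 11 (.and (.test (.natLt (reg d) (reg k))) (sameF ρ (d + 1) d k))
    (.test (.not (.and (.not (.and (.realEq (entry 12 k) .zero)
        (.natLt (reg d) (.add (reg t₀) (.lit 1)))))
      (.not (.and (.not (.realEq (entry 12 k) .zero))
        (.natLt (reg d) (.add (reg t₁) (.lit 1))))))))
    (sameF ρ (d + 1) d k) (.test (.natEq (reg d) (reg k)))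

/-- The label of the row in register `x`. -/
abbrev label (x : ℕ) : NatExpr := .get 7 (reg 10) (reg x)

/-- The row in register `x` belongs to the first factor. -/
def leftT (x : ℕ) : Test :=
  .not (.and (.not (.natEq (reg x) (reg 12))) (.not (.natEq (label x) (label 13))))

/-- The row in register `x` belongs to the second factor. -/
def rightT (x : ℕ) : Test := .not (.natEq (label x) (label 13))

/-- The special row in register `12` and the class of the row in register `13` split the matrix. -/
def splitsF : Fm :=
  .and (.test (.and (.natLt (reg 12) (reg 10)) (.natLt (reg 13) (reg 10)))) <|
  .and (.all 11 (.test (.not (.and (.not (.realEq (entry 12 20) .zero))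
    (.not (.realEq (entry 12 20) .one)))))) <|
  .and (.ex 11 (.test (.realEq (entry 12 20) .zero))) <|
  .and (.ex 11 (.test (.realEq (entry 12 20) .one))) <|
  .and (.test (rightT 12)) <|
  .and (.ex 10 (.test (.and (.not (.natEq (reg 20) (reg 12))) (leftT 20)))) <|
  .and (.ex 10 (.test (.and (.not (.natEq (reg 20) (reg 12))) (rightT 20)))) <|
  .all 11 <| .all 11 <| .imp (.test (.realEq (entry 12 20) (entry 12 21))) <|
  .cntEq 11 (.and (selF leftT 14 15 23 22) (sameF leftT 23 22 20))
    (.and (selF rightT 16 17 23 22) (sameF rightT 23 22 21))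
    (.and (sameF leftT 23 22 20) (sameF rightT 23 22 21))
    (.test (.natEq (reg 22) (reg 20)))

/-- The row in register `x` belongs to the class, at stage `v` (in register `18`), of the row in
register `19`. -/
def classT (x : ℕ) : Test :=
  .and (.natLt (reg x) (reg 18)) (.natEq (.get 7 (reg 18) (reg x)) (.get 7 (reg 18) (reg 19)))

/-- The row in register `x` is a row outside of the class, up to the row `v`. -/
def restT (x : ℕ) : Test :=
  .and (.natLt (reg x) (.add (reg 18) (.lit 1))) (.not (classT x))

/-- The class of the row in register `19` is not merged at stage `v`. -/
def stepF : Fm :=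
  .and (.test (.not (.natEq (reg 19) (reg 18)))) <|
  .all 11 <| .all 11 <| .imp (.test (.realEq (entry 12 20) (entry 12 21))) <|
  .cntEq 11 (.and (.test (.realEq (entry 12 22) (entry 12 20))) (sameF classT 23 22 20))
    (.and (.test (.realEq (entry 12 22) (entry 12 20))) (sameF restT 23 22 21))
    (.and (.test (.realEq (entry 12 22) (entry 12 20)))
      (.and (sameF classT 23 22 20) (sameF restT 23 22 21)))
    (.test (.realEq (entry 12 22) (entry 12 20)))

theorem wf_splitsF : splitsF.WF 20 := by
  simp [splitsF, selF, sameF, leftT, rightT, Fm.WF, Fm.all, Fm.ex, Fm.imp, Fm.cntEq, Fm.false,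
    Test.WF, RealExpr.WF, NatExpr.WF]

theorem wf_stepF : stepF.WF 20 := by
  simp [stepF, sameF, classT, restT, Fm.WF, Fm.all, Fm.ex, Fm.imp, Fm.cntEq, Fm.false,
    Test.WF, RealExpr.WF, NatExpr.WF]

theorem wf_selF_left : (selF leftT 14 15 20 19).WF 20 := by
  simp [selF, sameF, leftT, Fm.WF, Fm.all, Fm.ex, Fm.imp, Fm.false,
    Test.WF, RealExpr.WF, NatExpr.WF]

theorem wf_selF_right : (selF rightT 16 17 20 19).WF 20 := by
  simp [selF, sameF, rightT, Fm.WF, Fm.all, Fm.ex, Fm.imp, Fm.false,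
    Test.WF, RealExpr.WF, NatExpr.WF]

/-! ### The meaning of the formulas in a memory state -/

theorem holds_sameF {ρ : ℕ → Test} {d k l m : ℕ} {s : State} {A : ℕ → ℕ → ℝ} {p : ℕ → Prop}
    (hk : k < d) (hl : l < d) (hm : s.nat (10, 0, 0) = m)
    (hA : ∀ i j, s.real (0, i, j) = A i j)
    (hρ : ∀ x < m, ((ρ d).Holds (s.setN d 0 0 x) ↔ p x)) :
    (sameF ρ d k l).Holds d s ↔ SameCol A m p (s.nat (k, 0, 0)) (s.nat (l, 0, 0)) := by
  rw [sameF, Fm.holds_all, hm]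
  refine forall₂_congr fun x hx => ?_
  rw [Fm.holds_imp, Fm.Holds, Fm.Holds, hρ x hx]
  simp [Test.Holds, RealExpr.eval, NatExpr.eval, hA, hk.ne, hl.ne]

theorem holds_selF {ρ : ℕ → Test} {t₀ t₁ d k m n r : ℕ} {s : State} {A : ℕ → ℕ → ℝ} {p : ℕ → Prop}
    (hd : 20 ≤ d) (hk : k < d) (ht₀ : t₀ < 20) (ht₁ : t₁ < 20) (hm : s.nat (10, 0, 0) = m)
    (hn : s.nat (11, 0, 0) = n) (hr : s.nat (12, 0, 0) = r)
    (hA : ∀ i j, s.real (0, i, j) = A i j)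
    (hρ : ∀ l, ∀ x < m, ((ρ (d + 1)).Holds ((s.setN d 0 0 l).setN (d + 1) 0 0 x) ↔ p x)) :
    (selF ρ t₀ t₁ d k).Holds d s ↔
      Sel A m n r p (s.nat (t₀, 0, 0)) (s.nat (t₁, 0, 0)) (s.nat (k, 0, 0)) := by
  have h10 : (10 : ℕ) ≠ d := by omega
  have h12 : (12 : ℕ) ≠ d := by omega
  have h0 : t₀ ≠ d := by omega
  have h1 : t₁ ≠ d := by omega
  have hs : ∀ l, (sameF ρ (d + 1) d k).Holds (d + 1) (s.setN d 0 0 l) ↔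
      SameCol A m p l (s.nat (k, 0, 0)) := fun l => by
    rw [holds_sameF (A := A) (p := p) (m := m) (by omega) (by omega) (by simp [h10, hm])
      (by simpa using hA) (hρ l)]
    simp [hk.ne]
  rw [selF, Fm.Holds, hn, Sel]
  simp only [Fm.Holds, hs]
  simp [Test.Holds, RealExpr.eval, NatExpr.eval, hk.ne, h12, h0, h1, hr, hA]
  -- Disjunction is encoded by negation and conjunction in the tests; simplification leaves it as an
  -- implication.
  have e : ∀ l, ((A r (s.nat (k, 0, 0)) = 0 → s.nat (t₀, 0, 0) < l) →
      ¬ A r (s.nat (k, 0, 0)) = 0 ∧ l ≤ s.nat (t₁, 0, 0)) ↔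
      (A r (s.nat (k, 0, 0)) = 0 ∧ l ≤ s.nat (t₀, 0, 0) ∨
        ¬ A r (s.nat (k, 0, 0)) = 0 ∧ l ≤ s.nat (t₁, 0, 0)) := fun l => by
    by_cases h : A r (s.nat (k, 0, 0)) = 0 <;> simp [h]
  simp only [e]

/-- The state contains the matrix `A`, the row numbers `r` and `w` and the labels of the rows. -/
structure View (m n r w : ℕ) (A : ℕ → ℕ → ℝ) (lab : ℕ → ℕ) (s : State) : Prop where
  rows : s.nat (10, 0, 0) = m
  cols : s.nat (11, 0, 0) = n
  special : s.nat (12, 0, 0) = r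
  row : s.nat (13, 0, 0) = w
  entries : ∀ i j, s.real (0, i, j) = A i j
  labels : ∀ x < m, s.nat (7, m, x) = lab x

theorem View.setN {m n r w d k : ℕ} {A : ℕ → ℕ → ℝ} {lab : ℕ → ℕ} {s : State}
    (h : View m n r w A lab s) (hd : 18 ≤ d) : View m n r w A lab (s.setN d 0 0 k) := by
  have h7 : (7 : ℕ) ≠ d := by omega
  have h10 : (10 : ℕ) ≠ d := by omega
  have h11 : (11 : ℕ) ≠ d := by omega
  have h12 : (12 : ℕ) ≠ d := by omega
  have h13 : (13 : ℕ) ≠ d := by omega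
  exact ⟨by simp [h10, h.rows], by simp [h11, h.cols], by simp [h12, h.special],
    by simp [h13, h.row], h.entries, fun x hx => by simp [h7, h.labels x hx]⟩

theorem View.holds_leftT {m n r w a : ℕ} {A : ℕ → ℕ → ℝ} {lab : ℕ → ℕ} {s : State}
    (h : View m n r w A lab s) (hw : w < m) (ha : s.nat (a, 0, 0) < m) :
    (leftT a).Holds s ↔ LeftRow lab r w (s.nat (a, 0, 0)) := by
  simp only [leftT, Test.Holds, NatExpr.eval, h.rows, h.row, h.special, LeftRow,
    h.labels _ ha, h.labels _ hw]
  tauto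

theorem View.holds_rightT {m n r w a : ℕ} {A : ℕ → ℕ → ℝ} {lab : ℕ → ℕ} {s : State}
    (h : View m n r w A lab s) (hw : w < m) (ha : s.nat (a, 0, 0) < m) :
    (rightT a).Holds s ↔ RightRow lab w (s.nat (a, 0, 0)) := by
  simp only [rightT, Test.Holds, NatExpr.eval, h.rows, h.row, RightRow,
    h.labels _ ha, h.labels _ hw]

theorem View.holds_sameF {m n r w d k l : ℕ} {A : ℕ → ℕ → ℝ} {lab : ℕ → ℕ} {s : State}
    (h : View m n r w A lab s) (hw : w < m) (hd : 20 ≤ d) (hk : k < d) (hl : l < d) :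
    ((sameF leftT d k l).Holds d s ↔
      SameCol A m (LeftRow lab r w) (s.nat (k, 0, 0)) (s.nat (l, 0, 0))) ∧
    ((sameF rightT d k l).Holds d s ↔
      SameCol A m (RightRow lab w) (s.nat (k, 0, 0)) (s.nat (l, 0, 0))) := by
  constructor
  · refine RealRAM.holds_sameF hk hl h.rows h.entries fun x hx => ?_
    rw [(h.setN (by omega)).holds_leftT hw (by simpa using hx)]
    simp
  · refine RealRAM.holds_sameF hk hl h.rows h.entries fun x hx => ?_
    rw [(h.setN (by omega)).holds_rightT hw (by simpa using hx)]
    simp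

theorem View.holds_selF {m n r w d k t₀ t₁ : ℕ} {A : ℕ → ℕ → ℝ} {lab : ℕ → ℕ} {s : State}
    (h : View m n r w A lab s) (hw : w < m) (hd : 20 ≤ d) (hk : k < d) (ht₀ : t₀ < 20)
    (ht₁ : t₁ < 20) :
    ((selF leftT t₀ t₁ d k).Holds d s ↔ Sel A m n r (LeftRow lab r w)
      (s.nat (t₀, 0, 0)) (s.nat (t₁, 0, 0)) (s.nat (k, 0, 0))) ∧
    ((selF rightT t₀ t₁ d k).Holds d s ↔ Sel A m n r (RightRow lab w)
      (s.nat (t₀, 0, 0)) (s.nat (t₁, 0, 0)) (s.nat (k, 0, 0))) := by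
  constructor
  · refine RealRAM.holds_selF hd hk ht₀ ht₁ h.rows h.cols h.special h.entries fun l x hx => ?_
    rw [((h.setN (by omega)).setN (by omega)).holds_leftT hw (by simpa using hx)]
    simp
  · refine RealRAM.holds_selF hd hk ht₀ ht₁ h.rows h.cols h.special h.entries fun l x hx => ?_
    rw [((h.setN (by omega)).setN (by omega)).holds_rightT hw (by simpa using hx)]
    simp

/-- Not all fields of `Splits` are tested: that `r` lies on the left, that the two sides cover all
rows and that they meet only in `r` follow from the shape of `LeftRow` and `RightRow`. -/
theorem View.holds_splitsF {m n r w : ℕ} {A : ℕ → ℕ → ℝ} {lab : ℕ → ℕ} {s : State}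
    (h : View m n r w A lab s) :
    splitsF.Holds 20 s ↔ (r < m ∧ w < m) ∧ Splits A m n r (LeftRow lab r w) (RightRow lab w)
      (Sel A m n r (LeftRow lab r w) (s.nat (14, 0, 0)) (s.nat (15, 0, 0)))
      (Sel A m n r (RightRow lab w) (s.nat (16, 0, 0)) (s.nat (17, 0, 0))) := by
  rw [splitsF, Fm.Holds]
  -- The stored labels are meaningful only for rows below `m`; outside of this range the first test
  -- already fails.
  by_cases hrw : r < m ∧ w < m
  swap
  · refine iff_of_false (fun h' => hrw ?_) fun h' => hrw h'.1
    simpa [Fm.Holds, Test.Holds, NatExpr.eval, h.rows, h.special, h.row] using h'.1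
  obtain ⟨hr, hw⟩ := hrw
  have p0 : (Fm.test (.and (.natLt (reg 12) (reg 10)) (.natLt (reg 13) (reg 10)))).Holds 20 s ↔
      r < m ∧ w < m := by
    simp [Fm.Holds, Test.Holds, NatExpr.eval, h.rows, h.special, h.row]
  have p1 : (Fm.all 11 (.test (.not (.and (.not (.realEq (entry 12 20) .zero))
      (.not (.realEq (entry 12 20) .one)))))).Holds 20 s ↔ ∀ j < n, A r j = 0 ∨ A r j = 1 := by
    rw [Fm.holds_all, h.cols]
    refine forall₂_congr fun j hj => ?_
    simp [Fm.Holds, Test.Holds, NatExpr.eval, RealExpr.eval, h.special, h.entries]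
    tauto
  have p2 : (Fm.ex 11 (.test (.realEq (entry 12 20) .zero))).Holds 20 s ↔
      ∃ j < n, A r j = 0 := by
    simp [Fm.Holds, Test.Holds, NatExpr.eval, RealExpr.eval, h.special, h.entries, h.cols]
  have p3 : (Fm.ex 11 (.test (.realEq (entry 12 20) .one))).Holds 20 s ↔
      ∃ j < n, A r j = 1 := by
    simp [Fm.Holds, Test.Holds, NatExpr.eval, RealExpr.eval, h.special, h.entries, h.cols]
  have p4 : (Fm.test (rightT 12)).Holds 20 s ↔ RightRow lab w r := by
    rw [Fm.Holds, h.holds_rightT hw (by rwa [h.special]), h.special]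
  have p5 : (Fm.ex 10 (.test (.and (.not (.natEq (reg 20) (reg 12))) (leftT 20)))).Holds 20 s ↔
      ∃ x < m, x ≠ r ∧ LeftRow lab r w x := by
    rw [Fm.holds_ex, h.rows]
    refine exists_congr fun x => and_congr_right fun hx => ?_
    rw [Fm.Holds, Test.Holds, (h.setN (by omega)).holds_leftT hw (by simpa using hx)]
    simp [Test.Holds, NatExpr.eval, h.special]
  have p6 : (Fm.ex 10 (.test (.and (.not (.natEq (reg 20) (reg 12))) (rightT 20)))).Holds 20 s ↔
      ∃ x < m, x ≠ r ∧ RightRow lab w x := by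
    rw [Fm.holds_ex, h.rows]
    refine exists_congr fun x => and_congr_right fun hx => ?_
    rw [Fm.Holds, Test.Holds, (h.setN (by omega)).holds_rightT hw (by simpa using hx)]
    simp [Test.Holds, NatExpr.eval, h.special]
  rw [p0, Fm.Holds, p1, Fm.Holds, p2, Fm.Holds, p3, Fm.Holds, p4, Fm.Holds, p5, Fm.Holds, p6,
    Fm.holds_all, h.cols]
  have p7 : ∀ i < n, ((Fm.all 11 <| .imp (.test (.realEq (entry 12 20) (entry 12 21))) <|
      .cntEq 11 (.and (selF leftT 14 15 23 22) (sameF leftT 23 22 20))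
        (.and (selF rightT 16 17 23 22) (sameF rightT 23 22 21))
        (.and (sameF leftT 23 22 20) (sameF rightT 23 22 21))
        (.test (.natEq (reg 22) (reg 20)))).Holds (20 + 1) (s.setN 20 0 0 i) ↔
      ∀ j < n, A r i = A r j →
        cnt n (fun k => Sel A m n r (LeftRow lab r w) (s.nat (14, 0, 0)) (s.nat (15, 0, 0)) k ∧
          SameCol A m (LeftRow lab r w) k i) *
        cnt n (fun k => Sel A m n r (RightRow lab w) (s.nat (16, 0, 0)) (s.nat (17, 0, 0)) k ∧
          SameCol A m (RightRow lab w) k j) =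
        cnt n fun k => SameCol A m (LeftRow lab r w) k i ∧ SameCol A m (RightRow lab w) k j) := by
    intro i hi
    rw [Fm.holds_all, (h.setN (by omega)).cols]
    refine forall₂_congr fun j hj => ?_
    rw [Fm.holds_imp, Fm.holds_cntEq, ((h.setN (by omega)).setN (by omega)).cols]
    have hv : ∀ k, View m n r w A lab (((s.setN 20 0 0 i).setN (20 + 1) 0 0 j).setN 22 0 0 k) :=
      fun k => ((h.setN (by omega)).setN (by omega)).setN (by omega)
    refine imp_congr ?_ ?_
    · simp [Fm.Holds, Test.Holds, NatExpr.eval, RealExpr.eval, h.special, h.entries]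
    · simp only [Fm.Holds, ((hv _).holds_sameF hw (d := 23) (by omega) (k := 22) (l := 20) (by omega)
        (by omega)).1, ((hv _).holds_sameF hw (d := 23) (by omega) (k := 22) (l := 21) (by omega)
        (by omega)).2, ((hv _).holds_selF hw (d := 23) (t₀ := 14) (t₁ := 15) (by omega) (k := 22)
        (by omega) (by omega) (by omega)).1, ((hv _).holds_selF hw (d := 23) (t₀ := 16) (t₁ := 17)
        (by omega) (k := 22) (by omega) (by omega) (by omega)).2]
      simp [Test.Holds, NatExpr.eval, cnt_eq_self hi]
  rw [forall₂_congr p7]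
  constructor
  · rintro ⟨h0, h1, h2, h3, h4, h5, h6, h7⟩
    refine ⟨h0, h1, h2, h3, Or.inl rfl, h4, fun x _ => ?_, ?_, h5, h6, h7⟩
    · by_cases hx : lab x = lab w
      · exact Or.inl (Or.inr hx)
      · exact Or.inr hx
    · rintro x _ (hx | hx) hx'
      · exact hx
      · exact absurd hx hx'
  · rintro ⟨h0, h1, h2, h3, -, h4, -, -, h5, h6, h7⟩
    exact ⟨h0, h1, h2, h3, h4, h5, h6, h7⟩

theorem holds_stepF {m n r v u : ℕ} {A : ℕ → ℕ → ℝ} {f : ℕ → ℕ} {s : State} (hv : v < m)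
    (hu : u < m) (h10 : s.nat (10, 0, 0) = m) (h11 : s.nat (11, 0, 0) = n)
    (h12 : s.nat (12, 0, 0) = r) (h18 : s.nat (18, 0, 0) = v) (h19 : s.nat (19, 0, 0) = u)
    (hA : ∀ i j, s.real (0, i, j) = A i j) (hf : ∀ x < m, s.nat (7, v, x) = f x) :
    stepF.Holds 20 s ↔ u ≠ v ∧ CondInd A n r {x | x < v ∧ f x = f u}
      {x | x < v + 1 ∧ ¬ (x < v ∧ f x = f u)} := by
  have hd : Disjoint {x | x < v ∧ f x = f u} {x | x < v + 1 ∧ ¬ (x < v ∧ f x = f u)} :=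
    Set.disjoint_left.2 fun x hx hx' => hx'.2 hx
  rw [stepF, Fm.Holds]
  refine and_congr (by simp [Fm.Holds, Test.Holds, NatExpr.eval, h18, h19]) ?_
  rw [condInd_iff_cnt hd, Fm.holds_all, h11]
  refine forall₂_congr fun i hi => ?_
  rw [Fm.holds_all, State.setN_nat, if_neg (by simp), h11]
  refine forall₂_congr fun j hj => ?_
  rw [Fm.holds_imp, Fm.holds_cntEq, State.setN_nat, if_neg (by simp), State.setN_nat,
    if_neg (by simp), h11]
  refine imp_congr ?_ ?_
  · simp [Fm.Holds, Test.Holds, NatExpr.eval, RealExpr.eval, h12, hA]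
  · have e1 : ∀ k, (sameF classT 23 22 20).Holds 23
        (((s.setN 20 0 0 i).setN 21 0 0 j).setN 22 0 0 k) ↔
        ∀ x ∈ {x | x < v ∧ f x = f u}, A x k = A x i := by
      intro k
      rw [holds_sameF (p := fun x => x < v ∧ f x = f u) (A := A) (m := m) (by omega) (by omega)
        (by simp [h10]) (by simp [hA])]
      · simp only [SameCol, State.setN_nat]
        simp
        exact ⟨fun h x hx => h x (by omega) hx, fun h x _ hx => h x hx⟩
      · intro x hx
        simp [classT, Test.Holds, NatExpr.eval, h18, h19, hf x hx, hf u hu]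
    have e2 : ∀ k, (sameF restT 23 22 21).Holds 23
        (((s.setN 20 0 0 i).setN 21 0 0 j).setN 22 0 0 k) ↔
        ∀ x ∈ {x | x < v + 1 ∧ ¬ (x < v ∧ f x = f u)}, A x k = A x j := by
      intro k
      rw [holds_sameF (p := fun x => x < v + 1 ∧ ¬ (x < v ∧ f x = f u)) (A := A) (m := m) (by omega)
        (by omega) (by simp [h10]) (by simp [hA])]
      · simp only [SameCol, State.setN_nat]
        exact ⟨fun h x hx => h x (lt_of_lt_of_le hx.1 hv) hx, fun h x _ hx => h x hx⟩
      · intro x hx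
        simp [restT, classT, Test.Holds, NatExpr.eval, h18, h19, hf x hx, hf u hu]
    simp only [Fm.Holds, e1, e2]
    simp [Test.Holds, NatExpr.eval, RealExpr.eval, h12, hA]

end RealRAM

/-! ### The algorithm -/

namespace RealRAM

/-- The natural arrays in `N` and the real arrays in `R` have not changed. -/
def Keep (N R : Set ℕ) (s s' : State) : Prop :=
  (∀ c : ℕ × ℕ × ℕ, c.1 ∈ N → s'.nat c = s.nat c) ∧
    ∀ c : ℕ × ℕ × ℕ, c.1 ∈ R → s'.real c = s.real c

theorem Keep.refl (N R : Set ℕ) (s : State) : Keep N R s s := ⟨fun _ _ => rfl, fun _ _ => rfl⟩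

theorem Keep.trans {N R : Set ℕ} {s s' s'' : State} (h : Keep N R s s') (h' : Keep N R s' s'') :
    Keep N R s s'' :=
  ⟨fun c hc => (h'.1 c hc).trans (h.1 c hc), fun c hc => (h'.2 c hc).trans (h.2 c hc)⟩

theorem Keep.mono {N R N' R' : Set ℕ} {s s' : State} (h : Keep N R s s') (hN : N' ⊆ N)
    (hR : R' ⊆ R) : Keep N' R' s s' :=
  ⟨fun c hc => h.1 c (hN hc), fun c hc => h.2 c (hR hc)⟩

theorem Keep.setN {N R : Set ℕ} {s s' : State} (h : Keep N R s s') {a i j x : ℕ} (ha : a ∉ N) :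
    Keep N R s (s'.setN a i j x) := by
  refine ⟨fun c hc => ?_, h.2⟩
  rw [State.setN_nat, if_neg, h.1 c hc]
  rintro rfl
  exact ha hc

theorem Keep.setR {N R : Set ℕ} {s s' : State} (h : Keep N R s s') {a i j : ℕ} {x : ℝ}
    (ha : a ∉ R) : Keep N R s (s'.setR a i j x) := by
  refine ⟨h.1, fun c hc => ?_⟩
  rw [State.setR_real, if_neg, h.2 c hc]
  rintro rfl
  exact ha hc

theorem Agree.keep {d e : ℕ} {N R : Set ℕ} {s s' : State} (h : Agree d e s s')
    (hN : ∀ a ∈ N, a < d) (hR : ∀ a ∈ R, a < e) : Keep N R s s' :=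
  ⟨fun c hc => h.1 c (Or.inl (hN _ hc)), fun c hc => h.2 c (hR _ hc)⟩

theorem Keep.nat_eq {N R : Set ℕ} {s s' : State} (h : Keep N R s s') {a i j : ℕ} (ha : a ∈ N) :
    s'.nat (a, i, j) = s.nat (a, i, j) := h.1 _ ha

theorem Keep.real_eq {N R : Set ℕ} {s s' : State} (h : Keep N R s s') {a i j : ℕ} (ha : a ∈ R) :
    s'.real (a, i, j) = s.real (a, i, j) := h.2 _ ha

theorem Runs.forLE {a b N T B : ℕ} {P : Program} {s : State} (hab : b ≠ a)
    (hN : s.nat (b, 0, 0) = N) (hB : N ≤ B) (I : ℕ → State → Prop) (h0 : I 0 (s.setN a 0 0 0))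
    (hstep : ∀ k < N, ∀ s', I k s' → s'.nat (a, 0, 0) = k → s'.nat (b, 0, 0) = N →
      Runs P s' (fun s'' => s''.nat (a, 0, 0) = k ∧ s''.nat (b, 0, 0) = N ∧
        I (k + 1) (s''.setN a 0 0 (k + 1))) T) :
    Runs (forProg a b P) s (I N) (B * (T + 15) + 11) :=
  (Runs.for hab hN I h0 hstep).mono (fun _ h => h)
    (Nat.add_le_add_right (Nat.mul_le_mul_right _ hB) _)

/-- Evaluate a formula and branch. -/
def ifProg (φ : Fm) (P Q : Program) : Program :=
  .seq (φ.compile 20) (.cond (.realEq (rcell 20 0) .one) P Q)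

theorem Runs.ifProg {φ : Fm} {P P' : Program} {B T T' : ℕ} {s : State} {Q : State → Prop}
    (hφ : φ.WF 20) (hm : s.nat (10, 0, 0) ≤ B) (hn : s.nat (11, 0, 0) ≤ B)
    (h : ∀ s', Agree 20 20 s s' → φ.Holds 20 s → Runs P s' Q T)
    (h' : ∀ s', Agree 20 20 s s' → ¬ φ.Holds 20 s → Runs P' s' Q T') :
    Runs (ifProg φ P P') s Q (φ.time B + T + T' + 20) := by
  refine (Runs.seq (φ.runs_compile le_rfl hφ hm hn) fun s' h1 =>
    Runs.cond (fun hb => h s' h1.1 ?_) fun hb => h' s' h1.1 ?_).mono (fun _ h => h) ?_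
  · by_contra hf
    simp [Test.Holds, RealExpr.eval, NatExpr.eval, h1.2, hf] at hb
  · intro hf
    simp [Test.Holds, RealExpr.eval, NatExpr.eval, h1.2, hf] at hb
  · simp only [Test.cost, RealExpr.cost, NatExpr.cost]; omega

/-- Compute the labels of the rows for the row in register `12`. -/
def tableProg : Program :=
  .seq (forProg 19 10 (.setNat 7 (.lit 0) (reg 19) (.lit 0))) <|
  forProg 18 10 <| forProg 19 10 <| ifProg stepF
    (.setNat 7 (.add (reg 18) (.lit 1)) (reg 19) (.get 7 (reg 18) (reg 19)))
    (.setNat 7 (.add (reg 18) (.lit 1)) (reg 19) (reg 18))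

/-- A bound for the running time of `tableProg`. -/
def tableTime (B : ℕ) : ℕ :=
  B * (30 + 15) + 11 + (B * (B * (stepF.time B + 30 + 30 + 20 + 15) + 11 + 15) + 11)

/-- Row `v` of array `7` holds the labels of stage `v`. Stage `v + 1` reads only row `v` and writes
only row `v + 1`, so the labels it depends on stay available. -/
theorem runs_tableProg {m n r B : ℕ} {A : ℕ → ℕ → ℝ} {s : State} (h10 : s.nat (10, 0, 0) = m)
    (h11 : s.nat (11, 0, 0) = n) (h12 : s.nat (12, 0, 0) = r)
    (hA : ∀ i j, s.real (0, i, j) = A i j) (hm : m ≤ B) (hn : n ≤ B) :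
    Runs tableProg s (fun s' => Keep {a | a < 18 ∧ a ≠ 7} {a | a < 20} s s' ∧
      ∀ v ≤ m, ∀ u < m, s'.nat (7, v, u) = labels A n r v u) (tableTime B) := by
  refine Runs.seq (Q := fun s' => Keep {a | a < 18 ∧ a ≠ 7} {a | a < 20} s s' ∧
    ∀ u < m, s'.nat (7, 0, u) = 0) ?_ ?_
  · refine Runs.forLE (by omega) h10 hm (fun k s' => Keep {a | a < 18 ∧ a ≠ 7} {a | a < 20} s s' ∧
      ∀ u < k, s'.nat (7, 0, u) = 0) ⟨(Keep.refl _ _ _).setN (by simp), by simp⟩ ?_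
    rintro k hk s' ⟨h1, h2⟩ h3 h4
    refine (Runs.setNat ?_).mono (fun _ h => h) (by simp [NatExpr.cost])
    simp only [NatExpr.eval]
    refine ⟨by simp [h3], by simp [h4], (h1.setN (by simp)).setN (by simp), fun u hu => ?_⟩
    rcases Nat.lt_succ_iff_lt_or_eq.1 hu with hu | rfl
    · simp [h2 u hu]
    · simp [h3]
  · rintro s₁ ⟨k1, z1⟩
    refine Runs.forLE (by omega) ((k1.nat_eq (by simp)).trans h10) hm (fun v s' =>
      Keep {a | a < 18 ∧ a ≠ 7} {a | a < 20} s s' ∧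
      ∀ v' ≤ v, ∀ u < m, s'.nat (7, v', u) = labels A n r v' u) ⟨k1.setN (by simp), ?_⟩ ?_
    · intro v' hv' u hu
      obtain rfl : v' = 0 := by omega
      simp [z1 u hu, labels]
    · rintro v hv s₂ ⟨k2, z2⟩ h18 h10'
      refine (Runs.forLE (by omega) h10' hm (fun u s' =>
        Keep {a | a < 18 ∧ a ≠ 7} {a | a < 20} s s' ∧ s'.nat (18, 0, 0) = v ∧
        (∀ v' ≤ v, ∀ u < m, s'.nat (7, v', u) = labels A n r v' u) ∧
        ∀ u' < u, s'.nat (7, v + 1, u') = labels A n r (v + 1) u')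
        ⟨k2.setN (by simp), by simp [h18], fun v' hv' u hu => by simp [z2 v' hv' u hu], by simp⟩
        ?_).mono ?_ le_rfl
      · rintro u hu s₃ ⟨k3, h18, z3, y3⟩ h19 h10''
        have hst := holds_stepF (s := s₃) hv hu h10'' ((k3.nat_eq (by simp)).trans h11)
          ((k3.nat_eq (by simp)).trans h12) h18 h19
          (fun i j => (k3.real_eq (by simp)).trans (hA i j)) (z3 v le_rfl)
        have finish : ∀ s₄, Agree 20 20 s₃ s₄ → ∀ x, x = labels A n r (v + 1) u →
            (s₄.setN 7 (v + 1) u x).nat (19, 0, 0) = u ∧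
            (s₄.setN 7 (v + 1) u x).nat (10, 0, 0) = m ∧
            Keep {a | a < 18 ∧ a ≠ 7} {a | a < 20} s
              ((s₄.setN 7 (v + 1) u x).setN 19 0 0 (u + 1)) ∧
            ((s₄.setN 7 (v + 1) u x).setN 19 0 0 (u + 1)).nat (18, 0, 0) = v ∧
            (∀ v' ≤ v, ∀ u' < m, ((s₄.setN 7 (v + 1) u x).setN 19 0 0 (u + 1)).nat (7, v', u') =
              labels A n r v' u') ∧
            ∀ u' < u + 1, ((s₄.setN 7 (v + 1) u x).setN 19 0 0 (u + 1)).nat (7, v + 1, u') =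
              labels A n r (v + 1) u' := by
          rintro s₄ ha x rfl
          have k4 : Keep {a | a < 18 ∧ a ≠ 7} {a | a < 20} s s₄ :=
            k3.trans (ha.keep (fun a ha => by simp at ha; omega) (fun a ha => by simpa using ha))
          refine ⟨by simp [ha.nat_reg, h19], by simp [ha.nat_reg, h10''],
            (k4.setN (by simp)).setN (by simp), by simp [ha.nat_reg, h18], fun v' hv' u' hu' => ?_,
            fun u' hu' => ?_⟩
          · have : v' ≠ v + 1 := by omega
            simp [this, ha.nat_reg, z3 v' hv' u' hu']
          · rcases Nat.lt_succ_iff_lt_or_eq.1 hu' with hu' | rfl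
            · simp [hu'.ne, ha.nat_reg, y3 u' hu']
            · simp
        refine Runs.ifProg (B := B) (T := 30) (T' := 30) wf_stepF (by rwa [h10''])
          (by rwa [k3.nat_eq (by simp), h11]) (fun s₄ ha hf => ?_) (fun s₄ ha hf => ?_)
        · refine (Runs.setNat ?_).mono (fun _ h => h) (by simp [NatExpr.cost])
          have e : NatExpr.eval s₄ (.get 7 (reg 18) (reg 19)) = labels A n r (v + 1) u := by
            simp only [NatExpr.eval]
            rw [ha.nat_reg (by omega), ha.nat_reg (by omega), ha.nat_reg (by omega), h18, h19,
              z3 v le_rfl u hu]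
            rw [hst] at hf
            exact (labels_succ_of_condInd hf.1 hf.2).symm
          have := finish s₄ ha _ e
          simpa only [NatExpr.eval, ha.nat_reg (a := 18) (by omega),
            ha.nat_reg (a := 19) (by omega), h18, h19] using this
        · refine (Runs.setNat ?_).mono (fun _ h => h) (by simp [NatExpr.cost])
          have e : NatExpr.eval s₄ (reg 18) = labels A n r (v + 1) u := by
            simp only [NatExpr.eval]
            rw [ha.nat_reg (by omega), h18]
            by_contra hne
            have := labels_succ_of_ne (Ne.symm hne)
            exact hf (hst.2 ⟨this.1, this.2.1⟩)
          have := finish s₄ ha _ e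
          simpa only [NatExpr.eval, ha.nat_reg (a := 18) (by omega),
            ha.nat_reg (a := 19) (by omega), h18, h19] using this
      · rintro s₅ ⟨k5, h18, z5, y5⟩
        refine ⟨h18, (k5.nat_eq (by simp)).trans h10, k5.setN (by simp), fun v' hv' u hu => ?_⟩
        rcases Nat.le_succ_iff_eq_or_le.1 hv' with rfl | hv'
        · simp [y5 u hu]
        · simp [z5 v' hv' u hu]

/-! ### Writing the factors -/

/-- Copy the submatrix on the rows with `ρ` and the columns with `σ` to the real array `a`; put the
numbers of rows and columns and the index of the row in register `12` into the registers `i`, `j`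
and `x`. -/
def extractProg (ρ : ℕ → Test) (σ : Fm) (a i j x : ℕ) : Program :=
  .seq (setReg i (.lit 0)) <| forProg 18 10 <| .cond (ρ 18)
    (.seq (.cond (.natEq (reg 18) (reg 12)) (setReg x (reg i)) .skip) <|
      .seq (setReg j (.lit 0)) <|
      .seq (forProg 19 11 <| ifProg σ
        (.seq (.setReal a (reg i) (reg j) (entry 18 19)) (setReg j (.add (reg j) (.lit 1)))) .skip) <|
      setReg i (.add (reg i) (.lit 1)))
    .skip

/-- A bound for the running time of `extractProg`. -/
def extractTime (ρ : ℕ → Test) (σ : Fm) (B : ℕ) : ℕ :=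
  B * (B * (σ.time B + 60 + 15) + 100 + (ρ 18).cost + 15) + 50

set_option maxHeartbeats 1000000 in
-- The registers `i` and `j` hold the ranks of the current row and column. As `j` is reset at each
-- selected row, it is the number of selected columns only if some row was selected, which row `r`
-- guarantees; `x` records the rank of `r`. The tests have to keep their meaning while output
-- registers, loop counters and scratch cells change, hence the quantification over `s'`.
theorem runs_extractProg {ρ : ℕ → Test} {σ : Fm} {a i j x m n r B : ℕ} {p q : ℕ → Prop}
    {A : ℕ → ℕ → ℝ} {s : State} (hi : i < 7) (hj : j < 7) (hx : x < 7) (hij : i ≠ j)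
    (hix : i ≠ x) (hjx : j ≠ x) (ha0 : a ≠ 0) (ha : a < 20) (hwf : σ.WF 20)
    (h10 : s.nat (10, 0, 0) = m) (h11 : s.nat (11, 0, 0) = n) (h12 : s.nat (12, 0, 0) = r)
    (hA : ∀ i j, s.real (0, i, j) = A i j) (hm : m ≤ B) (hn : n ≤ B)
    (hρ : ∀ s', Keep {b | 7 ≤ b ∧ b < 18} {0} s s' → s'.nat (18, 0, 0) < m →
      ((ρ 18).Holds s' ↔ p (s'.nat (18, 0, 0))))
    (hσ : ∀ s', Keep {b | 7 ≤ b ∧ b < 18} {0} s s' → s'.nat (19, 0, 0) < n →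
      (σ.Holds 20 s' ↔ q (s'.nat (19, 0, 0)))) :
    Runs (extractProg ρ σ a i j x) s (fun s' =>
      Keep {b | b < 18 ∧ b ≠ i ∧ b ≠ j ∧ b ≠ x} {b | b < 20 ∧ b ≠ a} s s' ∧
      s'.nat (i, 0, 0) = cnt m p ∧
      (r < m → p r → s'.nat (j, 0, 0) = cnt n q ∧ s'.nat (x, 0, 0) = cnt r p) ∧
      ∀ k < m, ∀ l < n, p k → q l → s'.real (a, cnt k p, cnt l q) = A k l)
      (extractTime ρ σ B) := by
  set N : Set ℕ := {b | b < 18 ∧ b ≠ i ∧ b ≠ j ∧ b ≠ x} with hN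
  set R : Set ℕ := {b | b < 20 ∧ b ≠ a} with hR
  have hiN : i ∉ N := fun h => h.2.1 rfl
  have hjN : j ∉ N := fun h => h.2.2.1 rfl
  have hxN : x ∉ N := fun h => h.2.2.2 rfl
  have h18N : 18 ∉ N := fun h => absurd h.1 (by omega)
  have h19N : 19 ∉ N := fun h => absurd h.1 (by omega)
  have haR : a ∉ R := fun h => h.2 rfl
  have hNN : {b | 7 ≤ b ∧ b < 18} ⊆ N := fun b hb => by
    have := hb.1
    have := hb.2
    exact ⟨by omega, by omega, by omega, by omega⟩
  have hRR : {0} ⊆ R := by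
    rintro _ rfl
    exact ⟨by omega, ha0.symm⟩
  have h10N : 10 ∈ N := hNN ⟨by omega, by omega⟩
  have h11N : 11 ∈ N := hNN ⟨by omega, by omega⟩
  have h12N : 12 ∈ N := hNN ⟨by omega, by omega⟩
  have i18 : i ≠ 18 := by omega
  have i19 : i ≠ 19 := by omega
  have j18 : j ≠ 18 := by omega
  have j19 : j ≠ 19 := by omega
  have x18 : x ≠ 18 := by omega
  have x19 : x ≠ 19 := by omega
  have i10 : i ≠ 10 := by omega
  have i11 : i ≠ 11 := by omega
  have j10 : j ≠ 10 := by omega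
  have j11 : j ≠ 11 := by omega
  refine (Runs.seq (Runs.setNat (Q := fun s' => s' = s.setN i 0 0 0) rfl) fun s₁ hs₁ =>
    (Runs.forLE (b := 10) (by omega) (hs₁ ▸ ((Keep.refl N R s).setN hiN).nat_eq h10N |>.trans h10) hm
      (fun k s' => Keep N R s s' ∧ s'.nat (i, 0, 0) = cnt k p ∧
        (r < k → p r → s'.nat (j, 0, 0) = cnt n q ∧ s'.nat (x, 0, 0) = cnt r p) ∧
        ∀ k' < k, ∀ l < n, p k' → q l → s'.real (a, cnt k' p, cnt l q) = A k' l)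
      (T := B * (σ.time B + 60 + 15) + 100 + (ρ 18).cost) ?_ ?_)).mono (fun _ h => h) ?_
  · subst hs₁
    refine ⟨((Keep.refl _ _ _).setN hiN).setN h18N, by simp [i18], by simp, by simp⟩
  · rintro k hk s₂ ⟨k2, c2, f2, g2⟩ h18 h10'
    have h11' : s₂.nat (11, 0, 0) = n := (k2.nat_eq h11N).trans h11
    have h12' : s₂.nat (12, 0, 0) = r := (k2.nat_eq h12N).trans h12
    have hp := hρ s₂ (k2.mono hNN hRR) (by rwa [h18])
    rw [h18] at hp
    refine (Runs.cond (T := B * (σ.time B + 60 + 15) + 90) (T' := 1) (fun hb => ?_)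
      (fun hb => Runs.skip ?_)).mono (fun _ h => h) (by omega)
    · rw [hp] at hb
      refine (Runs.seq (T := 20) (T' := B * (σ.time B + 60 + 15) + 70)
        (Q := fun s' => Keep N R s s' ∧ s'.nat (18, 0, 0) = k ∧ s'.nat (10, 0, 0) = m ∧
          s'.nat (i, 0, 0) = cnt k p ∧ (r ≤ k → p r → s'.nat (x, 0, 0) = cnt r p) ∧
          ∀ k' < k, ∀ l < n, p k' → q l → s'.real (a, cnt k' p, cnt l q) = A k' l) ?_ ?_).mono
          (fun _ h => h) (by omega)
      · refine (Runs.cond (fun ht => Runs.setNat ?_) (fun ht => Runs.skip ?_)).mono (fun _ h => h)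
          (by simp [Test.cost, NatExpr.cost])
        · simp only [Test.Holds, NatExpr.eval, h18, h12'] at ht
          simp only [NatExpr.eval]
          exact ⟨k2.setN hxN, by simp [x18.symm, h18], by simp [h10', show (10 : ℕ) ≠ x by omega],
            by simp [hix, c2], by simp [c2, ht], g2⟩
        · simp only [Test.Holds, NatExpr.eval, h18, h12'] at ht
          exact ⟨k2, h18, h10', c2, fun h hpr => (f2 (by omega) hpr).2, g2⟩
      · rintro s₃ ⟨k3, h18, h10', c3, f3, g3⟩
        refine (Runs.seq (T := 4) (T' := B * (σ.time B + 60 + 15) + 11 + 20)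
          (Runs.setNat (Q := fun s' => s' = s₃.setN j 0 0 0) rfl) fun s₄ hs₄ =>
          Runs.seq (T' := 20) (Runs.forLE (b := 11) (T := σ.time B + 60) (by omega)
            (hs₄ ▸ (k3.setN hjN).nat_eq h11N |>.trans h11) hn
            (fun l s' => Keep N R s s' ∧ s'.nat (18, 0, 0) = k ∧ s'.nat (10, 0, 0) = m ∧
              s'.nat (i, 0, 0) = cnt k p ∧ (r ≤ k → p r → s'.nat (x, 0, 0) = cnt r p) ∧
              s'.nat (j, 0, 0) = cnt l q ∧
              (∀ k' < k, ∀ l < n, p k' → q l → s'.real (a, cnt k' p, cnt l q) = A k' l) ∧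
              ∀ l' < l, q l' → s'.real (a, cnt k p, cnt l' q) = A k l')
            ?_ ?_) ?_).mono (fun _ h => h) (by omega)
        · subst hs₄
          exact ⟨(k3.setN hjN).setN h19N, by simp [j18.symm, h18], by simp [j10.symm, h10'],
            by simp [i19, hij, c3], by simpa [x19, hjx.symm] using f3, by simp [j19], g3, by simp⟩
        · rintro l hl s₅ ⟨k5, h18, h10', c5, f5, d5, g5, e5⟩ h19 h11'
          have hq := hσ s₅ (k5.mono hNN hRR) (by rwa [h19])
          rw [h19] at hq
          refine (Runs.ifProg (B := B) (T := 25) (T' := 1) hwf (by rwa [h10']) (by rwa [h11'])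
            (fun s₆ h6 hf => ?_) (fun s₆ h6 hf => Runs.skip ?_)).mono (fun _ h => h) (by omega)
          · rw [hq] at hf
            have k6 : Keep N R s s₆ := k5.trans (h6.keep (fun b hb => by have := hb.1; omega)
              fun b hb => hb.1)
            refine (Runs.seq (Runs.setReal (Q := fun s' => s' =
              s₆.setR a (cnt k p) (cnt l q) (A k l)) ?_) (fun s₇ hs₇ => Runs.setNat ?_)).mono
              (fun _ h => h) (by simp [NatExpr.cost, RealExpr.cost])
            · simp only [NatExpr.eval, RealExpr.eval]
              rw [h6.nat_reg (by omega), h6.nat_reg (by omega), h6.nat_reg (by omega),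
                h6.nat_reg (by omega), h18, h19, c5, d5, k6.real_eq (hRR rfl), hA]
            · subst hs₇
              simp only [NatExpr.eval, State.setR_nat]
              rw [h6.nat_reg (by omega), d5]
              refine ⟨?_, ?_, ((k6.setR haR).setN hjN).setN h19N, ?_, ?_, ?_, ?_, ?_, ?_, ?_⟩
              · simp [j19.symm, h6.nat_reg, h19]
              · simp [j11.symm, h6.nat_reg, h11']
              · simp [j18.symm, h6.nat_reg, h18]
              · simp [j10.symm, h6.nat_reg, h10']
              · simp [i19, hij, h6.nat_reg (a := i) (by omega), c5]
              · simpa [x19, hjx.symm, h6.nat_reg (a := x) (by omega)] using f5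
              · simp [j19, cnt_succ, hf]
              · intro k' hk' l' hl' hpk hql
                -- Ranks of different selected rows differ, so entries written earlier are not
                -- overwritten.
                have : cnt k' p ≠ cnt k p := fun h => hk'.ne (cnt_inj hpk hb h)
                simp [this, h6.real_cell ha, g5 k' hk' l' hl' hpk hql]
              · intro l' hl' hql
                rcases Nat.lt_succ_iff_lt_or_eq.1 hl' with hl' | rfl
                · have : cnt l' q ≠ cnt l q := fun h => hl'.ne (cnt_inj hql hf h)
                  simp [this, h6.real_cell ha, e5 l' hl' hql]
                · simp
          · rw [hq] at hf
            have k6 : Keep N R s s₆ := k5.trans (h6.keep (fun b hb => by have := hb.1; omega)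
              fun b hb => hb.1)
            refine ⟨?_, ?_, k6.setN h19N, ?_, ?_, ?_, ?_, ?_, ?_, ?_⟩
            · simp [h6.nat_reg, h19]
            · simp [h6.nat_reg, h11']
            · simp [h6.nat_reg, h18]
            · simp [h6.nat_reg, h10']
            · simp [i19, h6.nat_reg (a := i) (by omega), c5]
            · simpa [x19, h6.nat_reg (a := x) (by omega)] using f5
            · simp [j19, cnt_succ, hf, h6.nat_reg (a := j) (by omega), d5]
            · intro k' hk' l' hl' hpk hql
              simp [h6.real_cell ha, g5 k' hk' l' hl' hpk hql]
            · intro l' hl' hql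
              rcases Nat.lt_succ_iff_lt_or_eq.1 hl' with hl' | rfl
              · simp [h6.real_cell ha, e5 l' hl' hql]
              · exact absurd hql hf
        · rintro s₈ ⟨k8, h18, h10', c8, f8, d8, g8, e8⟩
          refine (Runs.setNat ?_).mono (fun _ h => h) (by simp [NatExpr.cost])
          simp only [NatExpr.eval]
          refine ⟨by simp [i18.symm, h18], by simp [i10.symm, h10'], (k8.setN hiN).setN h18N,
            by simp [i18, cnt_succ, hb, c8], fun hrk hpr => ?_, ?_⟩
          · simp [j18, x18, hij.symm, hix.symm, d8, f8 (by omega) hpr]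
          · intro k' hk' l hl hpk hql
            rcases Nat.lt_succ_iff_lt_or_eq.1 hk' with hk' | rfl
            · exact g8 k' hk' l hl hpk hql
            · exact e8 l hl hql
    · rw [hp] at hb
      refine ⟨h18, h10', k2.setN h18N, by simp [i18, cnt_succ, hb, c2], fun hrk hpr => ?_, ?_⟩
      · have : r ≠ k := fun h => hb (h ▸ hpr)
        simpa [j18, x18] using f2 (by omega) hpr
      · intro k' hk' l hl hpk hql
        rcases Nat.lt_succ_iff_lt_or_eq.1 hk' with hk' | rfl
        · exact g2 k' hk' l hl hpk hql
        · exact absurd hpk hb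
  · simp only [NatExpr.cost, extractTime]
    omega

end RealRAM

namespace RealRAM

/-- The state has the answer `1` and outputs two matrices that exhibit `S` as a 2-product. -/
def Found {m n : ℕ} (S : Matrix (Fin m) (Fin n) ℝ) (s : State) : Prop :=
  s.answer = 1 ∧ ∃ (m₁ n₁ m₂ n₂ : ℕ) (S₁ : Matrix (Fin m₁) (Fin n₁) ℝ) (x₁ : Fin m₁)
    (S₂ : Matrix (Fin m₂) (Fin n₂) ℝ) (y₁ : Fin m₂),
    s.Outputs S₁ x₁ S₂ y₁ ∧ IsTwoProductOf S S₁ x₁ S₂ y₁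

theorem Found.of_keep {m n : ℕ} {S : Matrix (Fin m) (Fin n) ℝ} {s s' : State} {N R : Set ℕ}
    (h : Found S s) (hk : Keep N R s s') (hN : ∀ a < 7, a ∈ N) (hR : ∀ a < 3, a ∈ R) :
    Found S s' := by
  obtain ⟨h1, m₁, n₁, m₂, n₂, S₁, x₁, S₂, y₁, ⟨o1, o2, o3, o4, o5, o6, o7, o8⟩, h2⟩ := h
  have e : ∀ a < 7, s'.nat (a, 0, 0) = s.nat (a, 0, 0) := fun a ha => hk.nat_eq (hN a ha)
  refine ⟨(e 0 (by omega)).trans h1, m₁, n₁, m₂, n₂, S₁, x₁, S₂, y₁,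
    ⟨(e 1 (by omega)).trans o1, (e 2 (by omega)).trans o2, (e 3 (by omega)).trans o3,
    (e 4 (by omega)).trans o4, (e 5 (by omega)).trans o5, (e 6 (by omega)).trans o6, ?_, ?_⟩, h2⟩
  · rw [← o7]
    ext i j
    exact hk.real_eq (hR 1 (by omega))
  · rw [← o8]
    ext i j
    exact hk.real_eq (hR 2 (by omega))

theorem View.keep {m n r w : ℕ} {A : ℕ → ℕ → ℝ} {lab : ℕ → ℕ} {s s' : State}
    (h : View m n r w A lab s) (hk : Keep {b | 7 ≤ b ∧ b < 18} {0} s s') :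
    View m n r w A lab s' :=
  ⟨(hk.nat_eq (by simp)).trans h.rows, (hk.nat_eq (by simp)).trans h.cols,
    (hk.nat_eq (by simp)).trans h.special, (hk.nat_eq (by simp)).trans h.row,
    fun i j => (hk.real_eq (by simp)).trans (h.entries i j),
    fun x hx => (hk.nat_eq (by simp)).trans (h.labels x hx)⟩

/-- Output the two factors. -/
def outProg : Program :=
  .seq (setReg 0 (.lit 1)) <|
  .seq (extractProg leftT (selF leftT 14 15 20 19) 1 1 2 5) <|
  extractProg rightT (selF rightT 16 17 20 19) 2 3 4 6

/-- A bound for the running time of `outProg`. -/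
def outTime (B : ℕ) : ℕ :=
  4 + (extractTime leftT (selF leftT 14 15 20 19) B + extractTime rightT (selF rightT 16 17 20 19) B)

theorem runs_outProg {m n r w B : ℕ} {S : Matrix (Fin m) (Fin n) ℝ} {A : ℕ → ℕ → ℝ} {lab : ℕ → ℕ}
    {s : State} (hS : ∀ i j, S i j = A i j) (hv : View m n r w A lab s) (hm : m ≤ B) (hn : n ≤ B)
    (hr : r < m) (hw : w < m)
    (h : Splits A m n r (LeftRow lab r w) (RightRow lab w)
      (Sel A m n r (LeftRow lab r w) (s.nat (14, 0, 0)) (s.nat (15, 0, 0)))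
      (Sel A m n r (RightRow lab w) (s.nat (16, 0, 0)) (s.nat (17, 0, 0)))) :
    Runs outProg s (fun s' => Found S s' ∧ Keep {b | 7 ≤ b ∧ b < 18} {0} s s') (outTime B) := by
  set p₁ := LeftRow lab r w with hp₁
  set p₂ := RightRow lab w with hp₂
  set q₁ := Sel A m n r p₁ (s.nat (14, 0, 0)) (s.nat (15, 0, 0)) with hq₁
  set q₂ := Sel A m n r p₂ (s.nat (16, 0, 0)) (s.nat (17, 0, 0)) with hq₂
  have hN : ∀ i j x, i < 7 → j < 7 → x < 7 →
      {b | 7 ≤ b ∧ b < 18} ⊆ {b | b < 18 ∧ b ≠ i ∧ b ≠ j ∧ b ≠ x} := by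
    rintro i j x hi hj hx b ⟨h1, h2⟩
    exact ⟨h2, by omega, by omega, by omega⟩
  have hR : ∀ a, 0 ≠ a → {0} ⊆ {b | b < 20 ∧ b ≠ a} := by
    rintro a ha _ rfl
    exact ⟨by omega, ha⟩
  refine Runs.seq (T := 4) (Runs.setNat (Q := fun s' => s' = s.setN 0 0 0 1) rfl) fun s₁ hs₁ => ?_
  have k1 : Keep {b | 7 ≤ b ∧ b < 18} {0} s s₁ := hs₁ ▸ (Keep.refl _ _ _).setN (by simp)
  have hv1 := hv.keep k1
  refine Runs.seq (runs_extractProg (p := p₁) (q := q₁) (by omega) (by omega) (by omega) (by omega)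
    (by omega) (by omega) (by omega) (by omega) wf_selF_left hv1.rows hv1.cols hv1.special
    hv1.entries hm hn (fun s' hk h18 => (hv1.keep hk).holds_leftT hw h18) fun s' hk h19 => ?_)
    fun s₂ hs₂ => ?_
  · rw [((hv1.keep hk).holds_selF hw le_rfl (by omega) (by omega) (by omega)).1, hq₁,
      (k1.trans hk).nat_eq (a := 14) (by simp), (k1.trans hk).nat_eq (a := 15) (by simp)]
  · obtain ⟨l2, i2, j2, e2⟩ := hs₂
    have k2 := k1.trans (l2.mono (hN 1 2 5 (by omega) (by omega) (by omega)) (hR 1 (by omega)))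
    have hv2 := hv.keep k2
    refine (runs_extractProg (p := p₂) (q := q₂) (by omega) (by omega) (by omega) (by omega)
      (by omega) (by omega) (by omega) (by omega) wf_selF_right hv2.rows hv2.cols hv2.special
      hv2.entries hm hn (fun s' hk h18 => (hv2.keep hk).holds_rightT hw h18) fun s' hk h19 => ?_).mono
      (fun s₃ hs₃ => ?_) le_rfl
    · rw [((hv2.keep hk).holds_selF hw le_rfl (by omega) (by omega) (by omega)).2, hq₂,
        (k2.trans hk).nat_eq (a := 16) (by simp), (k2.trans hk).nat_eq (a := 17) (by simp)]
    · obtain ⟨l3, i3, j3, e3⟩ := hs₃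
      refine ⟨⟨?_, cnt m p₁, cnt n q₁, cnt m p₂, cnt n q₂, s₃.matrix 1 _ _,
        numbering m p₁ ⟨⟨r, hr⟩, h.left_special⟩, s₃.matrix 2 _ _,
        numbering m p₂ ⟨⟨r, hr⟩, h.right_special⟩, ⟨?_, ?_, ?_, ?_, ?_, ?_, rfl, rfl⟩,
        h.isTwoProductOf hr hS ?_ ?_⟩,
        k2.trans (l3.mono (hN 3 4 6 (by omega) (by omega) (by omega)) (hR 2 (by omega)))⟩
      · rw [State.answer, l3.nat_eq (by simp), l2.nat_eq (by simp), hs₁]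
        simp
      · rw [l3.nat_eq (by simp), i2]
      · rw [l3.nat_eq (by simp), (j2 hr h.left_special).1]
      · exact i3
      · exact (j3 hr h.right_special).1
      · rw [l3.nat_eq (by simp), (j2 hr h.left_special).2]
        rfl
      · exact (j3 hr h.right_special).2
      · intro i j
        exact (l3.real_eq (by simp)).trans (e2 i.1 i.1.2 j.1 j.1.2 i.2 j.2)
      · intro i j
        exact e3 i.1 i.1.2 j.1 j.1.2 i.2 j.2

/-! ### Exhaustive search by nested loops -/

/-- The input `S` is intact, and its numbers of rows and columns are in the registers `10`, `11`. -/
structure Intact {m n : ℕ} (S : Matrix (Fin m) (Fin n) ℝ) (s : State) : Prop where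
  rows : s.nat (10, 0, 0) = m
  cols : s.nat (11, 0, 0) = n
  entries : ∀ i j, s.real (0, i, j) = (input S).real (0, i, j)

/-- A program that searches for a condition `G`, changing only registers with numbers above `a`: it
preserves a valid output, and produces one if `G` holds. -/
def Searches {m n : ℕ} (S : Matrix (Fin m) (Fin n) ℝ) (a : ℕ) (P : Program) (G : State → Prop)
    (T : ℕ) : Prop :=
  (∀ s s' : State, (∀ c, 10 ≤ c → c ≤ a → s'.nat (c, 0, 0) = s.nat (c, 0, 0)) → G s → G s') ∧
  ∀ s, Intact S s → (s.answer = 0 ∨ Found S s) → Runs P s (fun s' => Intact S s' ∧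
    (∀ c, 10 ≤ c → c ≤ a → s'.nat (c, 0, 0) = s.nat (c, 0, 0)) ∧
    (s'.answer = 0 ∨ Found S s') ∧ (Found S s ∨ G s → Found S s')) T

theorem Found.setN {m n : ℕ} {S : Matrix (Fin m) (Fin n) ℝ} {s : State} {a x : ℕ}
    (h : Found S s) (ha : 7 ≤ a) : Found S (s.setN a 0 0 x) :=
  h.of_keep (N := {b | b < 7}) (R := {b | b < 3})
    ((Keep.refl _ _ _).setN (by simpa using ha)) (fun _ h => h) (fun _ h => h)

theorem Intact.setN {m n : ℕ} {S : Matrix (Fin m) (Fin n) ℝ} {s : State} {a x : ℕ}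
    (h : Intact S s) (ha : 12 ≤ a) : Intact S (s.setN a 0 0 x) := by
  have h10 : 10 ≠ a := by omega
  have h11 : 11 ≠ a := by omega
  exact ⟨by simp [h10, h.rows], by simp [h11, h.cols], h.entries⟩

/-- A loop adds a bounded existential quantifier to the condition searched for: an iteration that
succeeds leaves a valid output, which all later ones preserve or replace by a valid one. The first
part of `Searches` transfers `G` to the state actually reached in iteration `k`. -/
theorem Searches.for {m n : ℕ} {S : Matrix (Fin m) (Fin n) ℝ} {a b N B : ℕ} {P : Program}
    {G : State → Prop} {T : ℕ} (h : Searches S (a + 1) P G T) (ha : 11 ≤ a)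
    (hb : b = 10 ∧ N = m ∨ b = 11 ∧ N = n) (hB : N ≤ B) :
    Searches S a (forProg (a + 1) b P) (fun s => ∃ k < N, G (s.setN (a + 1) 0 0 k))
      (B * (T + 15) + 11) := by
  have hbN : ∀ s, Intact S s → s.nat (b, 0, 0) = N := by
    rintro s hs
    rcases hb with ⟨rfl, rfl⟩ | ⟨rfl, rfl⟩
    · exact hs.rows
    · exact hs.cols
  have hba : b ≠ a + 1 := by omega
  have hb10 : 10 ≤ b ∧ b ≤ a := by omega
  constructor
  · rintro s s' hc ⟨k, hk, hG⟩
    refine ⟨k, hk, h.1 _ _ (fun c h1 h2 => ?_) hG⟩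
    by_cases hca : c = a + 1
    · simp [hca]
    · simp [hca, hc c h1 (by omega)]
  · intro s hs hsf
    have hans : ∀ (s : State) (x : ℕ), (s.setN (a + 1) 0 0 x).answer = s.answer := fun s x => by
      simp [State.answer]
    refine (Runs.forLE hba (hbN s hs) hB (fun k s' => Intact S s' ∧
      (∀ c, 10 ≤ c → c ≤ a → s'.nat (c, 0, 0) = s.nat (c, 0, 0)) ∧
      (s'.answer = 0 ∨ Found S s') ∧
      (Found S s ∨ (∃ k' < k, G (s.setN (a + 1) 0 0 k')) → Found S s')) ?_ ?_)
    · refine ⟨hs.setN (by omega), fun c h1 h2 => ?_, ?_, ?_⟩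
      · have : c ≠ a + 1 := by omega
        simp [this]
      · rw [hans]
        exact hsf.imp_right fun h => h.setN (by omega)
      · rintro (h | ⟨k, hk, -⟩)
        · exact h.setN (by omega)
        · exact absurd hk (Nat.not_lt_zero _)
    · rintro k hk s₁ ⟨h1, h2, h3, h4⟩ h5 h6
      refine (h.2 s₁ h1 h3).mono (fun s₂ ⟨g1, g2, g3, g4⟩ => ?_) le_rfl
      refine ⟨(g2 _ (by omega) le_rfl).trans h5, (g2 _ hb10.1 (by omega)).trans h6,
        g1.setN (by omega), fun c hc hc' => ?_, ?_, ?_⟩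
      · have : c ≠ a + 1 := by omega
        simp [this, g2 c hc (by omega), h2 c hc hc']
      · rw [hans]
        exact g3.imp_right fun h => h.setN (by omega)
      · intro hor
        refine Found.setN (g4 ?_) (by omega)
        rcases hor with hor | ⟨k', hk', hG⟩
        · exact Or.inl (h4 (Or.inl hor))
        · rcases Nat.lt_succ_iff_lt_or_eq.1 hk' with hk' | rfl
          · exact Or.inl (h4 (Or.inr ⟨k', hk', hG⟩))
          · refine Or.inr (h.1 _ _ (fun c hc hc' => ?_) hG)
            by_cases hca : c = a + 1
            · simp [hca, h5]
            · simp [hca, h2 c hc (by omega)]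

/-- The condition searched for: the registers `12`, …, `17` determine a splitting. -/
def Succeeds {m n : ℕ} (S : Matrix (Fin m) (Fin n) ℝ) (r w t₀ t₁ s₀ s₁ : ℕ) : Prop :=
  let A := fun i j => (input S).real (0, i, j)
  (r < m ∧ w < m) ∧ Splits A m n r (LeftRow (labels A n r m) r w) (RightRow (labels A n r m) w)
    (Sel A m n r (LeftRow (labels A n r m) r w) t₀ t₁)
    (Sel A m n r (RightRow (labels A n r m) w) s₀ s₁)

/-- Try the candidate given by the registers `12`, …, `17`. -/
def tryProg : Program := .seq tableProg (ifProg splitsF outProg .skip)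

/-- A bound for the running time of `tryProg`. -/
def tryTime (B : ℕ) : ℕ := tableTime B + (splitsF.time B + outTime B + 1 + 20)

/-- If the test fails, only the table, loop counters and scratch cells have changed, so an earlier
output survives. If it succeeds, an output is written that is valid by itself. -/
theorem searches_tryProg {m n B : ℕ} (S : Matrix (Fin m) (Fin n) ℝ) (hm : m ≤ B) (hn : n ≤ B) :
    Searches S 17 tryProg (fun s => Succeeds S (s.nat (12, 0, 0)) (s.nat (13, 0, 0))
      (s.nat (14, 0, 0)) (s.nat (15, 0, 0)) (s.nat (16, 0, 0)) (s.nat (17, 0, 0))) (tryTime B) := by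
  constructor
  · intro s s' hc h
    simpa only [hc 12 (by omega) (by omega), hc 13 (by omega) (by omega),
      hc 14 (by omega) (by omega), hc 15 (by omega) (by omega), hc 16 (by omega) (by omega),
      hc 17 (by omega) (by omega)] using h
  · intro s hs hsf
    set A : ℕ → ℕ → ℝ := fun i j => (input S).real (0, i, j) with hA
    have hSA : ∀ i j, S i j = A i j := fun i j => by simp [hA, input]
    refine Runs.seq (runs_tableProg hs.rows hs.cols rfl hs.entries hm hn) ?_
    rintro s₁ ⟨k1, l1⟩
    have hv : View m n (s.nat (12, 0, 0)) (s.nat (13, 0, 0)) A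
        (labels A n (s.nat (12, 0, 0)) m) s₁ :=
      ⟨(k1.nat_eq (by simp)).trans hs.rows, (k1.nat_eq (by simp)).trans hs.cols,
        k1.nat_eq (by simp), k1.nat_eq (by simp),
        fun i j => (k1.real_eq (by simp)).trans (hs.entries i j), l1 m le_rfl⟩
    have hsp := hv.holds_splitsF
    rw [k1.nat_eq (a := 14) (by simp), k1.nat_eq (a := 15) (by simp),
      k1.nat_eq (a := 16) (by simp), k1.nat_eq (a := 17) (by simp)] at hsp
    refine Runs.ifProg (B := B) wf_splitsF (by rwa [hv.rows]) (by rwa [hv.cols])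
      (fun s₂ h2 hf => ?_) (fun s₂ h2 hf => Runs.skip ?_)
    · have k2 : Keep {b | 7 ≤ b ∧ b < 18} {0} s₁ s₂ :=
        h2.keep (fun b hb => by have := hb.2; omega) (by simp)
      have hv2 := hv.keep k2
      obtain ⟨⟨hr, hw⟩, hspl⟩ := hsp.1 hf
      refine (runs_outProg (S := S) hSA hv2 hm hn hr hw ?_).mono ?_ le_rfl
      · rwa [k2.nat_eq (a := 14) (by simp), k2.nat_eq (a := 15) (by simp),
          k2.nat_eq (a := 16) (by simp), k2.nat_eq (a := 17) (by simp),
          k1.nat_eq (a := 14) (by simp), k1.nat_eq (a := 15) (by simp),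
          k1.nat_eq (a := 16) (by simp), k1.nat_eq (a := 17) (by simp)]
      · rintro s₃ ⟨hF, k3⟩
        have hv3 := hv2.keep k3
        refine ⟨⟨hv3.rows, hv3.cols, hv3.entries⟩, fun c hc hc' => ?_, Or.inr hF, fun _ => hF⟩
        rw [(k2.trans k3).nat_eq ⟨by omega, by omega⟩, k1.nat_eq ⟨by omega, by omega⟩]
    · have k2 : Keep {a | a < 18 ∧ a ≠ 7} {a | a < 20} s s₂ :=
        k1.trans (h2.keep (fun b hb => by have := hb.1; omega) (fun b hb => hb))
      have hfound : Found S s → Found S s₂ := fun h =>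
        h.of_keep k2 (fun a ha => ⟨by omega, by omega⟩) (fun a ha => (by omega : a < 20))
      refine ⟨⟨(k2.nat_eq (by simp)).trans hs.rows, (k2.nat_eq (by simp)).trans hs.cols,
        fun i j => (k2.real_eq (by simp)).trans (hs.entries i j)⟩,
        fun c hc hc' => k2.nat_eq ⟨by omega, by omega⟩, ?_, ?_⟩
      · refine hsf.imp (fun h => ?_) hfound
        rw [State.answer, k2.nat_eq (by simp)]
        exact h
      · rintro (h | h)
        · exact hfound h
        · exact absurd (hsp.2 h) hf

/-- The algorithm: try all candidates. -/
def mainProg : Program :=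
  .seq (setReg 10 (reg 0)) <| .seq (setReg 11 (reg 1)) <| .seq (setReg 0 (.lit 0)) <|
  forProg 12 10 <| forProg 13 10 <| forProg 14 11 <| forProg 15 11 <| forProg 16 11 <|
  forProg 17 11 tryProg

/-- A bound for the running time of a loop. -/
def loopTime (f : ℕ → ℕ) (B : ℕ) : ℕ := B * (f B + 15) + 11

theorem PolyBdd.loopTime {f : ℕ → ℕ} (hf : PolyBdd f) : PolyBdd (loopTime f) :=
  (PolyBdd.id.mul (hf.add (.const 15))).add (.const 11)

theorem polyBdd_extractTime (ρ : ℕ → Test) (σ : Fm) : PolyBdd (extractTime ρ σ) :=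
  (PolyBdd.id.mul (((((PolyBdd.id.mul ((σ.polyBdd_time.add (.const 60)).add (.const 15))).add
    (.const 100)).add (.const _)).add (.const 15)))).add (.const 50)

theorem polyBdd_tryTime : PolyBdd tryTime := by
  have h1 : PolyBdd tableTime :=
    ((PolyBdd.id.mul (.const (30 + 15))).add (.const 11)).add
      ((PolyBdd.id.mul (((PolyBdd.id.mul ((((stepF.polyBdd_time.add (.const 30)).add (.const 30)).add
        (.const 20)).add (.const 15))).add (.const 11)).add (.const 15))).add (.const 11))
  have h2 : PolyBdd outTime :=
    (PolyBdd.const 4).add ((polyBdd_extractTime _ _).add (polyBdd_extractTime _ _))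
  exact h1.add (((splitsF.polyBdd_time.add h2).add (.const 1)).add (.const 20))

end RealRAM

open RealRAM in
theorem runs_mainProg {m n : ℕ} (S : Matrix (Fin m) (Fin n) ℝ) :
    Runs mainProg (input S) (fun s => (s.answer = 0 ∨ Found S s) ∧ (IsTwoProduct S → Found S s))
      (6 + (6 + (4 + loopTime (loopTime (loopTime (loopTime (loopTime (loopTime tryTime)))))
        (m + n)))) := by
  have hm : m ≤ m + n := by omega
  have hn : n ≤ m + n := by omega
  have hsearch := (((((((searches_tryProg S hm hn).for (a := 16) (by omega) (Or.inr ⟨rfl, rfl⟩)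
    hn).for (a := 15) (by omega) (Or.inr ⟨rfl, rfl⟩) hn).for (a := 14) (by omega)
    (Or.inr ⟨rfl, rfl⟩) hn).for (a := 13) (by omega) (Or.inr ⟨rfl, rfl⟩) hn).for (a := 12)
    (by omega) (Or.inl ⟨rfl, rfl⟩) hm).for (a := 11) (by omega) (Or.inl ⟨rfl, rfl⟩) hm).2
  -- The cells with the input dimensions are also output cells, so `m` and `n` are first moved to
  -- the registers `10` and `11` and the answer is cleared.
  refine Runs.seq (Runs.setNat (Q := fun s => s = (input S).setN 10 0 0 m) ?_) ?_
  · simp [NatExpr.eval, input]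
  rintro s₁ rfl
  refine Runs.seq (Runs.setNat (Q := fun s => s = ((input S).setN 10 0 0 m).setN 11 0 0 n) ?_) ?_
  · simp [NatExpr.eval, input]
  rintro s₂ rfl
  refine Runs.seq (T := 4) (Runs.setNat (Q := fun s =>
    s = (((input S).setN 10 0 0 m).setN 11 0 0 n).setN 0 0 0 0) rfl) ?_
  rintro s₃ rfl
  refine (hsearch ((((input S).setN 10 0 0 m).setN 11 0 0 n).setN 0 0 0 0) ⟨by simp, by simp, fun i j => rfl⟩ (Or.inl (by simp [State.answer]))).mono
    (fun s hs => ⟨hs.2.2.1, fun h => hs.2.2.2 (Or.inr ?_)⟩) le_rfl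
  obtain ⟨r, hr, w, hw, t₀, ht₀, t₁, ht₁, s₀, hs₀, s₁, hs₁, hspl⟩ :=
    exists_splits (A := fun i j => (input S).real (0, i, j)) (by simp [input]) h
  refine ⟨r, hr, w, hw, t₀, ht₀, t₁, ht₁, s₀, hs₀, s₁, hs₁, ?_⟩
  simpa [Succeeds] using ⟨⟨hr, hw⟩, hspl⟩

/-- There is one program that, on every real `m × n` matrix `S`, halts after a number of steps that
is polynomial in `m` and `n`, answers whether `S` is a 2-product, and, if it is, outputs matrices
`S₁`, `S₂` with special rows `x₁`, `y₁` such that `S` is isomorphic to `(S₁, x₁) ⊗₂ (S₂, y₁)`. -/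
theorem mainTheorem4 :
    ∃ (P : RealRAM.Program) (C k : ℕ), ∀ (m n : ℕ) (S : Matrix (Fin m) (Fin n) ℝ),
      ∃ (s : RealRAM.State) (t : ℕ),
        RealRAM.Exec P (RealRAM.input S) s t ∧ t ≤ C * (m + n + 1) ^ k ∧
        (IsTwoProduct S →
          s.answer = 1 ∧
          ∃ (m₁ n₁ m₂ n₂ : ℕ) (S₁ : Matrix (Fin m₁) (Fin n₁) ℝ) (x₁ : Fin m₁)
            (S₂ : Matrix (Fin m₂) (Fin n₂) ℝ) (y₁ : Fin m₂),
            s.Outputs S₁ x₁ S₂ y₁ ∧ IsTwoProductOf S S₁ x₁ S₂ y₁) ∧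
        (¬ IsTwoProduct S → s.answer = 0) := by
  obtain ⟨C, k, hC⟩ := (RealRAM.PolyBdd.const 6).add ((RealRAM.PolyBdd.const 6).add
    ((RealRAM.PolyBdd.const 4).add
    RealRAM.polyBdd_tryTime.loopTime.loopTime.loopTime.loopTime.loopTime.loopTime))
  refine ⟨RealRAM.mainProg, C, k, fun m n S => ?_⟩
  obtain ⟨s, t, h1, h2, h3, h4⟩ := runs_mainProg S
  -- A found output is itself a proof that `S` is a 2-product; otherwise the answer is still 0.
  refine ⟨s, t, h1, h2.trans (hC (m + n)), h4, fun hS => h3.resolve_right ?_⟩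
  rintro ⟨-, m₁, n₁, m₂, n₂, S₁, x₁, S₂, y₁, -, h5⟩
  exact hS ⟨m₁, n₁, m₂, n₂, S₁, x₁, S₂, y₁, h5⟩
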